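/- Let $m>0$ and let $H=-i\alpha\cdot\nabla+m\beta$ be the free Dirac operator in $L^2(\mathbb R^3)^4$ with domain $H^1(\mathbb R^3)^4$, where $\alpha=(\alpha_1,\alpha_2,\alpha_3)$ and $\beta$ are the Dirac matrices. For $a\in\mathbb C\setminus\mathbb R$, with $\sqrt{m^2-a^2}$ chosen of positive real part, let $$\phi^a(x)=\frac{e^{-\sqrt{m^2-a^2}|x|}}{4\pi|x|}\Big(a+m\beta+\big(1+\sqrt{m^2-a^2}\,|x|\big)\,i\alpha\cdot\frac{x}{|x|^2}\Big),\qquad \Phi^a G=\int_{\mathbb R^3}\phi^a(\cdot-y)\,G(y)\,dy .$$ Let $\Omega\subset\mathbb R^3$ be a bounded $C^2$ domain, $\Sigma=\partial\Omega$, $\nu$ its outward unit normal, $\upsigma$ its surface measure, $W=-d\nu$ its Weingarten map, and $\Omega_\epsilon=\{x:\operatorname{dist}(x,\Sigma)<\epsilon\}$. For $V\in L^\infty(\mathbb R)$ real-valued with $\operatorname{supp}V\subset[-\eta,\eta]$ and $0<\epsilon\le\eta$, put $V_\epsilon(t)=\frac{\eta}{\epsilon}V(\frac{\eta t}{\epsilon})$,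 let $\mathbf V_\epsilon(x_\Sigma+t\nu(x_\Sigma))=V_\epsilon(t)$ for $(x_\Sigma,t)\in\Sigma\times(-\epsilon,\epsilon)$ and $\mathbf V_\epsilon=0$ outside $\Omega_\epsilon$, and set $$\mathbf u_\epsilon=|\mathbf V_\epsilon|^{1/2},\quad \mathbf v_\epsilon=\operatorname{sign}(\mathbf V_\epsilon)|\mathbf V_\epsilon|^{1/2},\quad u(t)=|\eta V(\eta t)|^{1/2},\quad v(t)=\operatorname{sign}(V(\eta t))\,u(t).$$ Let $H^e_\epsilon=H+\mathbf V_\epsilon$ and $H^s_\epsilon=H+\beta\mathbf V_\epsilon$, with domain $H^1(\mathbb R^3)^4$. Define $$(\mathcal I_\epsilon f)(x_\Sigma+t\nu(x_\Sigma))=f(x_\Sigma,t),\qquad (\mathcal S_\epsilon g)(x_\Sigma,t)=\epsilon^{-1/2}g(x_\Sigma,t/\epsilon),$$ as operators $\mathcal I_\epsilon:L^2(\Sigma\times(-\epsilon,\epsilon))^4\to L^2(\Omega_\epsilon)^4$ and $\mathcal S_\epsilon:L^2(\Sigma\times(-1,1))^4\to L^2(\Sigma\times(-\epsilon,\epsilon))^4$,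 and $$\begin{aligned} (A_\epsilon(a)g)(x)&=\int_{-1}^1\!\int_\Sigma\phi^a(x-y_\Sigma-\epsilon s\nu(y_\Sigma))\,v(s)\det(1-\epsilon sW(y_\Sigma))\,g(y_\Sigma,s)\,d\upsigma(y_\Sigma)\,ds,\\ (B_\epsilon(a)g)(x_\Sigma,t)&=u(t)\int_{-1}^1\!\int_\Sigma\phi^a(x_\Sigma+\epsilon t\nu(x_\Sigma)-y_\Sigma-\epsilon s\nu(y_\Sigma))\,v(s)\det(1-\epsilon sW(y_\Sigma))\,g(y_\Sigma,s)\,d\upsigma(y_\Sigma)\,ds,\\ (C_\epsilon(a)G)(x_\Sigma,t)&=u(t)\int_{\mathbb R^3}\phi^a(x_\Sigma+\epsilon t\nu(x_\Sigma)-y)\,G(y)\,dy . \end{aligned}$$ There is $\eta_0>0$, depending only on $\Omega$, such that for all $m>0$, $a\in\mathbb C\setminus\mathbb R$, $0<\eta\le\eta_0$, all real-valued $V\in L^\infty(\mathbb R)$ with $\operatorname{supp}V\subset[-\eta,\eta]$ and all $0<\epsilon\le\eta$: the map $(x_\Sigma,t)\mapsto x_\Sigma+t\nu(x_\Sigma)$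 is a bijection of $\Sigma\times(-\epsilon,\epsilon)$ onto $\Omega_\epsilon$; $\mathcal I_\epsilon$ is bounded with bounded inverse and $\mathcal S_\epsilon$ is unitary; $\Phi^a$ is bounded on $L^2(\mathbb R^3)^4$ and $A_\epsilon(a):L^2(\Sigma\times(-1,1))^4\to L^2(\mathbb R^3)^4$, $B_\epsilon(a):L^2(\Sigma\times(-1,1))^4\to L^2(\Sigma\times(-1,1))^4$, $C_\epsilon(a):L^2(\mathbb R^3)^4\to L^2(\Sigma\times(-1,1))^4$ are well defined (the integrals converge absolutely almost everywhere) and bounded; the identities $$A_\epsilon(a)=\Phi^a\,\mathbf v_\epsilon\,\mathcal I_\epsilon\,\mathcal S_\epsilon,\qquad B_\epsilon(a)=\mathcal S_\epsilon^{-1}\mathcal I_\epsilon^{-1}\,\mathbf u_\epsilon\,\Phi^a\,\mathbf v_\epsilon\,\mathcal I_\epsilon\,\mathcal S_\epsilon,\qquad C_\epsilon(a)=\mathcal S_\epsilon^{-1}\mathcal I_\epsilon^{-1}\,\mathbf u_\epsilon\,\Phi^a$$ hold; $1+B_\epsilon(a)$ and $\beta+B_\epsilon(a)$ have bounded inverses;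 the bounded resolvents below exist, and $$(H^e_\epsilon-a)^{-1}=(H-a)^{-1}-A_\epsilon(a)\big(1+B_\epsilon(a)\big)^{-1}C_\epsilon(a),$$ $$(H^s_\epsilon-a)^{-1}=(H-a)^{-1}-A_\epsilon(a)\big(\beta+B_\epsilon(a)\big)^{-1}C_\epsilon(a).$$ -/

import Mathlib

open MeasureTheory Set Filter Topology
open scoped ENNReal SchwartzMap LineDeriv

noncomputable section

namespace DiracShell

/-- Physical space `ℝ³` with its Euclidean norm. -/
abbrev E3 : Type := EuclideanSpace ℝ (Fin 3)

/-- Spinors, `ℂ⁴`. -/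
abbrev Spinor : Type := EuclideanSpace ℂ (Fin 4)

/-! ### Dirac matrices -/

/-- The Dirac matrices `α₁, α₂, α₃` (off-diagonal blocks are the Pauli matrices). -/
def alphaMat : Fin 3 → Matrix (Fin 4) (Fin 4) ℂ :=
  ![!![0, 0, 0, 1;
       0, 0, 1, 0;
       0, 1, 0, 0;
       1, 0, 0, 0],
    !![0, 0, 0, -Complex.I;
       0, 0, Complex.I, 0;
       0, -Complex.I, 0, 0;
       Complex.I, 0, 0, 0],
    !![0, 0, 1, 0;
       0, 0, 0, -1;
       1, 0, 0, 0;
       0, -1, 0, 0]]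

/-- The Dirac matrix `β = diag (1, 1, -1, -1)`. -/
def betaMat : Matrix (Fin 4) (Fin 4) ℂ :=
  Matrix.diagonal ![1, 1, -1, -1]

/-- A `4 × 4` matrix acting on spinors. -/
abbrev act (M : Matrix (Fin 4) (Fin 4) ℂ) : Spinor →L[ℂ] Spinor :=
  Matrix.toEuclideanCLM (𝕜 := ℂ) M

/-- A constant matrix acting pointwise on `L²(μ)⁴`. -/
def matOp {X : Type*} [MeasurableSpace X] (μ : Measure X) (M : Matrix (Fin 4) (Fin 4) ℂ) :
    Lp Spinor 2 μ →L[ℂ] Lp Spinor 2 μ :=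
  (act M).compLpL 2 μ

/-! ### The free Dirac operator -/

/-- `L²(ℝ³)⁴`. -/
abbrev L2R3 : Type := Lp Spinor 2 (volume : Measure E3)

/-- The Sobolev space `H¹(ℝ³)⁴`, as a subspace of `L²(ℝ³)⁴`. -/
def sobolevH1 : Submodule ℂ L2R3 where
  carrier := {F | TemperedDistribution.MemSobolev 1 2 (F : 𝓢'(E3, Spinor))}
  add_mem' {F G} hF hG := by
    have h : ((F + G : L2R3) : 𝓢'(E3, Spinor)) = (F : 𝓢'(E3, Spinor)) + G :=
      map_add (Lp.toTemperedDistributionCLM Spinor (volume : Measure E3) 2) F G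
    simpa only [Set.mem_ofPred_eq, h] using
      TemperedDistribution.MemSobolev.add (hf := hF) (hg := hG)
  zero_mem' := by
    have h : ((0 : L2R3) : 𝓢'(E3, Spinor)) = 0 :=
      map_zero (Lp.toTemperedDistributionCLM Spinor (volume : Measure E3) 2)
    simpa only [Set.mem_ofPred_eq, h] using
      TemperedDistribution.memSobolev_fun_zero (E := E3) (F := Spinor) 1 2
  smul_mem' c F hF := by
    have h : ((c • F : L2R3) : 𝓢'(E3, Spinor)) = c • (F : 𝓢'(E3, Spinor)) :=
      map_smul (Lp.toTemperedDistributionCLM Spinor (volume : Measure E3) 2) c F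
    simpa only [Set.mem_ofPred_eq, h] using
      TemperedDistribution.MemSobolev.smul c (hf := hF)

/-- The distributional partial derivative `∂ⱼF` of `F ∈ H¹(ℝ³)⁴` lies in `L²(ℝ³)⁴`. -/
theorem exists_weakPartial (j : Fin 3) (F : sobolevH1) :
    ∃ D : L2R3, ∂_{(EuclideanSpace.single j (1 : ℝ) : E3)} ((F : L2R3) : 𝓢'(E3, Spinor)) =
      (D : 𝓢'(E3, Spinor)) := by
  have h := TemperedDistribution.MemSobolev.lineDerivOp
    (m := (EuclideanSpace.single j (1 : ℝ) : E3)) (hf := F.2)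
  rw [sub_self, TemperedDistribution.memSobolev_zero_iff] at h
  exact h

theorem toTemperedDistribution_injective {D D' : L2R3}
    (h : (D : 𝓢'(E3, Spinor)) = (D' : 𝓢'(E3, Spinor))) : D = D' :=
  LinearMap.ker_eq_bot.mp
    (Lp.ker_toTemperedDistributionCLM_eq_bot (F := Spinor) (μ := (volume : Measure E3)) (p := 2)) h

/-- The weak partial derivative `∂ⱼ : H¹(ℝ³)⁴ → L²(ℝ³)⁴`. -/
def weakPartial (j : Fin 3) : sobolevH1 →ₗ[ℂ] L2R3 where
  toFun F := (exists_weakPartial j F).choose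
  map_add' F G := by
    apply toTemperedDistribution_injective
    rw [← (exists_weakPartial j (F + G)).choose_spec]
    have h : ((((F + G : sobolevH1) : L2R3)) : 𝓢'(E3, Spinor)) = ((F : L2R3) : 𝓢'(E3, Spinor)) + (G : L2R3) :=
      map_add (Lp.toTemperedDistributionCLM Spinor (volume : Measure E3) 2) (F : L2R3) G
    have h' := map_add (Lp.toTemperedDistributionCLM Spinor (volume : Measure E3) 2)
      (exists_weakPartial j F).choose (exists_weakPartial j G).choose
    simp only [Lp.toTemperedDistributionCLM_apply] at h'
    rw [h, h', LineDeriv.lineDerivOp_add]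
    exact congrArg₂ (· + ·) (exists_weakPartial j F).choose_spec
      (exists_weakPartial j G).choose_spec
  map_smul' c F := by
    apply toTemperedDistribution_injective
    rw [← (exists_weakPartial j (c • F)).choose_spec]
    have h : ((((c • F : sobolevH1) : L2R3)) : 𝓢'(E3, Spinor)) = c • ((F : L2R3) : 𝓢'(E3, Spinor)) :=
      map_smul (Lp.toTemperedDistributionCLM Spinor (volume : Measure E3) 2) c (F : L2R3)
    have h' := map_smul (Lp.toTemperedDistributionCLM Spinor (volume : Measure E3) 2)
      c (exists_weakPartial j F).choose
    simp only [Lp.toTemperedDistributionCLM_apply] at h'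
    rw [h, RingHom.id_apply, h', LineDeriv.lineDerivOp_smul]
    exact congrArg (c • ·) (exists_weakPartial j F).choose_spec

/-- The free Dirac operator `H = -i α·∇ + m β` with domain `H¹(ℝ³)⁴`. -/
def diracOp (m : ℝ) : L2R3 →ₗ.[ℂ] L2R3 where
  domain := sobolevH1
  toFun := (-Complex.I) • (∑ j, (matOp volume (alphaMat j)).toLinearMap ∘ₗ weakPartial j) +
    (m : ℂ) • ((matOp volume betaMat).toLinearMap ∘ₗ sobolevH1.subtype)

/-- The unbounded operator `T + M`, for a bounded operator `M`, with the domain of `T`. -/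
def perturb (T : L2R3 →ₗ.[ℂ] L2R3) (M : L2R3 →L[ℂ] L2R3) : L2R3 →ₗ.[ℂ] L2R3 :=
  M.toLinearMap +ᵥ T

/-- `R = (T - a)⁻¹`: the bounded operator `R` is a two-sided inverse of `T - a : D(T) → L²`. -/
def IsResolvent (T : L2R3 →ₗ.[ℂ] L2R3) (a : ℂ) (R : L2R3 →L[ℂ] L2R3) : Prop :=
  (∀ f : L2R3, ∃ g : T.domain, R f = g ∧ T g - a • (g : L2R3) = f) ∧
    ∀ g : T.domain, R (T g - a • (g : L2R3)) = g

/-- The fundamental solution `φᵃ` of `H - a`; `Complex.sqrt` is the principal square root, whose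
real part is positive off the half-line `(-∞, 0]`. -/
def fundSol (m : ℝ) (a : ℂ) (x : E3) : Matrix (Fin 4) (Fin 4) ℂ :=
  let κ : ℂ := Complex.sqrt ((m : ℂ) ^ 2 - a ^ 2)
  (Complex.exp (-κ * ‖x‖) / (4 * Real.pi * ‖x‖)) •
    (a • (1 : Matrix (Fin 4) (Fin 4) ℂ) + (m : ℂ) • betaMat +
      ((1 + κ * ‖x‖) * Complex.I / (‖x‖ : ℂ) ^ 2) • ∑ j, ((x j : ℝ) : ℂ) • alphaMat j)

/-! ### Geometry of the boundary -/

/-- Bounded `C²` domains: near each boundary point `Q`, in suitable Cartesian coordinates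
`e (y - Q)`, the set is the region strictly above the graph of a `C²` function and its boundary is
the graph. -/
structure IsC2Domain (Ω : Set E3) : Prop where
  isOpen : IsOpen Ω
  bounded : Bornology.IsBounded Ω
  chart : ∀ Q ∈ frontier Ω, ∃ r > 0, ∃ e : E3 ≃ₗᵢ[ℝ] E3,
    ∃ ψ : EuclideanSpace ℝ (Fin 2) → ℝ, ContDiff ℝ 2 ψ ∧
      ∀ y ∈ Metric.ball Q r,
        (y ∈ Ω ↔ ψ !₂[e (y - Q) 0, e (y - Q) 1] < e (y - Q) 2) ∧
        (y ∈ frontier Ω ↔ e (y - Q) 2 = ψ !₂[e (y - Q) 0, e (y - Q) 1])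

/-- `n` is the outward unit normal of `Ω` at the boundary point `x`: the normalized gradient at `x`
of a local defining function `ρ`, with `Ω = {ρ < 0}` near `x`. -/
def IsOutwardUnitNormal (Ω : Set E3) (x n : E3) : Prop :=
  ‖n‖ = 1 ∧ ∃ ρ : E3 → ℝ, ∃ c : ℝ, 0 < c ∧ ContDiffAt ℝ 1 ρ x ∧ ρ x = 0 ∧
    HasGradientAt ρ (c • n) x ∧ ∀ᶠ y in 𝓝 x, (y ∈ Ω ↔ ρ y < 0)

/-- The outward unit normal field `ν` (meaningful on `∂Ω`). -/
def normal (Ω : Set E3) (x : E3) : E3 :=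
  Classical.epsilon (IsOutwardUnitNormal Ω x)

/-- The tangent plane of `∂Ω` at `x`. -/
abbrev tangentPlane (Ω : Set E3) (x : E3) : Submodule ℝ E3 :=
  (Submodule.span ℝ {normal Ω x})ᗮ

/-- The Weingarten map `W(x) = -dν(x)` on the tangent plane of `∂Ω` at `x`. (The derivative of `ν`
along `∂Ω` is unique on tangent vectors, and tangential since `|ν| = 1`; the orthogonal projection
only restricts the codomain.) -/
def weingarten (Ω : Set E3) (x : E3) : tangentPlane Ω x →ₗ[ℝ] tangentPlane Ω x :=
  -((tangentPlane Ω x).orthogonalProjectionOnto.toLinearMap ∘ₗ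
    (fderivWithin ℝ (normal Ω) (frontier Ω) x).toLinearMap ∘ₗ (tangentPlane Ω x).subtype)

/-- The Jacobian factor `det (1 - t W(x))`. -/
def jac (Ω : Set E3) (t : ℝ) (x : E3) : ℝ :=
  LinearMap.det (1 - t • weingarten Ω x)

/-- Tubular coordinates `(x_Σ, t) ↦ x_Σ + t ν(x_Σ)`. -/
def tube (Ω : Set E3) (p : E3 × ℝ) : E3 :=
  p.1 + p.2 • normal Ω p.1

/-- `Σ × (-ε, ε)`. -/
def collar (Ω : Set E3) (ε : ℝ) : Set (E3 × ℝ) :=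
  frontier Ω ×ˢ Ioo (-ε) ε

/-- `Ω_ε = {x : d(x, Σ) < ε}`. -/
def shell (Ω : Set E3) (ε : ℝ) : Set E3 :=
  Metric.thickening ε (frontier Ω)

/-- Surface measure on `Σ = ∂Ω`: the two-dimensional Hausdorff measure, normalized so as to be
Lebesgue measure on planes, restricted to `Σ`. -/
def surfaceMeasure (Ω : Set E3) : Measure E3 :=
  (Measure.euclideanHausdorffMeasure 2).restrict (frontier Ω)

/-- The product of surface measure and Lebesgue measure on `Σ × (-ε, ε)`. -/
def cylMeasure (Ω : Set E3) (ε : ℝ) : Measure (E3 × ℝ) :=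
  (surfaceMeasure Ω).prod (volume.restrict (Ioo (-ε) ε))

/-- `L²(Σ × (-ε, ε))⁴`. -/
abbrev L2Cyl (Ω : Set E3) (ε : ℝ) : Type := Lp Spinor 2 (cylMeasure Ω ε)

/-- `L²(Ω_ε)⁴`. -/
abbrev L2Shell (Ω : Set E3) (ε : ℝ) : Type := Lp Spinor 2 (volume.restrict (shell Ω ε) : Measure E3)

/-! ### Potentials -/

/-- `V_ε(t) = (η/ε) V(η t/ε)`. -/
def scaledPot (V : ℝ → ℝ) (η ε t : ℝ) : ℝ :=
  η / ε * V (η * t / ε)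

open Classical in
/-- The short-range potential on `ℝ³`: `V_ε(t)` at `x_Σ + t ν(x_Σ) ∈ Ω_ε` with
`(x_Σ, t) ∈ Σ × (-ε, ε)`, and zero outside `Ω_ε`. -/
def shellPot (Ω : Set E3) (V : ℝ → ℝ) (η ε : ℝ) (x : E3) : ℝ :=
  if x ∈ shell Ω ε then
    scaledPot V η ε (Function.invFunOn (tube Ω) (collar Ω ε) x).2
  else 0

/-- `𝐮_ε = |𝐕_ε|^{1/2}`. -/
def shellU (Ω : Set E3) (V : ℝ → ℝ) (η ε : ℝ) (x : E3) : ℝ :=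
  Real.sqrt |shellPot Ω V η ε x|

/-- `𝐯_ε = sign(𝐕_ε) |𝐕_ε|^{1/2}`. -/
def shellV (Ω : Set E3) (V : ℝ → ℝ) (η ε : ℝ) (x : E3) : ℝ :=
  Real.sign (shellPot Ω V η ε x) * Real.sqrt |shellPot Ω V η ε x|

/-- `u(t) = |η V(η t)|^{1/2}`. -/
def profU (V : ℝ → ℝ) (η t : ℝ) : ℝ :=
  Real.sqrt |η * V (η * t)|

/-- `v(t) = sign(V(η t)) u(t)`. -/
def profV (V : ℝ → ℝ) (η t : ℝ) : ℝ :=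
  Real.sign (V (η * t)) * profU V η t

/-! ### Operators

Each predicate below determines the operator it describes. -/

/-- `T` is the integral operator `(T f)(y) = ∫ K(y, x) f(x) dμ(x)` from `L²(μ)⁴` to `L²(ν)⁴`, the
integral converging absolutely for almost every `y`. -/
def IsKernelOp {X Y : Type*} [MeasurableSpace X] [MeasurableSpace Y]
    {μ : Measure X} {ν : Measure Y} (K : Y → X → Matrix (Fin 4) (Fin 4) ℂ)
    (T : Lp Spinor 2 μ →L[ℂ] Lp Spinor 2 ν) : Prop :=
  ∀ f : Lp Spinor 2 μ, ∀ᵐ y ∂ν,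
    Integrable (fun x => act (K y x) (f x)) μ ∧ T f y = ∫ x, act (K y x) (f x) ∂μ

/-- `T` is multiplication by the real function `w`; if `w` vanishes outside a set, functions
given on that set are extended by zero, and with a smaller target functions are restricted. -/
def IsMulOp {X : Type*} [MeasurableSpace X] {μ ν : Measure X} (w : X → ℝ)
    (T : Lp Spinor 2 μ →L[ℂ] Lp Spinor 2 ν) : Prop :=
  ∀ f : Lp Spinor 2 μ, ∀ᵐ x ∂ν, T f x = (w x : ℂ) • f x

/-- `I` is `𝓘_ε`: `(𝓘_ε f)(x_Σ + t ν(x_Σ)) = f(x_Σ, t)`. -/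
def IsTubeOp {Ω : Set E3} {ε : ℝ} (I : L2Cyl Ω ε ≃L[ℂ] L2Shell Ω ε) : Prop :=
  ∀ f : L2Cyl Ω ε, ∀ᵐ p ∂(cylMeasure Ω ε), I f (tube Ω p) = f p

/-- `S` is `𝓢_ε`: `(𝓢_ε g)(x_Σ, t) = ε^{-1/2} g(x_Σ, t/ε)`. -/
def IsScalingOp {Ω : Set E3} {ε : ℝ} (S : L2Cyl Ω 1 ≃ₗᵢ[ℂ] L2Cyl Ω ε) : Prop :=
  ∀ g : L2Cyl Ω 1, ∀ᵐ p ∂(cylMeasure Ω ε),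
    S g p = (((Real.sqrt ε)⁻¹ : ℝ) : ℂ) • g (p.1, p.2 / ε)

/-- The kernel of `Φᵃ(·, 0)`. -/
def kerPhi (m : ℝ) (a : ℂ) (x y : E3) : Matrix (Fin 4) (Fin 4) ℂ :=
  fundSol m a (x - y)

/-- The kernel of `A_ε(a)`. -/
def kerA (Ω : Set E3) (V : ℝ → ℝ) (η ε m : ℝ) (a : ℂ) (x : E3) (q : E3 × ℝ) :
    Matrix (Fin 4) (Fin 4) ℂ :=
  ((profV V η q.2 * jac Ω (ε * q.2) q.1 : ℝ) : ℂ) •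
    fundSol m a (x - tube Ω (q.1, ε * q.2))

/-- The kernel of `B_ε(a)`. -/
def kerB (Ω : Set E3) (V : ℝ → ℝ) (η ε m : ℝ) (a : ℂ) (p q : E3 × ℝ) :
    Matrix (Fin 4) (Fin 4) ℂ :=
  ((profU V η p.2 * profV V η q.2 * jac Ω (ε * q.2) q.1 : ℝ) : ℂ) •
    fundSol m a (tube Ω (p.1, ε * p.2) - tube Ω (q.1, ε * q.2))

/-- The kernel of `C_ε(a)`. -/
def kerC (Ω : Set E3) (V : ℝ → ℝ) (η ε m : ℝ) (a : ℂ) (p : E3 × ℝ) (y : E3) :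
    Matrix (Fin 4) (Fin 4) ℂ :=
  (profU V η p.2 : ℂ) • fundSol m a (tube Ω (p.1, ε * p.2) - y)

end DiracShell

end

open DiracShell

noncomputable section

namespace DiracShell

/-! ### Resolvents of bounded perturbations -/

/-! Both resolvent formulae are instances of one algebraic fact, `IsResolvent.factorized`. Let `R`
and `R'` be the resolvents at `a` of `T` and `T + M`, and let `M = v b u` with `b² = 1`. The second
resolvent identity, used in both orders, shows that `b + u R v` is invertible with inverse `b - b u
R' v b`, and that `R' = R - R v (b + u R v)⁻¹ u R`. Here `T` is the free Dirac operator, `b = 1` in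
the electrostatic case and `b = β` in the scalar case, and `u`, `v` are `𝐮_ε`, `𝐯_ε` transported to
`Σ × (-1, 1)` by `𝓘_ε` and `𝓢_ε`. Hence no estimate on `B_ε(a)` is needed: the invertibility of `1 +
B` and `β + B` follows from the existence of the perturbed resolvents.

That existence is a substitute for self-adjointness. If the quadratic form of `T` is real, any
resolvent at a nonreal `a` has norm at most `1 / |Im a|`. A bounded perturbation with real form can
therefore be switched on in finitely many equal steps, each covered by a Neumann series
(`IsResolvent.exists_perturb`).

For the free operator, `(H - iy)(H + iy) = -Δ + m² + y²` is inverted by a Fourier multiplier, which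
gives the resolvent on the imaginary axis; a real shift reaches every nonreal `a`. Schwartz
functions form a core, on which the form is real by integration by parts. To see that convolution
with `φᵃ` is this resolvent, write `φᵃ = (-iα·∇ + mβ + a) G` with `G` the Yukawa potential of
exponent `κ = √(m² - a²)`. Then `φᵃ * (H - a)s = G * (κ² - Δ)s = s` for Schwartz `s`. The last
equality is obtained by replacing `|z|` with `√(|z|² + δ²)`, integrating by parts without a
singularity, and letting `δ → 0`.

The kernels of `A`, `B`, `C` come from the change of variables `y = x_Σ + t ν(x_Σ)`. Injectivity on
a thin collar rests on `|⟨y - x, ν(x)⟩| ≤ K |y - x|²` for `x, y ∈ Σ`, and surjectivity on nearest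
points. The Jacobian is computed in graph charts, where the surface measure, a Hausdorff measure, is
identified by differentiation of measures (`LocalChart.map_G_withDensity`). -/

/-- The quadratic form of `T` is real. -/
def RealForm (T : L2R3 →ₗ.[ℂ] L2R3) : Prop :=
  ∀ g : T.domain, (inner ℂ (g : L2R3) (T g)).im = 0

/-- The imaginary part of `⟨g, (T - a)g⟩` is `-Im a · ‖g‖²`, because the form of `T` contributes
none; Cauchy–Schwarz does the rest. -/
theorem RealForm.mul_norm_le {T : L2R3 →ₗ.[ℂ] L2R3} (hT : RealForm T) (a : ℂ) (g : T.domain) :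
    |a.im| * ‖(g : L2R3)‖ ≤ ‖T g - a • (g : L2R3)‖ := by
  by_cases hg : ‖(g : L2R3)‖ = 0
  · rw [hg, mul_zero]; exact norm_nonneg _
  have h1 : (inner ℂ (g : L2R3) (T g - a • (g : L2R3))).im = -(a.im * ‖(g : L2R3)‖ ^ 2) := by
    rw [inner_sub_right, inner_smul_right, inner_self_eq_norm_sq_to_K, Complex.sub_im, hT g]
    have : ((‖(g : L2R3)‖ : ℂ) ^ 2) = ((‖(g : L2R3)‖ ^ 2 : ℝ) : ℂ) := by push_cast; rfl
    change 0 - (a * ((‖(g : L2R3)‖ : ℂ) ^ 2)).im = _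
    rw [this, Complex.im_mul_ofReal]; ring
  have h2 : |a.im| * ‖(g : L2R3)‖ ^ 2 ≤ ‖(g : L2R3)‖ * ‖T g - a • (g : L2R3)‖ := by
    calc |a.im| * ‖(g : L2R3)‖ ^ 2 = |(inner ℂ (g : L2R3) (T g - a • (g : L2R3))).im| := by
          rw [h1, abs_neg, abs_mul, abs_of_nonneg (sq_nonneg ‖(g : L2R3)‖)]
      _ ≤ ‖inner ℂ (g : L2R3) (T g - a • (g : L2R3))‖ := Complex.abs_im_le_norm _
      _ ≤ _ := norm_inner_le_norm _ _
  have hpos : 0 < ‖(g : L2R3)‖ := lt_of_le_of_ne (norm_nonneg _) (Ne.symm hg)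
  nlinarith

theorem IsResolvent.opNorm_le {T : L2R3 →ₗ.[ℂ] L2R3} {a : ℂ} {R : L2R3 →L[ℂ] L2R3}
    (hR : IsResolvent T a R) (hT : RealForm T) (ha : a.im ≠ 0) : ‖R‖ ≤ |a.im|⁻¹ := by
  have hpos : 0 < |a.im| := abs_pos.mpr ha
  refine R.opNorm_le_bound (by positivity) fun f => ?_
  obtain ⟨g, hg, hf⟩ := hR.1 f
  have := hT.mul_norm_le a g
  rw [hf] at this
  rw [hg, inv_mul_eq_div, le_div_iff₀ hpos]
  linarith

theorem perturb_apply (T : L2R3 →ₗ.[ℂ] L2R3) (M : L2R3 →L[ℂ] L2R3) (g : T.domain) :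
    perturb T M g = M (g : L2R3) + T g := rfl

theorem perturb_zero (T : L2R3 →ₗ.[ℂ] L2R3) : perturb T 0 = T := zero_vadd _ T

theorem perturb_perturb (T : L2R3 →ₗ.[ℂ] L2R3) (M N : L2R3 →L[ℂ] L2R3) :
    perturb (perturb T M) N = perturb T (N + M) := by
  simp only [perturb, ContinuousLinearMap.toLinearMap_add, add_vadd]

theorem RealForm.perturb {T : L2R3 →ₗ.[ℂ] L2R3} (hT : RealForm T) {M : L2R3 →L[ℂ] L2R3}
    (hM : ∀ g, (inner ℂ g (M g)).im = 0) : RealForm (perturb T M) := by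
  intro g
  have h : (inner ℂ (g : L2R3) (T g)).im = 0 := hT g
  change (inner ℂ (g : L2R3) (M (g : L2R3) + T g)).im = 0
  rw [inner_add_right, Complex.add_im, hM, zero_add]
  exact h

/-- On the domain, `T + M - a = (1 + M R)(T - a)`, so inverting the first factor suffices. -/
theorem IsResolvent.perturb_of_inverse {T : L2R3 →ₗ.[ℂ] L2R3} {a : ℂ} {R M U : L2R3 →L[ℂ] L2R3}
    (hR : IsResolvent T a R) (h1 : (1 + M * R) * U = 1) (h2 : U * (1 + M * R) = 1) :
    IsResolvent (perturb T M) a (R * U) := by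
  constructor
  · intro f
    obtain ⟨g, hg, hf⟩ := hR.1 (U f)
    refine ⟨g, hg, ?_⟩
    have h : U f + M (R (U f)) = f := by simpa using congrArg (fun L => L f) h1
    rw [perturb_apply, ← hg]
    rw [hg] at h ⊢
    rw [← hf] at h
    rw [add_sub_assoc, add_comm]; exact h
  · intro g
    have hg := hR.2 g
    have h : U ((T g - a • (g : L2R3)) + M (R (T g - a • (g : L2R3)))) = T g - a • (g : L2R3) := by
      simpa using congrArg (fun L => L (T g - a • (g : L2R3))) h2
    rw [hg] at h
    change R (U (M (g : L2R3) + T g - a • (g : L2R3))) = g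
    rw [add_sub_assoc, add_comm, h, hg]

theorem IsResolvent.exists_perturb_of_small {T : L2R3 →ₗ.[ℂ] L2R3} {a : ℂ} {R M : L2R3 →L[ℂ] L2R3}
    (hR : IsResolvent T a R) (h : ‖M‖ * ‖R‖ < 1) : ∃ R', IsResolvent (perturb T M) a R' := by
  have h' : ‖-(M * R)‖ < 1 := by
    rw [norm_neg]; exact (norm_mul_le M R).trans_lt h
  obtain ⟨U, hU⟩ := isUnit_one_sub_of_norm_lt_one h'
  rw [sub_neg_eq_add] at hU
  exact ⟨R * ↑U⁻¹, hR.perturb_of_inverse (by rw [← hU]; exact U.mul_inv)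
    (by rw [← hU]; exact U.inv_mul)⟩

/-- Bounded perturbations with real form keep the nonreal points in the resolvent set. -/
theorem IsResolvent.exists_perturb {T : L2R3 →ₗ.[ℂ] L2R3} {a : ℂ} {R M : L2R3 →L[ℂ] L2R3}
    (hR : IsResolvent T a R) (hT : RealForm T) (ha : a.im ≠ 0)
    (hM : ∀ g, (inner ℂ g (M g)).im = 0) : ∃ R', IsResolvent (perturb T M) a R' := by
  have hpos : 0 < |a.im| := abs_pos.mpr ha
  -- With this `N` the increment `M / N` satisfies `‖M / N‖ · |Im a|⁻¹ < 1`. The resolvent bound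
  -- `|Im a|⁻¹` is the same at each of the `N` stages `T + (k/N) M`, so the step size never has to
  -- shrink.
  obtain ⟨N, hN⟩ := exists_nat_gt (‖M‖ * |a.im|⁻¹)
  have hN0 : (0 : ℝ) < N := lt_of_le_of_lt (by positivity) hN
  have hform : ∀ t : ℝ, ∀ g, (inner ℂ g (((t : ℂ) • M) g)).im = 0 := by
    intro t g
    rw [_root_.smul_apply, inner_smul_right, Complex.im_ofReal_mul, hM, mul_zero]
  have key : ∀ k : ℕ, ∃ R', IsResolvent (DiracShell.perturb T ((((k : ℝ) / N : ℝ) : ℂ) • M)) a R' := by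
    intro k
    induction k with
    | zero =>
      refine ⟨R, ?_⟩
      simpa [perturb_zero] using hR
    | succ k ih =>
      obtain ⟨R₁, hR₁⟩ := ih
      have hb := hR₁.opNorm_le (hT.perturb (hform _)) ha
      have hs : ‖(((1 / N : ℝ) : ℂ) • M)‖ * ‖R₁‖ < 1 := by
        rw [norm_smul, Complex.norm_real, Real.norm_of_nonneg (by positivity)]
        calc 1 / (N : ℝ) * ‖M‖ * ‖R₁‖ ≤ 1 / (N : ℝ) * ‖M‖ * |a.im|⁻¹ := by gcongr
          _ = (‖M‖ * |a.im|⁻¹) / N := by ring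
          _ < 1 := (div_lt_one hN0).mpr hN
      obtain ⟨R', hR'⟩ := hR₁.exists_perturb_of_small hs
      refine ⟨R', ?_⟩
      rw [perturb_perturb, ← add_smul, ← Complex.ofReal_add] at hR'
      convert hR' using 5
      push_cast; ring
  obtain ⟨R', hR'⟩ := key N
  refine ⟨R', ?_⟩
  rwa [div_self hN0.ne', Complex.ofReal_one, one_smul] at hR'

/-- The resolvent formula for a factorized perturbation `M = v b u` with an involution `b`. -/
theorem IsResolvent.factorized {Y : Type*} [NormedAddCommGroup Y] [NormedSpace ℂ Y]
    {T : L2R3 →ₗ.[ℂ] L2R3} {a : ℂ} {R R' M : L2R3 →L[ℂ] L2R3}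
    (hR : IsResolvent T a R) (hR' : IsResolvent (perturb T M) a R')
    (u : L2R3 →L[ℂ] Y) (v : Y →L[ℂ] L2R3) (b : Y →L[ℂ] Y) (hb : b * b = 1)
    (hM : ∀ f, M f = v (b (u f))) :
    IsUnit (b + u ∘L R ∘L v) ∧
      R' = R - (R ∘L v) ∘L Ring.inverse (b + u ∘L R ∘L v) ∘L (u ∘L R) := by
  have hb' : ∀ y, b (b y) = y := fun y => by simpa using congrArg (fun L => L y) hb
  -- The second resolvent identity in its two forms, `R' = R - R M R'` and `R' = R - R' M R`. The
  -- first gives a right inverse below, the second a left inverse.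
  have e1 : ∀ f, R' f = R f - R (M (R' f)) := by
    intro f
    obtain ⟨g, hg, hf⟩ := hR'.1 f
    have h : R (T g - a • (g : L2R3)) = (g : L2R3) := hR.2 g
    have hf' : M (g : L2R3) + T g - a • (g : L2R3) = f := hf
    rw [add_sub_assoc] at hf'
    rw [hg, ← map_sub, ← hf', add_sub_cancel_left]
    exact h.symm
  have e2 : ∀ f, R' f = R f - R' (M (R f)) := by
    intro f
    obtain ⟨g, hg, hf⟩ := hR.1 f
    have h : R' (M (g : L2R3) + T g - a • (g : L2R3)) = (g : L2R3) := hR'.2 g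
    rw [add_sub_assoc, hf, map_add] at h
    rw [hg]
    exact eq_sub_of_add_eq' h
  have e2' : ∀ f, R' (M (R f)) = R f - R' f := fun f => by rw [e2 f]; abel
  have e1' : ∀ f, R (M (R' f)) = R f - R' f := fun f => by
    have := e1 f
    rw [eq_sub_iff_add_eq] at this
    rw [← this]; abel
  -- The candidate inverse of `b + u R v`. In the product the term `u R (v b u) R' v b` equals `u (R
  -- - R') v b`, and everything but `b² = 1` cancels.
  let Z : Y →L[ℂ] Y := b - b ∘L u ∘L R' ∘L v ∘L b
  have hZ1 : (b + u ∘L R ∘L v) * Z = 1 := by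
    ext1 y
    have h := congrArg u (e1' (v (b y)))
    rw [hM, map_sub] at h
    simp only [Z, mul_apply_eq_comp, _root_.add_apply,
      _root_.sub_apply, ContinuousLinearMap.comp_apply, map_sub, hb',
      one_apply_eq_self, h]
    abel
  have hZ2 : Z * (b + u ∘L R ∘L v) = 1 := by
    ext1 y
    have h := congrArg (fun z => b (u z)) (e2' (v y))
    simp only [hM, map_sub] at h
    simp only [Z, mul_apply_eq_comp, _root_.add_apply,
      _root_.sub_apply, ContinuousLinearMap.comp_apply, map_add, hb',
      one_apply_eq_self, h]
    abel
  let Zu : (Y →L[ℂ] Y)ˣ := ⟨b + u ∘L R ∘L v, Z, hZ1, hZ2⟩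
  have hinv : Ring.inverse (b + u ∘L R ∘L v) = Z := Ring.inverse_unit Zu
  refine ⟨⟨Zu, rfl⟩, ?_⟩
  rw [hinv]
  ext1 f
  -- Both identities are iterated once: `R' = R - R M R' = R - R M R + R M R' M R`, and the right
  -- side is `R - R v Z u R`.
  have h := congrArg (fun z => R (M z)) (e2 f)
  simp only [hM, map_sub] at h
  simp only [Z, _root_.sub_apply, ContinuousLinearMap.comp_apply, map_sub]
  rw [e1 f, hM, h]

end DiracShell

end

noncomputable section

namespace DiracShell

/-! ### Algebra of the Dirac matrices -/

set_option maxHeartbeats 1600000 in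
theorem alphaMat_mul_add (j k : Fin 3) :
    alphaMat j * alphaMat k + alphaMat k * alphaMat j =
      if j = k then (2 : Matrix (Fin 4) (Fin 4) ℂ) else 0 := by
  have h2 : (2 : Matrix (Fin 4) (Fin 4) ℂ) = (2 : ℂ) • 1 := by
    rw [← one_add_one_eq_two, ← one_add_one_eq_two, add_smul, one_smul]
  rw [h2]
  fin_cases j <;> fin_cases k <;> ext p q <;> fin_cases p <;> fin_cases q <;>
    simp [alphaMat] <;> norm_num

theorem alphaMat_mul_betaMat (j : Fin 3) : alphaMat j * betaMat = -(betaMat * alphaMat j) := by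
  fin_cases j <;> ext p q <;> fin_cases p <;> fin_cases q <;>
    simp [alphaMat, betaMat, Matrix.mul_diagonal, Matrix.diagonal_mul]

theorem betaMat_mul_self : betaMat * betaMat = 1 := by
  ext p q
  fin_cases p <;> fin_cases q <;> simp [betaMat, Matrix.mul_diagonal]

theorem star_alphaMat (j : Fin 3) : star (alphaMat j) = alphaMat j := by
  fin_cases j <;> ext p q <;> fin_cases p <;> fin_cases q <;>
    simp [alphaMat, Matrix.star_apply]

theorem star_betaMat : star betaMat = betaMat := by
  ext p q
  fin_cases p <;> fin_cases q <;> simp [betaMat, Matrix.star_apply]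

/-- The square of an abstract Dirac operator. -/
theorem dirac_square {A : Type*} [Ring A] [Algebra ℂ A] (α D : Fin 3 → A) (β : A) (m : ℂ)
    (hα : ∀ j k, α j * α k + α k * α j = if j = k then 2 else 0)
    (hαβ : ∀ j, α j * β = -(β * α j)) (hβ : β * β = 1)
    (hD : ∀ j k, D j * D k = D k * D j) (hαD : ∀ j k, α j * D k = D k * α j)
    (hβD : ∀ k, β * D k = D k * β) :
    ((-Complex.I) • (∑ j, α j * D j) + m • β) * ((-Complex.I) • (∑ j, α j * D j) + m • β) =
      -(∑ j, D j * D j) + (m ^ 2) • 1 := by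
  have hterm : ∀ j k, (α j * D j) * (α k * D k) = (α j * α k) * (D j * D k) := fun j k => by
    rw [mul_assoc, ← mul_assoc (D j), ← hαD k j, mul_assoc (α k), ← mul_assoc (α j)]
  have hsq : ∀ j, α j * α j = 1 := fun j => by
    have h := hα j j
    rw [if_pos rfl, ← two_smul ℂ (α j * α j)] at h
    have h' := congrArg (fun z => ((2 : ℂ)⁻¹) • z) h
    simp only [smul_smul] at h'
    have h2 : (2 : A) = (2 : ℂ) • (1 : A) := by
      rw [← one_add_one_eq_two, ← one_add_one_eq_two, add_smul, one_smul]
    rw [h2, smul_smul] at h'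
    simpa using h'
  have hS : (∑ j, α j * D j) * (∑ j, α j * D j) = ∑ j, D j * D j := by
    have hanti : ∀ j k, j ≠ k → (α j * D j) * (α k * D k) = -((α k * D k) * (α j * D j)) := by
      intro j k hjk
      have h := hα j k
      rw [if_neg hjk] at h
      rw [hterm, hterm, hD k j, eq_neg_of_add_eq_zero_left h, neg_mul]
    have hdiag : ∀ j, (α j * D j) * (α j * D j) = D j * D j := fun j => by
      rw [hterm, hsq, one_mul]
    simp only [Fin.sum_univ_three, add_mul, mul_add, hdiag]
    rw [hanti 1 0 (by decide), hanti 2 0 (by decide), hanti 2 1 (by decide)]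
    abel
  have hSβ : (∑ j, α j * D j) * β = -(β * ∑ j, α j * D j) := by
    rw [Finset.sum_mul, Finset.mul_sum, ← Finset.sum_neg_distrib]
    refine Finset.sum_congr rfl fun j _ => ?_
    rw [mul_assoc, ← hβD, ← mul_assoc, hαβ, neg_mul, mul_assoc]
  generalize (∑ j, α j * D j) = S at hS hSβ ⊢
  rw [← hS]
  simp only [add_mul, mul_add, smul_mul_assoc, mul_smul_comm, hSβ, hβ]
  rw [smul_add, smul_add, smul_smul, smul_smul, smul_neg, smul_neg, smul_smul, smul_smul,
    show (-Complex.I * -Complex.I) = (-1 : ℂ) by simp [Complex.I_mul_I], neg_one_smul,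
    mul_comm (-Complex.I) m, sq m]
  abel

/-- The relations are stated on vectors so that the same computation in `Module.End` serves tempered
distributions and Schwartz functions alike. -/
theorem dirac_square_apply {V : Type*} [AddCommGroup V] [Module ℂ V] (α D : Fin 3 → V →ₗ[ℂ] V)
    (β : V →ₗ[ℂ] V) (m : ℂ)
    (hα : ∀ j k v, α j (α k v) + α k (α j v) = if j = k then (2 : ℂ) • v else 0)
    (hαβ : ∀ j v, α j (β v) = -(β (α j v))) (hβ : ∀ v, β (β v) = v)
    (hD : ∀ j k v, D j (D k v) = D k (D j v)) (hαD : ∀ j k v, α j (D k v) = D k (α j v))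
    (hβD : ∀ k v, β (D k v) = D k (β v)) (v : V) :
    (-Complex.I) • (∑ j, α j (D j ((-Complex.I) • (∑ j, α j (D j v)) + m • β v))) +
        m • β ((-Complex.I) • (∑ j, α j (D j v)) + m • β v) =
      -(∑ j, D j (D j v)) + (m ^ 2) • v := by
  have h := dirac_square (A := Module.End ℂ V) α D β m (fun j k => ?_)
    (fun j => LinearMap.ext (hαβ j)) (LinearMap.ext hβ) (fun j k => LinearMap.ext (hD j k))
    (fun j k => LinearMap.ext (hαD j k)) (fun k => LinearMap.ext (hβD k))
  · have h' := congrArg (fun L => L v) h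
    simpa only [Module.End.mul_apply, LinearMap.add_apply, LinearMap.smul_apply,
      LinearMap.sum_apply, LinearMap.neg_apply, Module.End.one_apply] using h'
  · ext v
    refine (hα j k v).trans ?_
    split_ifs
    · rw [two_smul, ← one_add_one_eq_two]; rfl
    · rfl

/-! ### The Dirac operator on tempered distributions and on Schwartz functions -/

/-- A constant matrix acting on vector-valued tempered distributions. -/
def distAct (M : Matrix (Fin 4) (Fin 4) ℂ) : 𝓢'(E3, Spinor) →L[ℂ] 𝓢'(E3, Spinor) :=
  PointwiseConvergenceCLM.postcomp _ (act M)

theorem distAct_apply_apply (M : Matrix (Fin 4) (Fin 4) ℂ) (T : 𝓢'(E3, Spinor)) (ψ : 𝓢(E3, ℂ)) :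
    distAct M T ψ = act M (T ψ) := rfl

/-- A constant matrix acting on vector-valued Schwartz functions. -/
def schwartzAct (M : Matrix (Fin 4) (Fin 4) ℂ) : 𝓢(E3, Spinor) →L[ℂ] 𝓢(E3, Spinor) :=
  SchwartzMap.postcompCLM (act M)

theorem schwartzAct_apply (M : Matrix (Fin 4) (Fin 4) ℂ) (s : 𝓢(E3, Spinor)) (x : E3) :
    schwartzAct M s x = act M (s x) := rfl

/-- The standard basis of physical space. -/
abbrev basisE (j : Fin 3) : E3 := EuclideanSpace.single j (1 : ℝ)

/-- The Dirac operator on tempered distributions. -/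
def distDirac (m : ℝ) : 𝓢'(E3, Spinor) →L[ℂ] 𝓢'(E3, Spinor) :=
  (-Complex.I) • (∑ j, distAct (alphaMat j) ∘L
    LineDeriv.lineDerivOpCLM ℂ 𝓢'(E3, Spinor) (basisE j)) + (m : ℂ) • distAct betaMat

/-- The Dirac operator on Schwartz functions. -/
def schwartzDirac (m : ℝ) : 𝓢(E3, Spinor) →L[ℂ] 𝓢(E3, Spinor) :=
  (-Complex.I) • (∑ j, schwartzAct (alphaMat j) ∘L
    LineDeriv.lineDerivOpCLM ℂ 𝓢(E3, Spinor) (basisE j)) + (m : ℂ) • schwartzAct betaMat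

theorem act_mul (M N : Matrix (Fin 4) (Fin 4) ℂ) (x : Spinor) : act (M * N) x = act M (act N x) := by
  simp [act]

theorem act_add (M N : Matrix (Fin 4) (Fin 4) ℂ) (x : Spinor) :
    act (M + N) x = act M x + act N x := by simp [act]

theorem act_one (x : Spinor) : act 1 x = x := by simp [act]

theorem distAct_lineDerivOp (M : Matrix (Fin 4) (Fin 4) ℂ) (v : E3) (T : 𝓢'(E3, Spinor)) :
    distAct M (∂_{v} T) = ∂_{v} (distAct M T) := by
  ext1 ψ
  simp [distAct_apply_apply, TemperedDistribution.lineDerivOp_apply_apply]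

theorem lineDerivOp_apply' (v : E3) (s : 𝓢(E3, Spinor)) (x : E3) :
    (∂_{v} s) x = fderiv ℝ s x v := SchwartzMap.lineDerivOp_apply_eq_fderiv v s x

theorem schwartzAct_lineDerivOp (M : Matrix (Fin 4) (Fin 4) ℂ) (v : E3) (s : 𝓢(E3, Spinor)) :
    schwartzAct M (∂_{v} s) = ∂_{v} (schwartzAct M s) := by
  ext1 x
  rw [schwartzAct_apply, lineDerivOp_apply', lineDerivOp_apply']
  have h : HasFDerivAt (fun y => act M (s y))
      (((act M).restrictScalars ℝ).comp (fderiv ℝ s x)) x :=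
    ((act M).restrictScalars ℝ).hasFDerivAt.comp x (s.hasFDerivAt x)
  have h' : (schwartzAct M s : E3 → Spinor) = fun y => act M (s y) := rfl
  rw [h', h.fderiv]; rfl

theorem act_neg (M : Matrix (Fin 4) (Fin 4) ℂ) (x : Spinor) : act (-M) x = -act M x := by
  simp [act]

theorem act_alphaMat_add (j k : Fin 3) (x : Spinor) :
    act (alphaMat j) (act (alphaMat k) x) + act (alphaMat k) (act (alphaMat j) x) =
      if j = k then (2 : ℂ) • x else 0 := by
  rw [← act_mul, ← act_mul, ← act_add, alphaMat_mul_add]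
  split_ifs
  · rw [show (2 : Matrix (Fin 4) (Fin 4) ℂ) = 1 + 1 from one_add_one_eq_two.symm, act_add, act_one,
      two_smul]
  · simp [act]

theorem act_alphaMat_betaMat (j : Fin 3) (x : Spinor) :
    act (alphaMat j) (act betaMat x) = -act betaMat (act (alphaMat j) x) := by
  rw [← act_mul, alphaMat_mul_betaMat, act_neg, act_mul]

theorem act_betaMat_betaMat (x : Spinor) : act betaMat (act betaMat x) = x := by
  rw [← act_mul, betaMat_mul_self, act_one]

/-- On the Fourier side both derivatives are multiplications by scalar symbols, which commute. -/
theorem schwartz_lineDerivOp_comm {F : Type*} [NormedAddCommGroup F] [NormedSpace ℂ F]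
    [CompleteSpace F] (v w : E3) (s : 𝓢(E3, F)) : ∂_{v} (∂_{w} s) = ∂_{w} (∂_{v} s) := by
  have h : ∀ (v : E3) (s : 𝓢(E3, F)), ∂_{v} s = (2 * Real.pi * Complex.I) •
      SchwartzMap.fourierMultiplierCLM F (fun x => ((inner ℝ x v : ℝ) : ℂ)) s := by
    intro v s
    rw [SchwartzMap.lineDeriv_eq_fourierMultiplierCLM]
    congr 1
    exact (SchwartzMap.fourierMultiplierCLM_ofReal ℂ (by fun_prop) s).symm
  simp only [h, map_smul]
  rw [SchwartzMap.fourierMultiplierCLM_fourierMultiplierCLM_apply (by fun_prop) (by fun_prop),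
    SchwartzMap.fourierMultiplierCLM_fourierMultiplierCLM_apply (by fun_prop) (by fun_prop),
    mul_comm (fun x : E3 => ((inner ℝ x v : ℝ) : ℂ))]

theorem dist_lineDerivOp_comm (v w : E3) (T : 𝓢'(E3, Spinor)) :
    ∂_{v} (∂_{w} T) = ∂_{w} (∂_{v} T) := by
  refine DFunLike.ext _ _ fun ψ => ?_
  simp only [TemperedDistribution.lineDerivOp_apply_apply, map_neg]
  rw [schwartz_lineDerivOp_comm]

theorem distDirac_apply (m : ℝ) (T : 𝓢'(E3, Spinor)) : distDirac m T =
    (-Complex.I) • (∑ j, distAct (alphaMat j) (∂_{basisE j} T)) + (m : ℂ) • distAct betaMat T := by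
  simp only [distDirac, _root_.add_apply, _root_.smul_apply, sum_apply,
    ContinuousLinearMap.comp_apply, LineDeriv.lineDerivOpCLM_apply]

theorem schwartzDirac_apply (m : ℝ) (s : 𝓢(E3, Spinor)) : schwartzDirac m s =
    (-Complex.I) • (∑ j, schwartzAct (alphaMat j) (∂_{basisE j} s)) +
      (m : ℂ) • schwartzAct betaMat s := by
  simp only [schwartzDirac, _root_.add_apply, _root_.smul_apply, sum_apply,
    ContinuousLinearMap.comp_apply, LineDeriv.lineDerivOpCLM_apply]

theorem distDirac_sq (m : ℝ) (T : 𝓢'(E3, Spinor)) :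
    distDirac m (distDirac m T) =
      -(∑ j, ∂_{basisE j} (∂_{basisE j} T)) + ((m : ℂ) ^ 2) • T := by
  rw [distDirac_apply, distDirac_apply]
  refine dirac_square_apply (fun j => (distAct (alphaMat j)).toLinearMap)
    (fun j => (LineDeriv.lineDerivOpCLM ℂ 𝓢'(E3, Spinor) (basisE j)).toLinearMap)
    (distAct betaMat).toLinearMap (m : ℂ) (fun j k T => DFunLike.ext _ _ fun ψ => ?_)
    (fun j T => DFunLike.ext _ _ fun ψ => act_alphaMat_betaMat j (T ψ))
    (fun T => DFunLike.ext _ _ fun ψ => act_betaMat_betaMat (T ψ))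
    (fun j k T => dist_lineDerivOp_comm _ _ T) (fun j k T => distAct_lineDerivOp _ _ _)
    (fun k T => distAct_lineDerivOp _ _ _) T
  refine (act_alphaMat_add j k (T ψ)).trans ?_
  split_ifs <;> rfl

theorem schwartzDirac_sq (m : ℝ) (s : 𝓢(E3, Spinor)) :
    schwartzDirac m (schwartzDirac m s) =
      -(∑ j, ∂_{basisE j} (∂_{basisE j} s)) + ((m : ℂ) ^ 2) • s := by
  rw [schwartzDirac_apply, schwartzDirac_apply]
  refine dirac_square_apply (fun j => (schwartzAct (alphaMat j)).toLinearMap)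
    (fun j => (LineDeriv.lineDerivOpCLM ℂ 𝓢(E3, Spinor) (basisE j)).toLinearMap)
    (schwartzAct betaMat).toLinearMap (m : ℂ) (fun j k T => DFunLike.ext _ _ fun ψ => ?_)
    (fun j T => DFunLike.ext _ _ fun ψ => act_alphaMat_betaMat j (T ψ))
    (fun T => DFunLike.ext _ _ fun ψ => act_betaMat_betaMat (T ψ))
    (fun j k T => schwartz_lineDerivOp_comm _ _ T) (fun j k T => schwartzAct_lineDerivOp _ _ _)
    (fun k T => schwartzAct_lineDerivOp _ _ _) s
  refine (act_alphaMat_add j k (T ψ)).trans ?_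
  split_ifs <;> rfl

theorem distAct_toDistribution (M : Matrix (Fin 4) (Fin 4) ℂ) (s : 𝓢(E3, Spinor)) :
    distAct M (s : 𝓢'(E3, Spinor)) = ((schwartzAct M s : 𝓢(E3, Spinor)) : 𝓢'(E3, Spinor)) := by
  refine DFunLike.ext _ _ fun ψ => ?_
  rw [distAct_apply_apply]
  simp only [SchwartzMap.toTemperedDistributionCLM_apply_apply]
  have hint : Integrable (fun x => ψ x • s x) :=
    (SchwartzMap.bilinLeftCLM (ContinuousLinearMap.lsmul ℝ ℂ) s.hasTemperateGrowth ψ).integrable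
  rw [← ContinuousLinearMap.integral_comp_comm _ hint]
  refine integral_congr_ae (ae_of_all _ fun x => ?_)
  simp only [map_smul]; rfl

theorem schwartzDirac_toDistribution (m : ℝ) (s : 𝓢(E3, Spinor)) :
    distDirac m (s : 𝓢'(E3, Spinor)) = ((schwartzDirac m s : 𝓢(E3, Spinor)) : 𝓢'(E3, Spinor)) := by
  rw [distDirac_apply, schwartzDirac_apply, map_add, map_smul, map_sum, map_smul,
    distAct_toDistribution]
  congr 2
  refine Finset.sum_congr rfl fun j _ => ?_
  rw [TemperedDistribution.lineDerivOp_toTemperedDistributionCLM_eq, distAct_toDistribution]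

theorem toLp_schwartzAct (M : Matrix (Fin 4) (Fin 4) ℂ) (s : 𝓢(E3, Spinor)) :
    matOp volume M (s.toLp 2) = (schwartzAct M s).toLp 2 := by
  refine Lp.ext ?_
  filter_upwards [(act M).coeFn_compLpL (p := 2) (s.toLp 2 volume),
    s.coeFn_toLp 2 volume, (schwartzAct M s).coeFn_toLp 2 volume] with x h1 h2 h3
  rw [h3, schwartzAct_apply, ← h2]; exact h1

/-- Both sides are continuous in `F` and agree on the dense set of Schwartz functions. -/
theorem matOp_toDistribution (M : Matrix (Fin 4) (Fin 4) ℂ) (F : L2R3) :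
    ((matOp volume M F : L2R3) : 𝓢'(E3, Spinor)) = distAct M (F : 𝓢'(E3, Spinor)) := by
  refine DenseRange.induction_on (p := fun F : L2R3 =>
    ((matOp volume M F : L2R3) : 𝓢'(E3, Spinor)) = distAct M (F : 𝓢'(E3, Spinor)))
    (SchwartzMap.denseRange_toLpCLM (E := E3) (F := Spinor) (μ := volume) (p := 2)
      ENNReal.ofNat_ne_top) F ?_ ?_
  · exact isClosed_eq ((Lp.toTemperedDistributionCLM Spinor volume 2).continuous.comp
      (matOp volume M).continuous)
      ((distAct M).continuous.comp (Lp.toTemperedDistributionCLM Spinor volume 2).continuous)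
  · intro s
    rw [SchwartzMap.toLpCLM_apply, toLp_schwartzAct, Lp.toTemperedDistribution_toLp_eq,
      Lp.toTemperedDistribution_toLp_eq, distAct_toDistribution]

theorem weakPartial_toDistribution (j : Fin 3) (g : sobolevH1) :
    ((weakPartial j g : L2R3) : 𝓢'(E3, Spinor)) = ∂_{basisE j} ((g : L2R3) : 𝓢'(E3, Spinor)) :=
  (exists_weakPartial j g).choose_spec.symm

theorem diracOp_toDistribution (m : ℝ) (g : sobolevH1) :
    ((diracOp m g : L2R3) : 𝓢'(E3, Spinor)) = distDirac m ((g : L2R3) : 𝓢'(E3, Spinor)) := by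
  have h : diracOp m g = (-Complex.I) • (∑ j, matOp volume (alphaMat j) (weakPartial j g)) +
      (m : ℂ) • matOp volume betaMat (g : L2R3) := by
    change ((-Complex.I) • (∑ j, (matOp volume (alphaMat j)).toLinearMap ∘ₗ weakPartial j) +
      (m : ℂ) • ((matOp volume betaMat).toLinearMap ∘ₗ sobolevH1.subtype)) g = _
    simp only [LinearMap.add_apply, LinearMap.smul_apply, LinearMap.sum_apply]
    rfl
  rw [h, distDirac_apply, ← Lp.toTemperedDistributionCLM_apply]
  rw [map_add, map_smul, map_sum, map_smul]
  simp only [Lp.toTemperedDistributionCLM_apply, matOp_toDistribution, weakPartial_toDistribution]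

end DiracShell

end

noncomputable section

namespace DiracShell

/-! ### The resolvent of the free Dirac operator -/

open TemperedDistribution in
theorem dist_laplacian_eq_sum (T : 𝓢'(E3, Spinor)) :
    (∑ j, ∂_{basisE j} (∂_{basisE j} T)) = Laplacian.laplacian T := by
  rw [TemperedDistribution.laplacian_eq_sum (EuclideanSpace.basisFun (Fin 3) ℝ)]
  simp

/-- The symbol of `(c² - Δ)⁻¹`. -/
def invSymbol (c : ℝ) (x : E3) : ℂ := (((c ^ 2 + (2 * Real.pi) ^ 2 * ‖x‖ ^ 2)⁻¹ : ℝ) : ℂ)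

/-- Up to the factor `c⁻²`, the symbol is `(1 + |ξ|²)⁻¹` evaluated at `ξ = (2π/c) x`, whose
temperate growth is known. -/
theorem hasTemperateGrowth_invSymbol {c : ℝ} (hc : 0 < c) : (invSymbol c).HasTemperateGrowth := by
  have h : invSymbol c = fun x : E3 => (((c ^ 2)⁻¹ *
      ((1 + ‖((2 * Real.pi / c) • ContinuousLinearMap.id ℝ E3) x‖ ^ 2) ^ (-1 : ℝ)) : ℝ) : ℂ) := by
    ext x
    rw [invSymbol, Real.rpow_neg_one]
    congr 1
    have : ‖((2 * Real.pi / c) • ContinuousLinearMap.id ℝ E3) x‖ = 2 * Real.pi / c * ‖x‖ := by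
      rw [_root_.smul_apply, norm_smul, Real.norm_of_nonneg (by positivity)]; rfl
    rw [this, ← mul_inv]
    congr 1
    field_simp
  rw [h]
  have h1 : (fun x : E3 => (1 + ‖x‖ ^ 2) ^ (-1 : ℝ)).HasTemperateGrowth := by fun_prop
  have h2 := h1.comp ((2 * Real.pi / c) • ContinuousLinearMap.id ℝ E3).hasTemperateGrowth
  have h3 : (fun x : E3 => ((c ^ 2)⁻¹ *
      ((1 + ‖((2 * Real.pi / c) • ContinuousLinearMap.id ℝ E3) x‖ ^ 2) ^ (-1 : ℝ)) : ℝ)).HasTemperateGrowth :=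
    (Function.HasTemperateGrowth.const _).mul h2
  fun_prop

theorem symbol_mul_invSymbol {c : ℝ} (hc : 0 < c) :
    (fun x : E3 => (((c : ℂ) ^ 2 + (2 * Real.pi) ^ 2 * ((‖x‖ ^ 2 : ℝ) : ℂ)))) * invSymbol c =
      fun _ => 1 := by
  ext x
  have h : (c ^ 2 + (2 * Real.pi) ^ 2 * ‖x‖ ^ 2 : ℝ) ≠ 0 := by positivity
  simp only [Pi.mul_apply, invSymbol]
  rw [← Complex.ofReal_one, ← mul_inv_cancel₀ h]
  push_cast; ring

theorem dist_helmholtz (c : ℝ) (T : 𝓢'(E3, Spinor)) :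
    ((c : ℂ) ^ 2) • T - Laplacian.laplacian T = TemperedDistribution.fourierMultiplierCLM Spinor
      (fun x : E3 => (((c : ℂ) ^ 2 + (2 * Real.pi) ^ 2 * ((‖x‖ ^ 2 : ℝ) : ℂ)))) T := by
  have h0 : (fun x : E3 => ((2 * Real.pi : ℂ) ^ 2 * ((‖x‖ ^ 2 : ℝ) : ℂ))) =
      ((2 * Real.pi : ℂ) ^ 2) • (fun x : E3 => ((‖x‖ ^ 2 : ℝ) : ℂ)) := rfl
  have hs : (fun x : E3 => (((c : ℂ) ^ 2 + (2 * Real.pi) ^ 2 * ((‖x‖ ^ 2 : ℝ) : ℂ)))) =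
      (fun _ : E3 => (c : ℂ) ^ 2) + ((2 * Real.pi : ℂ) ^ 2) • (fun x : E3 => ((‖x‖ ^ 2 : ℝ) : ℂ)) := rfl
  have hneg : ∀ (r : ℝ) (S : 𝓢'(E3, Spinor)), (-r) • S = -(r • S) := fun r S => neg_smul r S
  rw [hs, TemperedDistribution.fourierMultiplierCLM_apply,
    TemperedDistribution.smulLeftCLM_add (by fun_prop) (by fun_prop), _root_.add_apply,
    FourierTransform.fourierInv_add, ← TemperedDistribution.fourierMultiplierCLM_apply,
    ← TemperedDistribution.fourierMultiplierCLM_apply,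
    TemperedDistribution.fourierMultiplierCLM_const,
    TemperedDistribution.fourierMultiplierCLM_smul (by fun_prop),
    TemperedDistribution.laplacian_eq_fourierMultiplierCLM, sub_eq_add_neg, hneg, neg_neg]
  congr 1
  refine DFunLike.ext _ _ fun ψ => ?_
  have hreal : ∀ (r : ℝ) (w : Spinor), r • w = (r : ℂ) • w := fun r w => (Complex.coe_smul r w).symm
  refine (hreal _ _).trans ?_
  push_cast; rfl

/-- `(c² - Δ)⁻¹` on tempered distributions. -/
def helmholtzInv (c : ℝ) : 𝓢'(E3, Spinor) →L[ℂ] 𝓢'(E3, Spinor) :=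
  TemperedDistribution.fourierMultiplierCLM Spinor (invSymbol c)

theorem helmholtz_helmholtzInv {c : ℝ} (hc : 0 < c) (T : 𝓢'(E3, Spinor)) :
    ((c : ℂ) ^ 2) • helmholtzInv c T - Laplacian.laplacian (helmholtzInv c T) = T := by
  rw [dist_helmholtz, helmholtzInv,
    TemperedDistribution.fourierMultiplierCLM_fourierMultiplierCLM_apply
      (hasTemperateGrowth_invSymbol hc) (by fun_prop), mul_comm, symbol_mul_invSymbol hc]
  simp

theorem helmholtzInv_helmholtz {c : ℝ} (hc : 0 < c) (T : 𝓢'(E3, Spinor)) :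
    helmholtzInv c (((c : ℂ) ^ 2) • T - Laplacian.laplacian T) = T := by
  rw [dist_helmholtz, helmholtzInv,
    TemperedDistribution.fourierMultiplierCLM_fourierMultiplierCLM_apply
      (by fun_prop) (hasTemperateGrowth_invSymbol hc), symbol_mul_invSymbol hc]
  simp

/-- Applying the Bessel potential of order 2 multiplies the symbol by `1 + |x|²`. The product is
bounded by `c⁻² + 1`, because `(2π)² ≥ 1`, so it preserves `L²`. -/
theorem memSobolev_helmholtzInv {c : ℝ} (hc : 0 < c) (F : L2R3) :
    TemperedDistribution.MemSobolev 2 2 (helmholtzInv c (F : 𝓢'(E3, Spinor))) := by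
  have h0 : TemperedDistribution.MemSobolev 0 2 (F : 𝓢'(E3, Spinor)) :=
    TemperedDistribution.memSobolev_zero_iff.mpr ⟨F, rfl⟩
  have hb : TemperedDistribution.MemSobolev 0 2
      (TemperedDistribution.besselPotential E3 Spinor 2 (helmholtzInv c (F : 𝓢'(E3, Spinor)))) := by
    rw [TemperedDistribution.besselPotential, helmholtzInv,
      TemperedDistribution.fourierMultiplierCLM_fourierMultiplierCLM_apply
      (hasTemperateGrowth_invSymbol hc) (by fun_prop)]
    refine h0.fourierMultiplierCLM_of_bounded
      ((hasTemperateGrowth_invSymbol hc).mul (by fun_prop)) ⟨(c ^ 2)⁻¹ + 1, fun x => ?_⟩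
    rw [Pi.mul_apply, invSymbol, ← Complex.ofReal_mul, Complex.norm_real,
      div_self (two_ne_zero' ℝ), Real.rpow_one, Real.norm_of_nonneg (by positivity),
      inv_mul_eq_div, div_le_iff₀ (by positivity)]
    have hpi : 1 ≤ (2 * Real.pi) ^ 2 := by nlinarith [Real.pi_gt_three]
    have hx := sq_nonneg ‖x‖
    have h1 : (c ^ 2)⁻¹ * c ^ 2 = 1 := inv_mul_cancel₀ (by positivity)
    have h2 : 0 ≤ (c ^ 2)⁻¹ * ((2 * Real.pi) ^ 2 * ‖x‖ ^ 2) := by positivity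
    nlinarith [sq_nonneg c]
  simpa using TemperedDistribution.memSobolev_besselPotential_iff.mp hb

theorem memSobolev_distAct {r : ℝ} {T : 𝓢'(E3, Spinor)} (M : Matrix (Fin 4) (Fin 4) ℂ)
    (hT : TemperedDistribution.MemSobolev r 2 T) :
    TemperedDistribution.MemSobolev r 2 (distAct M T) := by
  obtain ⟨F, hF⟩ := hT
  refine ⟨matOp volume M F, ?_⟩
  rw [matOp_toDistribution, ← hF]
  rfl

theorem memSobolev_sum {ι : Type*} (t : Finset ι) {r : ℝ} {T : ι → 𝓢'(E3, Spinor)}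
    (hT : ∀ j, TemperedDistribution.MemSobolev r 2 (T j)) :
    TemperedDistribution.MemSobolev r 2 (∑ j ∈ t, T j) := by
  classical
  induction t using Finset.induction_on with
  | empty => simp
  | insert j t hj ih => rw [Finset.sum_insert hj]; exact (hT j).add ih

theorem memSobolev_distDirac (m : ℝ) {T : 𝓢'(E3, Spinor)}
    (hT : TemperedDistribution.MemSobolev 2 2 T) :
    TemperedDistribution.MemSobolev 1 2 (distDirac m T) := by
  rw [distDirac_apply]
  refine ((memSobolev_sum _ fun j => memSobolev_distAct _ ?_).smul _).add
    ((memSobolev_distAct _ (hT.mono (by norm_num))).smul _)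
  have h := hT.lineDerivOp (m := basisE j)
  norm_num at h
  exact h

/-- `(H - iy)⁻¹` on tempered distributions. -/
def distResolvent (m y : ℝ) : 𝓢'(E3, Spinor) →L[ℂ] 𝓢'(E3, Spinor) :=
  (distDirac m + ((y : ℂ) * Complex.I) • ContinuousLinearMap.id ℂ _) ∘L
    helmholtzInv (Real.sqrt (m ^ 2 + y ^ 2))

theorem sqrt_mass_sq (m y : ℝ) : ((Real.sqrt (m ^ 2 + y ^ 2) : ℝ) : ℂ) ^ 2 = (m : ℂ) ^ 2 + (y : ℂ) ^ 2 := by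
  rw [← Complex.ofReal_pow, Real.sq_sqrt (by positivity)]; push_cast; rfl

theorem mul_I_sq (y : ℝ) : ((y : ℂ) * Complex.I) * ((y : ℂ) * Complex.I) = -(y : ℂ) ^ 2 := by
  rw [mul_mul_mul_comm, Complex.I_mul_I]; ring

/-- The cross terms of `(H - iy)(H + iy)` cancel and `(iy)² = -y²` turns `H² = -Δ + m²` into `-Δ +
m² + y²`. The Dirac resolvent on the imaginary axis thus reduces to a scalar Helmholtz inverse. -/
theorem distDirac_factor (m y : ℝ) (T : 𝓢'(E3, Spinor)) :
    distDirac m (distDirac m T + ((y : ℂ) * Complex.I) • T) -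
      ((y : ℂ) * Complex.I) • (distDirac m T + ((y : ℂ) * Complex.I) • T) =
    (((Real.sqrt (m ^ 2 + y ^ 2) : ℝ) : ℂ) ^ 2) • T - Laplacian.laplacian T := by
  have hadd : ∀ (a b : ℂ), (a + b) • T = a • T + b • T := fun a b => add_smul a b T
  have hneg : ∀ (a : ℂ), (-a) • T = -(a • T) := fun a => neg_smul a T
  rw [map_add, map_smul, distDirac_sq, dist_laplacian_eq_sum, sqrt_mass_sq, smul_add, smul_smul,
    mul_I_sq, hadd, hneg]
  abel

theorem distDirac_distResolvent (m : ℝ) {y : ℝ} (hy : y ≠ 0) (T : 𝓢'(E3, Spinor)) :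
    distDirac m (distResolvent m y T) - ((y : ℂ) * Complex.I) • distResolvent m y T = T := by
  have hc : 0 < Real.sqrt (m ^ 2 + y ^ 2) := Real.sqrt_pos.mpr (by positivity)
  exact (distDirac_factor m y _).trans (helmholtz_helmholtzInv hc T)

/-- Apply `H + iy` to the equation: the two factors commute, so `(m² + y² - Δ)T = 0`, and the
Helmholtz operator has a left inverse on tempered distributions. -/
theorem distDirac_injective (m : ℝ) {y : ℝ} (hy : y ≠ 0) (T : 𝓢'(E3, Spinor))
    (h : distDirac m T - ((y : ℂ) * Complex.I) • T = 0) : T = 0 := by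
  have hc : 0 < Real.sqrt (m ^ 2 + y ^ 2) := Real.sqrt_pos.mpr (by positivity)
  rw [← helmholtzInv_helmholtz hc T, ← distDirac_factor]
  have e : distDirac m (distDirac m T + ((y : ℂ) * Complex.I) • T) -
      ((y : ℂ) * Complex.I) • (distDirac m T + ((y : ℂ) * Complex.I) • T) =
      distDirac m (distDirac m T - ((y : ℂ) * Complex.I) • T) +
      ((y : ℂ) * Complex.I) • (distDirac m T - ((y : ℂ) * Complex.I) • T) := by
    simp only [map_add, map_sub, smul_add, smul_sub, map_smul]; abel
  rw [e, h, map_zero, zero_add, show ((y : ℂ) * Complex.I) • (0 : 𝓢'(E3, Spinor)) = 0 from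
    DFunLike.ext _ _ fun ψ => smul_zero ((y : ℂ) * Complex.I),
    map_zero]

theorem distDirac_unique (m : ℝ) {y : ℝ} (hy : y ≠ 0) {T S : 𝓢'(E3, Spinor)}
    (h : distDirac m T - ((y : ℂ) * Complex.I) • T = distDirac m S - ((y : ℂ) * Complex.I) • S) :
    T = S := by
  rw [← sub_eq_zero]
  refine distDirac_injective m hy _ ?_
  rw [map_sub, smul_sub, sub_sub_sub_comm, h, sub_self]

theorem diracOp_sub_toDistribution (m : ℝ) (a : ℂ) (g : sobolevH1) :
    ((diracOp m g - a • (g : L2R3) : L2R3) : 𝓢'(E3, Spinor)) =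
      distDirac m ((g : L2R3) : 𝓢'(E3, Spinor)) - a • ((g : L2R3) : 𝓢'(E3, Spinor)) := by
  rw [← diracOp_toDistribution]
  simp only [← Lp.toTemperedDistributionCLM_apply, map_sub, map_smul]

theorem exists_isResolvent_imag (m : ℝ) {y : ℝ} (hy : y ≠ 0) :
    ∃ R : L2R3 →L[ℂ] L2R3, IsResolvent (diracOp m) ((y : ℂ) * Complex.I) R ∧
      ∀ F : L2R3, ((R F : L2R3) : 𝓢'(E3, Spinor)) = distResolvent m y (F : 𝓢'(E3, Spinor)) := by
  have hc : 0 < Real.sqrt (m ^ 2 + y ^ 2) := Real.sqrt_pos.mpr (by positivity)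
  have hex : ∀ F : L2R3, ∃ g : sobolevH1,
      ((g : L2R3) : 𝓢'(E3, Spinor)) = distResolvent m y (F : 𝓢'(E3, Spinor)) := by
    intro F
    have h2 := memSobolev_helmholtzInv hc F
    have h1 : TemperedDistribution.MemSobolev 1 2 (distResolvent m y (F : 𝓢'(E3, Spinor))) :=
      (memSobolev_distDirac m h2).add ((h2.mono (by norm_num)).smul _)
    obtain ⟨G, hG⟩ := TemperedDistribution.memSobolev_zero_iff.mp (h1.mono zero_le_one)
    refine ⟨⟨G, ?_⟩, hG.symm⟩
    change TemperedDistribution.MemSobolev 1 2 (G : 𝓢'(E3, Spinor))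
    rwa [← hG]
  choose r hr using hex
  have hinj : ∀ {F G : L2R3}, (F : 𝓢'(E3, Spinor)) = (G : 𝓢'(E3, Spinor)) → F = G :=
    fun h => toTemperedDistribution_injective h
  let Rl : L2R3 →ₗ[ℂ] L2R3 :=
    { toFun := fun F => r F
      map_add' := fun F G => hinj (by
        have e := map_add (Lp.toTemperedDistributionCLM Spinor (volume : Measure E3) 2) F G
        have e' := map_add (Lp.toTemperedDistributionCLM Spinor (volume : Measure E3) 2)
          (r F : L2R3) (r G)
        simp only [Lp.toTemperedDistributionCLM_apply] at e e'
        rw [e', hr, hr, hr, e, map_add])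
      map_smul' := fun c F => hinj (by
        have e := map_smul (Lp.toTemperedDistributionCLM Spinor (volume : Measure E3) 2) c F
        have e' := map_smul (Lp.toTemperedDistributionCLM Spinor (volume : Measure E3) 2) c
          (r F : L2R3)
        simp only [Lp.toTemperedDistributionCLM_apply] at e e'
        rw [RingHom.id_apply, e', hr, hr, e, map_smul]) }
  -- Boundedness is taken from the closed graph theorem: the operator is the restriction of a
  -- continuous map on distributions, and `L²` embeds continuously and injectively there.
  let R : L2R3 →L[ℂ] L2R3 := ContinuousLinearMap.ofSeqClosedGraph (g := Rl) (by
    intro w F G hw hG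
    refine hinj ?_
    change _ = ((r F : L2R3) : 𝓢'(E3, Spinor))
    rw [hr]
    have c1 := ((distResolvent m y).continuous.comp
      (Lp.toTemperedDistributionCLM Spinor (volume : Measure E3) 2).continuous).tendsto F |>.comp hw
    have c2 := ((Lp.toTemperedDistributionCLM Spinor (volume : Measure E3) 2).continuous.tendsto
      G).comp hG
    refine tendsto_nhds_unique c2 (c1.congr fun n => ?_)
    exact (hr (w n)).symm)
  refine ⟨R, ⟨fun F => ⟨r F, rfl, hinj ?_⟩, fun g => hinj ?_⟩, hr⟩
  · rw [diracOp_sub_toDistribution, hr, distDirac_distResolvent m hy]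
  · refine (hr _).trans (distDirac_unique m hy ?_)
    rw [distDirac_distResolvent m hy]
    exact diracOp_sub_toDistribution m _ g

end DiracShell

end

noncomputable section

namespace DiracShell

/-! ### Schwartz functions form a core -/

/-- `(H - iy)⁻¹` on Schwartz functions. -/
def schwartzResolvent (m y : ℝ) (s : 𝓢(E3, Spinor)) : 𝓢(E3, Spinor) :=
  let c := Real.sqrt (m ^ 2 + y ^ 2)
  schwartzDirac m (SchwartzMap.fourierMultiplierCLM Spinor (invSymbol c) s) +
    ((y : ℂ) * Complex.I) • SchwartzMap.fourierMultiplierCLM Spinor (invSymbol c) s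

theorem schwartzResolvent_toDistribution (m : ℝ) {y : ℝ} (hy : y ≠ 0) (s : 𝓢(E3, Spinor)) :
    ((schwartzResolvent m y s : 𝓢(E3, Spinor)) : 𝓢'(E3, Spinor)) =
      distResolvent m y (s : 𝓢'(E3, Spinor)) := by
  have hc : 0 < Real.sqrt (m ^ 2 + y ^ 2) := Real.sqrt_pos.mpr (by positivity)
  rw [schwartzResolvent, map_add, map_smul, ← schwartzDirac_toDistribution,
    ← TemperedDistribution.fourierMultiplierCLM_toTemperedDistributionCLM_eq
      (hasTemperateGrowth_invSymbol hc)]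
  rfl

theorem toLp_mem_sobolevH1 (s : 𝓢(E3, Spinor)) : s.toLp 2 volume ∈ sobolevH1 := by
  have h : TemperedDistribution.MemSobolev 1 2 (s : 𝓢'(E3, Spinor)) := s.memSobolev
  rw [← Lp.toTemperedDistribution_toLp_eq (p := 2)] at h
  exact h

/-- A Schwartz function as an element of the domain of the Dirac operator. -/
def schwartzH1 (s : 𝓢(E3, Spinor)) : sobolevH1 := ⟨s.toLp 2 volume, toLp_mem_sobolevH1 s⟩

theorem diracOp_schwartzH1 (m : ℝ) (s : 𝓢(E3, Spinor)) :
    diracOp m (schwartzH1 s) = (schwartzDirac m s).toLp 2 := by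
  apply toTemperedDistribution_injective
  rw [diracOp_toDistribution, Lp.toTemperedDistribution_toLp_eq, ← schwartzDirac_toDistribution]
  congr 1
  exact Lp.toTemperedDistribution_toLp_eq s

/-- The core property for the graph norm. Approximate `(H - i)g` in `L²` by Schwartz functions and
apply `(H - i)⁻¹`, which is bounded on `L²` and maps Schwartz functions to Schwartz functions. -/
theorem exists_schwartz_seq (m : ℝ) (g : (diracOp m).domain) :
    ∃ s : ℕ → 𝓢(E3, Spinor), Tendsto (fun n => (s n).toLp 2 volume) atTop (𝓝 (g : L2R3)) ∧
      Tendsto (fun n => (schwartzDirac m (s n)).toLp 2 volume) atTop (𝓝 (diracOp m g)) := by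
  obtain ⟨R, hR, hRd⟩ := exists_isResolvent_imag m (one_ne_zero (α := ℝ))
  set i : ℂ := ((1 : ℝ) : ℂ) * Complex.I
  have hd : DenseRange (SchwartzMap.toLpCLM ℂ Spinor 2 (volume : Measure E3)) :=
    SchwartzMap.denseRange_toLpCLM ENNReal.ofNat_ne_top
  obtain ⟨w, hw, hlim⟩ := mem_closure_iff_seq_limit.mp (hd (diracOp m g - i • (g : L2R3)))
  choose f hf using hw
  have hRf : ∀ n, R (w n) = (schwartzResolvent m 1 (f n)).toLp 2 volume := by
    intro n
    apply toTemperedDistribution_injective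
    rw [hRd, ← hf n, SchwartzMap.toLpCLM_apply, Lp.toTemperedDistribution_toLp_eq,
      Lp.toTemperedDistribution_toLp_eq, schwartzResolvent_toDistribution m one_ne_zero]
  have h1 : Tendsto (fun n => (schwartzResolvent m 1 (f n)).toLp 2 volume) atTop (𝓝 (g : L2R3)) := by
    have := (R.continuous.tendsto _).comp hlim
    rw [hR.2 g] at this
    exact this.congr hRf
  refine ⟨fun n => schwartzResolvent m 1 (f n), h1, ?_⟩
  have h2 : ∀ n, (schwartzDirac m (schwartzResolvent m 1 (f n))).toLp 2 volume =
      w n + i • (schwartzResolvent m 1 (f n)).toLp 2 volume := by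
    intro n
    obtain ⟨g', hg', hw'⟩ := hR.1 (w n)
    have hg'' : g' = schwartzH1 (schwartzResolvent m 1 (f n)) :=
      Subtype.ext (by rw [← hg', hRf]; rfl)
    rw [← diracOp_schwartzH1, ← hg'', ← hRf, hg', ← hw']
    abel
  have h3 := hlim.add (h1.const_smul i)
  rw [sub_add_cancel] at h3
  exact h3.congr fun n => (h2 n).symm

/-! ### Symmetry and resolvent set -/

theorem inner_act_alphaMat (j : Fin 3) (x z : Spinor) :
    inner ℂ (act (alphaMat j) x) z = inner ℂ x (act (alphaMat j) z) := by
  have h : ContinuousLinearMap.adjoint (act (alphaMat j)) = act (alphaMat j) := by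
    rw [← ContinuousLinearMap.star_eq_adjoint, act, ← map_star, star_alphaMat]
  rw [← ContinuousLinearMap.adjoint_inner_right, h]

theorem inner_act_betaMat (x z : Spinor) :
    inner ℂ (act betaMat x) z = inner ℂ x (act betaMat z) := by
  have h : ContinuousLinearMap.adjoint (act betaMat) = act betaMat := by
    rw [← ContinuousLinearMap.star_eq_adjoint, act, ← map_star, star_betaMat]
  rw [← ContinuousLinearMap.adjoint_inner_right, h]

theorem inner_toLp (s t : 𝓢(E3, Spinor)) :
    inner ℂ (s.toLp 2 volume) (t.toLp 2 volume) = ∫ x, inner ℂ (s x) (t x) := by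
  rw [L2.inner_def]
  refine integral_congr_ae ?_
  filter_upwards [s.coeFn_toLp 2 volume, t.coeFn_toLp 2 volume] with x h1 h2
  rw [h1, h2]

theorem integral_inner_lineDerivOp (v : E3) (s t : 𝓢(E3, Spinor)) :
    ∫ x, inner ℂ (s x) ((∂_{v} t) x) = -∫ x, inner ℂ ((∂_{v} s) x) (t x) :=
  SchwartzMap.integral_bilinear_lineDerivOp_right_eq_neg_left s t
    (isBoundedBilinearMap_inner (𝕜 := ℂ) (E := Spinor)).toContinuousLinearMap v

theorem im_inner_act_betaMat (F : L2R3) : (inner ℂ F (matOp volume betaMat F)).im = 0 := by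
  have h : inner ℂ F (matOp volume betaMat F) = inner ℂ (matOp volume betaMat F) F := by
    rw [L2.inner_def, L2.inner_def]
    refine integral_congr_ae ?_
    filter_upwards [(act betaMat).coeFn_compLpL (p := 2) F] with x hx
    have hx' : (matOp volume betaMat F : L2R3) x = act betaMat (F x) := hx
    rw [hx', inner_act_betaMat]
  rw [← inner_conj_symm F] at h
  have := congrArg Complex.im h
  rw [Complex.conj_im] at this
  rw [← inner_conj_symm, Complex.conj_im]
  linarith

/-- Each `α_j ∂_j` is antisymmetric, since `α_j` is Hermitian and integration by parts produces a
sign. Its form is therefore purely imaginary, and the factor `-i` makes it real. -/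
theorem im_inner_schwartzDirac (m : ℝ) (s : 𝓢(E3, Spinor)) :
    (inner ℂ (s.toLp 2 (volume : Measure E3)) ((schwartzDirac m s).toLp 2 volume)).im = 0 := by
  have hre : ∀ j, (inner ℂ (s.toLp 2 (volume : Measure E3))
      ((schwartzAct (alphaMat j) (∂_{basisE j} s)).toLp 2 volume)).re = 0 := by
    intro j
    have h : inner ℂ (s.toLp 2 (volume : Measure E3))
        ((schwartzAct (alphaMat j) (∂_{basisE j} s)).toLp 2 volume) =
        -inner ℂ ((schwartzAct (alphaMat j) (∂_{basisE j} s)).toLp 2 (volume : Measure E3))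
          (s.toLp 2 volume) := by
      rw [inner_toLp, inner_toLp, schwartzAct_lineDerivOp, integral_inner_lineDerivOp]
      congr 1
      rw [← schwartzAct_lineDerivOp]
      refine integral_congr_ae (ae_of_all _ fun x => ?_)
      exact (inner_act_alphaMat j _ _).symm
    rw [← inner_conj_symm (s.toLp 2 (volume : Measure E3))] at h
    have := congrArg Complex.re h
    rw [Complex.conj_re, Complex.neg_re] at this
    rw [← inner_conj_symm, Complex.conj_re]
    linarith
  rw [schwartzDirac_apply]
  have e : ((-Complex.I) • (∑ j, schwartzAct (alphaMat j) (∂_{basisE j} s)) +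
      (m : ℂ) • schwartzAct betaMat s).toLp 2 (volume : Measure E3) =
      (-Complex.I) • (∑ j, (schwartzAct (alphaMat j) (∂_{basisE j} s)).toLp 2 volume) +
      (m : ℂ) • (matOp volume betaMat (s.toLp 2 volume)) := by
    rw [toLp_schwartzAct]
    simp only [← SchwartzMap.toLpCLM_apply (𝕜 := ℂ), map_add, map_smul, map_sum]
  rw [e, inner_add_right, inner_smul_right, inner_smul_right, Complex.add_im, Complex.im_ofReal_mul,
    im_inner_act_betaMat, inner_sum]
  have hS : (∑ j, inner ℂ (s.toLp 2 (volume : Measure E3))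
      ((schwartzAct (alphaMat j) (∂_{basisE j} s)).toLp 2 volume)).re = 0 := by
    rw [Complex.re_sum]; exact Finset.sum_eq_zero fun j _ => hre j
  rw [Complex.mul_im, hS]
  simp

theorem realForm_diracOp (m : ℝ) : RealForm (diracOp m) := by
  intro g
  obtain ⟨s, h1, h2⟩ := exists_schwartz_seq m g
  have h := Complex.continuous_im.tendsto _ |>.comp (h1.inner (𝕜 := ℂ) h2)
  refine tendsto_nhds_unique h (tendsto_const_nhds.congr fun n => ?_)
  exact (im_inner_schwartzDirac m (s n)).symm

theorem exists_isResolvent_diracOp (m : ℝ) {a : ℂ} (ha : a.im ≠ 0) :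
    ∃ R : L2R3 →L[ℂ] L2R3, IsResolvent (diracOp m) a R := by
  obtain ⟨R, hR, -⟩ := exists_isResolvent_imag m ha
  -- `H - a = (H - Re a) - i Im a`: the real part of `a` is absorbed as a bounded perturbation with
  -- real form, starting from the resolvent at `i Im a`.
  obtain ⟨R', hR'⟩ := hR.exists_perturb (M := (-(a.re : ℂ)) • (1 : L2R3 →L[ℂ] L2R3))
    (realForm_diracOp m) (by simpa using ha) (fun g => by
      rw [_root_.smul_apply, one_apply_eq_self, inner_smul_right, ← Complex.ofReal_neg,
        Complex.im_ofReal_mul]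
      exact mul_eq_zero_of_right _ (inner_self_im (𝕜 := ℂ) g))
  have key : ∀ g : (diracOp m).domain, diracOp m g - a • (g : L2R3) =
      ((-(a.re : ℂ)) • (1 : L2R3 →L[ℂ] L2R3)) (g : L2R3) + diracOp m g -
        ((a.im : ℂ) * Complex.I) • (g : L2R3) := by
    intro g
    nth_rewrite 1 [← Complex.re_add_im a]
    rw [_root_.smul_apply, one_apply_eq_self, add_smul, neg_smul]
    abel
  refine ⟨R', fun f => ?_, fun g => ?_⟩
  · obtain ⟨g, hg, hf⟩ := hR'.1 f
    exact ⟨g, hg, (key g).trans hf⟩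
  · rw [key]; exact hR'.2 g

end DiracShell

end

noncomputable section

namespace DiracShell

/-! ### The Yukawa potential -/

/-- The radial profile `e^{-κs}/(4πs)` of the Yukawa potential. -/
def radG (κ : ℂ) (s : ℝ) : ℂ := ((s⁻¹ : ℝ) : ℂ) * Complex.exp (-κ * s) / (4 * Real.pi)

/-- `radG' / s`. -/
def radG1 (κ : ℂ) (s : ℝ) : ℂ :=
  -(((s⁻¹ ^ 3 : ℝ) : ℂ) + κ * ((s⁻¹ ^ 2 : ℝ) : ℂ)) * Complex.exp (-κ * s) / (4 * Real.pi)

/-- `radG1' / s`. -/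
def radG2 (κ : ℂ) (s : ℝ) : ℂ :=
  (3 * ((s⁻¹ ^ 5 : ℝ) : ℂ) + 3 * κ * ((s⁻¹ ^ 4 : ℝ) : ℂ) + κ ^ 2 * ((s⁻¹ ^ 3 : ℝ) : ℂ)) *
    Complex.exp (-κ * s) / (4 * Real.pi)

theorem hasDerivAt_exp_neg_mul (κ : ℂ) (s : ℝ) :
    HasDerivAt (fun s : ℝ => Complex.exp (-κ * s)) (-κ * Complex.exp (-κ * s)) s := by
  have h : HasDerivAt (fun s : ℝ => -κ * (s : ℂ)) (-κ) s := by
    simpa using (Complex.ofRealCLM.hasDerivAt (x := s)).const_mul (-κ)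
  simpa [mul_comm] using h.cexp

theorem hasDerivAt_inv_pow_ofReal (n : ℕ) {s : ℝ} (hs : s ≠ 0) :
    HasDerivAt (fun s : ℝ => ((s⁻¹ ^ n : ℝ) : ℂ)) (-(n : ℂ) * ((s⁻¹ ^ (n + 1) : ℝ) : ℂ)) s := by
  have h := ((hasDerivAt_inv hs).pow n).ofReal_comp
  refine h.congr_deriv ?_
  rcases n with _ | n
  · simp
  · have hs' : (s : ℂ) ≠ 0 := by exact_mod_cast hs
    push_cast
    field_simp
    simp
    field_simp
    ring

theorem hasDerivAt_radG (κ : ℂ) {s : ℝ} (hs : s ≠ 0) :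
    HasDerivAt (radG κ) (s * radG1 κ s) s := by
  have h1 := hasDerivAt_inv_pow_ofReal 1 hs
  simp only [pow_one] at h1
  refine ((h1.mul (hasDerivAt_exp_neg_mul κ s)).div_const (4 * Real.pi)).congr_deriv ?_
  have hs' : (s : ℂ) ≠ 0 := by exact_mod_cast hs
  have hpi : (Real.pi : ℂ) ≠ 0 := by exact_mod_cast Real.pi_ne_zero
  rw [radG1]
  push_cast
  field_simp
  ring

theorem hasDerivAt_radG1 (κ : ℂ) {s : ℝ} (hs : s ≠ 0) :
    HasDerivAt (radG1 κ) (s * radG2 κ s) s := by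
  have h3 := hasDerivAt_inv_pow_ofReal 3 hs
  have h2 := (hasDerivAt_inv_pow_ofReal 2 hs).const_mul κ
  refine (((h3.add h2).neg.mul (hasDerivAt_exp_neg_mul κ s)).div_const (4 * Real.pi)).congr_deriv ?_
  have hs' : (s : ℂ) ≠ 0 := by exact_mod_cast hs
  have hpi : (Real.pi : ℂ) ≠ 0 := by exact_mod_cast Real.pi_ne_zero
  rw [radG2]
  simp only [Pi.add_apply, Pi.neg_apply]
  push_cast
  field_simp
  ring

/-- The radial form of `ΔG = κ² G` in dimension three: since `∂_j G = z_j G₁` and `∂_j G₁ = z_j G₂`,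
one has `ΔG = 3 G₁ + s² G₂` at `s = |z|`. -/
theorem radG_identity (κ : ℂ) {s : ℝ} (hs : s ≠ 0) :
    3 * radG1 κ s + (s : ℂ) ^ 2 * radG2 κ s = κ ^ 2 * radG κ s := by
  have hs' : (s : ℂ) ≠ 0 := by exact_mod_cast hs
  have hpi : (Real.pi : ℂ) ≠ 0 := by exact_mod_cast Real.pi_ne_zero
  rw [radG, radG1, radG2]
  push_cast
  field_simp
  ring

/-- The regularized radius. -/
def reg (δ : ℝ) (z : E3) : ℝ := Real.sqrt (‖z‖ ^ 2 + δ ^ 2)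

theorem continuous_reg (δ : ℝ) : Continuous (reg δ) := by unfold reg; fun_prop

theorem reg_pos {δ : ℝ} (hδ : 0 < δ) (z : E3) : 0 < reg δ z := Real.sqrt_pos.mpr (by positivity)

theorem le_reg (δ : ℝ) (z : E3) : δ ≤ reg δ z :=
  Real.le_sqrt_of_sq_le (by nlinarith [sq_nonneg ‖z‖])

theorem norm_le_reg (δ : ℝ) (z : E3) : ‖z‖ ≤ reg δ z :=
  Real.le_sqrt_of_sq_le (by nlinarith [sq_nonneg δ])

theorem reg_sq (δ : ℝ) (z : E3) : reg δ z ^ 2 = ‖z‖ ^ 2 + δ ^ 2 := Real.sq_sqrt (by positivity)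

theorem abs_apply_le_norm (z : E3) (j : Fin 3) : |z j| ≤ ‖z‖ := by
  have := PiLp.norm_apply_le z j
  rwa [Real.norm_eq_abs] at this

/-- The gradient of `reg δ` is `z / reg δ z`. Writing the derivative of `f` as `reg δ z * f'`
cancels this denominator, which is why `radG1` and `radG2` are derivatives divided by `s`. -/
theorem hasFDerivAt_comp_reg {δ : ℝ} (hδ : 0 < δ) (z : E3) {f : ℝ → ℂ} {f' : ℂ}
    (hf : HasDerivAt f (reg δ z * f') (reg δ z)) :
    HasFDerivAt (fun z => f (reg δ z)) ((innerSL ℝ z).smulRight f') z := by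
  have hp := reg_pos hδ z
  have h1 : HasFDerivAt (fun z : E3 => ‖z‖ ^ 2 + δ ^ 2) (2 • innerSL ℝ z) z :=
    (hasStrictFDerivAt_norm_sq z).hasFDerivAt.add_const _
  have h2 : HasFDerivAt (reg δ) ((1 / (2 * reg δ z)) • (2 • innerSL ℝ z)) z :=
    h1.sqrt (by positivity)
  refine (hf.hasFDerivAt.comp z h2).congr_fderiv ?_
  ext v
  have hp' : ((reg δ z : ℝ) : ℂ) ≠ 0 := by exact_mod_cast hp.ne'
  simp only [ContinuousLinearMap.comp_apply, ContinuousLinearMap.smulRight_apply,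
    _root_.smul_apply, Complex.real_smul]
  rw [ContinuousLinearMap.toSpanSingleton_apply, Complex.real_smul]
  simp only [smul_eq_mul, nsmul_eq_mul]
  push_cast
  field_simp

theorem inner_basisE (z : E3) (j : Fin 3) : inner ℝ z (basisE j) = z j := by
  rw [EuclideanSpace.inner_single_right]; simp

theorem hasLineDerivAt_comp_reg {δ : ℝ} (hδ : 0 < δ) (z : E3) (j : Fin 3) {f : ℝ → ℂ} {f' : ℂ}
    (hf : HasDerivAt f (reg δ z * f') (reg δ z)) :
    HasLineDerivAt ℝ (fun z => f (reg δ z)) ((z j : ℂ) * f') z (basisE j) := by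
  have h := (hasFDerivAt_comp_reg hδ z hf).hasLineDerivAt (basisE j)
  rwa [ContinuousLinearMap.smulRight_apply, innerSL_apply_apply, inner_basisE,
    Complex.real_smul] at h

theorem hasLineDerivAt_coord_mul_comp_reg {δ : ℝ} (hδ : 0 < δ) (z : E3) (j : Fin 3) {f : ℝ → ℂ}
    {f' : ℂ} (hf : HasDerivAt f (reg δ z * f') (reg δ z)) :
    HasLineDerivAt ℝ (fun z : E3 => (z j : ℂ) * f (reg δ z))
      (f (reg δ z) + (z j : ℂ) ^ 2 * f') z (basisE j) := by
  have hc : HasFDerivAt (fun z : E3 => (z j : ℂ))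
      (Complex.ofRealCLM.comp (EuclideanSpace.proj (𝕜 := ℝ) j)) z :=
    (Complex.ofRealCLM.comp (EuclideanSpace.proj (𝕜 := ℝ) j)).hasFDerivAt
  have h := (hc.mul (hasFDerivAt_comp_reg hδ z hf)).hasLineDerivAt (basisE j)
  refine (congrArg (fun w => HasLineDerivAt ℝ (fun z : E3 => (z j : ℂ) * f (reg δ z)) w z
    (basisE j)) ?_).mp h
  simp only [_root_.add_apply, _root_.smul_apply, ContinuousLinearMap.smulRight_apply,
    innerSL_apply_apply, inner_basisE, ContinuousLinearMap.comp_apply, Complex.real_smul,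
    smul_eq_mul, Complex.ofRealCLM_apply]
  simp
  ring

theorem norm_exp_neg_mul (κ : ℂ) (s : ℝ) : ‖Complex.exp (-κ * s)‖ = Real.exp (-κ.re * s) := by
  rw [Complex.norm_exp]; simp

theorem norm_four_pi_inv_le (z : ℂ) : ‖z / (4 * Real.pi)‖ ≤ ‖z‖ := by
  rw [norm_div]
  refine div_le_self (norm_nonneg _) ?_
  rw [norm_mul, Complex.norm_real, Real.norm_of_nonneg Real.pi_pos.le]
  norm_num
  nlinarith [Real.pi_gt_three]

/-- An integrable radial majorant. -/
def yukMaj (c s : ℝ) : ℝ := (s⁻¹ + s⁻¹ ^ 2) * Real.exp (-c * s)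

theorem yukMaj_nonneg {c s : ℝ} (hs : 0 ≤ s) : 0 ≤ yukMaj c s := by unfold yukMaj; positivity

theorem yukMaj_anti {c r s : ℝ} (hc : 0 < c) (hr : 0 < r) (hrs : r ≤ s) :
    yukMaj c s ≤ yukMaj c r := by
  unfold yukMaj
  have hs : 0 < s := hr.trans_le hrs
  have h1 : s⁻¹ ≤ r⁻¹ := inv_anti₀ hr hrs
  have h2 : -c * s ≤ -c * r := by nlinarith
  gcongr

theorem norm_radG_le {κ : ℂ} {s : ℝ} (hs : 0 < s) : ‖radG κ s‖ ≤ yukMaj κ.re s := by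
  refine (norm_four_pi_inv_le _).trans ?_
  rw [norm_mul, norm_exp_neg_mul, Complex.norm_real, Real.norm_of_nonneg (by positivity), yukMaj]
  gcongr
  have : 0 ≤ s⁻¹ ^ 2 := by positivity
  linarith

theorem norm_mul_radG1_le {κ : ℂ} {s : ℝ} (hs : 0 < s) {r : ℝ} (hr : |r| ≤ s) :
    ‖(r : ℂ) * radG1 κ s‖ ≤ (1 + ‖κ‖) * yukMaj κ.re s := by
  have h1 : ‖radG1 κ s‖ ≤ (s⁻¹ ^ 3 + ‖κ‖ * s⁻¹ ^ 2) * Real.exp (-κ.re * s) := by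
    refine (norm_four_pi_inv_le _).trans ?_
    rw [norm_mul, norm_exp_neg_mul, norm_neg]
    gcongr
    refine (norm_add_le _ _).trans ?_
    rw [norm_mul, Complex.norm_real, Complex.norm_real, Real.norm_of_nonneg (by positivity),
      Real.norm_of_nonneg (by positivity)]
  rw [norm_mul, Complex.norm_real, Real.norm_eq_abs]
  calc |r| * ‖radG1 κ s‖ ≤ s * ((s⁻¹ ^ 3 + ‖κ‖ * s⁻¹ ^ 2) * Real.exp (-κ.re * s)) := by gcongr
    _ = (s⁻¹ ^ 2 + ‖κ‖ * s⁻¹) * Real.exp (-κ.re * s) := by field_simp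
    _ ≤ (1 + ‖κ‖) * yukMaj κ.re s := by
      rw [yukMaj, ← mul_assoc]
      gcongr
      have h2 : 0 ≤ ‖κ‖ * s⁻¹ ^ 2 := by positivity
      have h3 : 0 ≤ s⁻¹ := by positivity
      nlinarith

/-- The weight `s²` of polar coordinates in dimension three absorbs the singularity `s⁻²`, and what
remains is `(s + 1) e^{-cs}`. -/
theorem integrable_yukMaj {c : ℝ} (hc : 0 < c) : Integrable (fun z : E3 => yukMaj c ‖z‖) := by
  rw [integrable_fun_norm_addHaar]
  have hdim : Module.finrank ℝ E3 - 1 = 2 := by simp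
  rw [hdim]
  have h1 : IntegrableOn (fun y : ℝ => Real.exp (-c * y)) (Ioi 0) := exp_neg_integrableOn_Ioi 0 hc
  have h2 : IntegrableOn (fun y : ℝ => y * Real.exp (-c * y)) (Ioi 0) := by
    have := integrableOn_rpow_mul_exp_neg_mul_rpow (p := 1) (s := 1) (b := c) (by norm_num)
      zero_lt_one hc
    simpa using this
  refine (h1.add h2).congr_fun (fun y hy => ?_) measurableSet_Ioi
  have hy' : (y : ℝ) ≠ 0 := (mem_Ioi.mp hy).ne'
  simp only [Pi.add_apply, smul_eq_mul, yukMaj]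
  field_simp
  ring


theorem integrable_yukMaj_sub {c : ℝ} (hc : 0 < c) (x : E3) :
    Integrable (fun y : E3 => yukMaj c ‖x - y‖) :=
  (integrable_yukMaj hc).comp_sub_left x

/-! ### Integration by parts against a smooth bounded kernel -/

theorem exists_norm_le_schwartz {F : Type*} [NormedAddCommGroup F] [NormedSpace ℝ F]
    (h : 𝓢(E3, F)) : ∃ M : ℝ, 0 ≤ M ∧ ∀ x, ‖h x‖ ≤ M := by
  obtain ⟨M, hM⟩ := h.decay 0 0
  exact ⟨M, hM.1.le, fun x => by simpa using hM.2 x⟩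

theorem integrable_bdd_smul_schwartz {k : E3 → ℂ} (hk : Continuous k) {C : ℝ}
    (hC : ∀ z, ‖k z‖ ≤ C) (x : E3) (h : 𝓢(E3, Spinor)) :
    Integrable (fun y => k (x - y) • h y) :=
  h.integrable.bdd_smul C (hk.comp (continuous_const.sub continuous_id)).aestronglyMeasurable
    (ae_of_all _ fun _ => hC _)

/-- There is no minus sign: the one from integration by parts cancels the one from differentiating
`k (x - y)` in `y`. -/
theorem integral_smul_lineDerivOp_eq {k k' : E3 → ℂ} {v : E3}
    (hd : ∀ z, HasLineDerivAt ℝ k (k' z) z v) (hk : Continuous k) (hk' : Continuous k')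
    {C C' : ℝ} (hC : ∀ z, ‖k z‖ ≤ C) (hC' : ∀ z, ‖k' z‖ ≤ C') (x : E3) (h : 𝓢(E3, Spinor)) :
    ∫ y, k (x - y) • (∂_{v} h) y = ∫ y, k' (x - y) • h y := by
  have hline : ∀ y, HasLineDerivAt ℝ (fun y => k (x - y)) (-k' (x - y)) y v := by
    intro y
    have h0 := (hd (x - y))
    unfold HasLineDerivAt at h0 ⊢
    have hneg : HasDerivAt (fun t : ℝ => -t) (-1) 0 := hasDerivAt_neg (0 : ℝ)
    have h1 := HasDerivAt.scomp (h := fun t : ℝ => -t) (0 : ℝ) (by simpa using h0) hneg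
    refine (h1.congr_deriv (by simp)).congr_of_eventuallyEq (Eventually.of_forall fun t => ?_)
    simp only [Function.comp_apply]
    congr 1
    rw [neg_smul]; abel
  have h1 := integral_bilinear_hasLineDerivAt_right_eq_neg_left_of_integrable
    (μ := (volume : Measure E3)) (v := v) (B := ContinuousLinearMap.lsmul ℝ ℂ)
    (f := fun y => k (x - y)) (f' := fun y => -k' (x - y)) (g := h) (g' := fun y => (∂_{v} h : 𝓢(E3, Spinor)) y)
    ?_ ?_ ?_ (fun y _ => hline y) (fun y _ => ?_)
  · simp only [ContinuousLinearMap.lsmul_apply] at h1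
    rw [h1, ← integral_neg]
    simp
  · simp only [ContinuousLinearMap.lsmul_apply, neg_smul]
    exact (integrable_bdd_smul_schwartz hk' hC' x h).neg
  · exact integrable_bdd_smul_schwartz hk hC x _
  · exact integrable_bdd_smul_schwartz hk hC x _
  · rw [lineDerivOp_apply']
    exact (h.hasFDerivAt y).hasLineDerivAt v

theorem tendsto_reg (z : E3) : Tendsto (fun δ => reg δ z) (𝓝[>] 0) (𝓝 ‖z‖) := by
  have h : Continuous fun δ : ℝ => reg δ z := by unfold reg; fun_prop
  have h0 := h.tendsto 0
  have e : reg 0 z = ‖z‖ := by simp [reg, Real.sqrt_sq (norm_nonneg z)]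
  rw [e] at h0
  exact h0.mono_left nhdsWithin_le_nhds

/-- Removing the regularization of a kernel. -/
theorem tendsto_integral_reg {p : E3 → ℝ → ℂ} {c C : ℝ} (hc : 0 < c)
    (hp : ∀ δ > 0, Continuous fun z => p z (reg δ z))
    (hp' : ∀ z, ∀ s ≠ 0, ContinuousAt (p z) s)
    (hC : ∀ z s, 0 < s → ‖z‖ ≤ s → ‖p z s‖ ≤ C * yukMaj c s) (hC0 : 0 ≤ C) (x : E3)
    (h : 𝓢(E3, Spinor)) :
    Tendsto (fun δ => ∫ y, p (x - y) (reg δ (x - y)) • h y) (𝓝[>] 0)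
      (𝓝 (∫ y, p (x - y) ‖x - y‖ • h y)) := by
  obtain ⟨M, hM0, hM⟩ := exists_norm_le_schwartz h
  have hne : ∀ᵐ y : E3, y ≠ x := by
    rw [ae_iff]; simp
  -- `yukMaj` decreases and `|z| ≤ reg δ z`, so its value at `|x - y|` dominates the regularized
  -- kernels for all `δ` at once; the factor `M` bounds `h`.
  refine tendsto_integral_filter_of_dominated_convergence
    (fun y => C * yukMaj c ‖x - y‖ * M) ?_ ?_ ?_ ?_
  · filter_upwards [self_mem_nhdsWithin] with δ hδ
    exact (((hp δ hδ).comp (continuous_const.sub continuous_id)).smul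
      h.continuous).aestronglyMeasurable
  · filter_upwards [self_mem_nhdsWithin] with δ hδ
    filter_upwards [hne] with y hy
    have hpos : 0 < ‖x - y‖ := norm_pos_iff.mpr (sub_ne_zero.mpr hy.symm)
    rw [norm_smul]
    have h1 := hC (x - y) _ (reg_pos hδ _) (norm_le_reg δ _)
    have h2 := yukMaj_anti hc hpos (norm_le_reg δ (x - y))
    have h3 : 0 ≤ yukMaj c ‖x - y‖ := yukMaj_nonneg hpos.le
    gcongr
    · exact h1.trans (by gcongr)
    · exact hM y
  · exact ((integrable_yukMaj_sub hc x).const_mul C).mul_const M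
  · filter_upwards [hne] with y hy
    have hpos : ‖x - y‖ ≠ 0 := norm_ne_zero_iff.mpr (sub_ne_zero.mpr hy.symm)
    exact ((hp' (x - y) _ hpos).tendsto.comp (tendsto_reg (x - y))).smul_const _

end DiracShell

end

noncomputable section

namespace DiracShell

/-! ### The Yukawa kernel at the regularized radius: bounds, integration by parts and the Helmholtz
equation -/

theorem continuousAt_radG2 (κ : ℂ) {s : ℝ} (hs : s ≠ 0) : ContinuousAt (radG2 κ) s := by
  have h5 := (hasDerivAt_inv_pow_ofReal 5 hs).continuousAt
  have h4 := ((hasDerivAt_inv_pow_ofReal 4 hs).const_mul (3 * κ)).continuousAt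
  have h3 := ((hasDerivAt_inv_pow_ofReal 3 hs).const_mul (κ ^ 2)).continuousAt
  have he := (hasDerivAt_exp_neg_mul κ s).continuousAt
  exact ((((h5.const_mul 3).add h4).add h3).mul he).div_const _

theorem continuous_radG_reg (κ : ℂ) {δ : ℝ} (hδ : 0 < δ) :
    Continuous fun z => radG κ (reg δ z) :=
  continuous_iff_continuousAt.mpr fun z =>
    (hasDerivAt_radG κ (reg_pos hδ z).ne').continuousAt.comp (continuous_reg δ).continuousAt

theorem continuous_radG1_reg (κ : ℂ) {δ : ℝ} (hδ : 0 < δ) :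
    Continuous fun z => radG1 κ (reg δ z) :=
  continuous_iff_continuousAt.mpr fun z =>
    (hasDerivAt_radG1 κ (reg_pos hδ z).ne').continuousAt.comp (continuous_reg δ).continuousAt

theorem continuous_radG2_reg (κ : ℂ) {δ : ℝ} (hδ : 0 < δ) :
    Continuous fun z => radG2 κ (reg δ z) :=
  continuous_iff_continuousAt.mpr fun z => ContinuousAt.comp
    (continuousAt_radG2 κ (reg_pos hδ z).ne') (continuous_reg δ).continuousAt

theorem continuous_coord_mul_radG1_reg (κ : ℂ) (j : Fin 3) {δ : ℝ} (hδ : 0 < δ) :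
    Continuous fun z : E3 => (z j : ℂ) * radG1 κ (reg δ z) :=
  (by fun_prop : Continuous fun z : E3 => (z j : ℂ)).mul (continuous_radG1_reg κ hδ)

theorem norm_radG_reg_le {κ : ℂ} (hκ : 0 < κ.re) {δ : ℝ} (hδ : 0 < δ) (z : E3) :
    ‖radG κ (reg δ z)‖ ≤ yukMaj κ.re δ :=
  (norm_radG_le (reg_pos hδ z)).trans (yukMaj_anti hκ hδ (le_reg δ z))

theorem norm_coord_mul_radG1_reg_le {κ : ℂ} (hκ : 0 < κ.re) (j : Fin 3) {δ : ℝ} (hδ : 0 < δ)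
    (z : E3) : ‖(z j : ℂ) * radG1 κ (reg δ z)‖ ≤ (1 + ‖κ‖) * yukMaj κ.re δ := by
  refine (norm_mul_radG1_le (reg_pos hδ z)
    ((abs_apply_le_norm z j).trans (norm_le_reg δ z))).trans ?_
  have := yukMaj_anti hκ hδ (le_reg δ z)
  gcongr

theorem norm_radG1_reg_le {κ : ℂ} (hκ : 0 < κ.re) {δ : ℝ} (hδ : 0 < δ) (z : E3) :
    ‖radG1 κ (reg δ z)‖ ≤ (1 + ‖κ‖) * yukMaj κ.re δ / δ := by
  have h1 := norm_mul_radG1_le (κ := κ) (reg_pos hδ z)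
    ((abs_of_pos hδ).le.trans (le_reg δ z))
  have h2 := yukMaj_anti hκ hδ (le_reg δ z)
  rw [norm_mul, Complex.norm_real, Real.norm_of_nonneg hδ.le] at h1
  rw [le_div_iff₀ hδ, mul_comm]
  exact h1.trans (by gcongr)

/-- Since `|z_j| ≤ reg δ z`, it suffices to bound `s² G₂ = κ² G - 3 G₁` at `s = reg δ z`, so no
separate estimate of `radG2` is needed. -/
theorem norm_coord_sq_mul_radG2_reg_le {κ : ℂ} (hκ : 0 < κ.re) (j : Fin 3) {δ : ℝ} (hδ : 0 < δ)
    (z : E3) : ‖(z j : ℂ) ^ 2 * radG2 κ (reg δ z)‖ ≤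
      ‖κ‖ ^ 2 * yukMaj κ.re δ + 3 * ((1 + ‖κ‖) * yukMaj κ.re δ / δ) := by
  have hid := radG_identity κ (reg_pos hδ z).ne'
  have h1 : ‖(z j : ℂ) ^ 2 * radG2 κ (reg δ z)‖ ≤ ‖((reg δ z : ℝ) : ℂ) ^ 2 * radG2 κ (reg δ z)‖ := by
    rw [norm_mul, norm_mul, norm_pow, norm_pow, Complex.norm_real, Complex.norm_real]
    have : ‖z j‖ ≤ ‖reg δ z‖ := by
      rw [Real.norm_eq_abs, Real.norm_of_nonneg (reg_pos hδ z).le]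
      exact (abs_apply_le_norm z j).trans (norm_le_reg δ z)
    gcongr
  have h2 : ((reg δ z : ℝ) : ℂ) ^ 2 * radG2 κ (reg δ z) =
      κ ^ 2 * radG κ (reg δ z) - 3 * radG1 κ (reg δ z) := by rw [← hid]; ring
  refine h1.trans ?_
  rw [h2]
  refine (norm_sub_le _ _).trans ?_
  rw [norm_mul, norm_mul, norm_pow]
  have h3 := norm_radG_reg_le hκ hδ z
  have h4 := norm_radG1_reg_le hκ hδ z
  have h5 : ‖(3 : ℂ)‖ = 3 := by norm_num
  rw [h5]
  gcongr

theorem integral_radG_reg_smul_lineDeriv {κ : ℂ} (hκ : 0 < κ.re) (j : Fin 3) {δ : ℝ} (hδ : 0 < δ)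
    (x : E3) (h : 𝓢(E3, Spinor)) :
    ∫ y, radG κ (reg δ (x - y)) • (∂_{(basisE j)} h) y =
      ∫ y, (((x - y) j : ℂ) * radG1 κ (reg δ (x - y))) • h y :=
  integral_smul_lineDerivOp_eq (k := fun z => radG κ (reg δ z))
    (k' := fun z => (z j : ℂ) * radG1 κ (reg δ z))
    (fun z => hasLineDerivAt_comp_reg hδ z j (hasDerivAt_radG κ (reg_pos hδ z).ne'))
    (continuous_radG_reg κ hδ) (continuous_coord_mul_radG1_reg κ j hδ)
    (norm_radG_reg_le hκ hδ) (norm_coord_mul_radG1_reg_le hκ j hδ) x h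

theorem integral_coord_mul_radG1_reg_smul_lineDeriv {κ : ℂ} (hκ : 0 < κ.re) (j : Fin 3) {δ : ℝ}
    (hδ : 0 < δ) (x : E3) (h : 𝓢(E3, Spinor)) :
    ∫ y, (((x - y) j : ℂ) * radG1 κ (reg δ (x - y))) • (∂_{(basisE j)} h) y =
      ∫ y, (radG1 κ (reg δ (x - y)) + ((x - y) j : ℂ) ^ 2 * radG2 κ (reg δ (x - y))) • h y :=
  integral_smul_lineDerivOp_eq (k := fun z => (z j : ℂ) * radG1 κ (reg δ z))
    (k' := fun z => radG1 κ (reg δ z) + (z j : ℂ) ^ 2 * radG2 κ (reg δ z))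
    (fun z => hasLineDerivAt_coord_mul_comp_reg hδ z j (hasDerivAt_radG1 κ (reg_pos hδ z).ne'))
    (continuous_coord_mul_radG1_reg κ j hδ)
    ((continuous_radG1_reg κ hδ).add
      ((by fun_prop : Continuous fun z : E3 => (z j : ℂ) ^ 2).mul (continuous_radG2_reg κ hδ)))
    (norm_coord_mul_radG1_reg_le hκ j hδ)
    (fun z => (norm_add_le _ _).trans (add_le_add (norm_radG1_reg_le hκ hδ z)
      (norm_coord_sq_mul_radG2_reg_le hκ j hδ z))) x h

/-- Integration by parts against the Yukawa potential. -/
theorem integral_radG_smul_lineDeriv {κ : ℂ} (hκ : 0 < κ.re) (j : Fin 3)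
    (x : E3) (h : 𝓢(E3, Spinor)) :
    ∫ y, radG κ ‖x - y‖ • (∂_{(basisE j)} h) y =
      ∫ y, (((x - y) j : ℂ) * radG1 κ ‖x - y‖) • h y := by
  have h1 := tendsto_integral_reg (p := fun _ s => radG κ s) (C := 1) hκ
    (fun δ hδ => continuous_radG_reg κ hδ) (fun z s hs => (hasDerivAt_radG κ hs).continuousAt)
    (fun z s hs _ => by simpa using norm_radG_le hs) zero_le_one x (∂_{(basisE j)} h)
  have h2 := tendsto_integral_reg (p := fun z s => (z j : ℂ) * radG1 κ s) (C := 1 + ‖κ‖) hκ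
    (fun δ hδ => continuous_coord_mul_radG1_reg κ j hδ)
    (fun z s hs => (hasDerivAt_radG1 κ hs).continuousAt.const_mul _)
    (fun z s hs hz => norm_mul_radG1_le hs ((abs_apply_le_norm z j).trans hz))
    (by positivity) x h
  refine tendsto_nhds_unique (h1.congr' ?_) h2
  filter_upwards [self_mem_nhdsWithin] with δ hδ
  exact integral_radG_reg_smul_lineDeriv hκ j hδ x h

/-- Two integrations by parts turn the Laplacian into `3 G₁ + |z|² G₂`, while `κ² G = 3 G₁ + (|z|² +
δ²) G₂` at the regularized radius. The difference `δ² G₂` is the approximate Dirac mass studied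
next. -/
theorem integral_radG_reg_helmholtz {κ : ℂ} (hκ : 0 < κ.re) {δ : ℝ} (hδ : 0 < δ)
    (x : E3) (h : 𝓢(E3, Spinor)) :
    ∫ y, radG κ (reg δ (x - y)) • (κ ^ 2 • h - ∑ j, ∂_{(basisE j)} (∂_{(basisE j)} h)) y =
      ∫ y, ((δ : ℂ) ^ 2 * radG2 κ (reg δ (x - y))) • h y := by
  have hi : ∀ g : 𝓢(E3, Spinor), Integrable fun y => radG κ (reg δ (x - y)) • g y := fun g =>
    integrable_bdd_smul_schwartz (k := fun z => radG κ (reg δ z)) (continuous_radG_reg κ hδ)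
      (norm_radG_reg_le hκ hδ) x g
  have hi2 : ∀ j : Fin 3, Integrable fun y => (radG1 κ (reg δ (x - y)) +
      ((x - y) j : ℂ) ^ 2 * radG2 κ (reg δ (x - y))) • h y := fun j =>
    integrable_bdd_smul_schwartz
      (k := fun z => radG1 κ (reg δ z) + (z j : ℂ) ^ 2 * radG2 κ (reg δ z))
      ((continuous_radG1_reg κ hδ).add
        ((by fun_prop : Continuous fun z : E3 => (z j : ℂ) ^ 2).mul (continuous_radG2_reg κ hδ)))
      (fun z => (norm_add_le _ _).trans (add_le_add (norm_radG1_reg_le hκ hδ z)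
        (norm_coord_sq_mul_radG2_reg_le hκ j hδ z))) x h
  have hsum : ∫ y, radG κ (reg δ (x - y)) • (∑ j, ∂_{(basisE j)} (∂_{(basisE j)} h)) y =
      ∫ y, ∑ j, (radG1 κ (reg δ (x - y)) +
        ((x - y) j : ℂ) ^ 2 * radG2 κ (reg δ (x - y))) • h y := by
    rw [integral_finsetSum _ fun j _ => hi2 j]
    simp only [sum_apply, Finset.smul_sum]
    rw [integral_finsetSum _ fun j _ => hi _]
    refine Finset.sum_congr rfl fun j _ => ?_
    rw [integral_radG_reg_smul_lineDeriv hκ j hδ,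
      integral_coord_mul_radG1_reg_smul_lineDeriv hκ j hδ]
  have hsub : ∀ y, radG κ (reg δ (x - y)) •
      (κ ^ 2 • h - ∑ j, ∂_{(basisE j)} (∂_{(basisE j)} h)) y =
      κ ^ 2 • (radG κ (reg δ (x - y)) • h y) -
      radG κ (reg δ (x - y)) • (∑ j, ∂_{(basisE j)} (∂_{(basisE j)} h)) y := by
    intro y
    rw [sub_apply, smul_apply, smul_sub, smul_comm]
  have hκi : Integrable fun y => κ ^ 2 • (radG κ (reg δ (x - y)) • h y) := (hi h).smul (κ ^ 2)
  simp_rw [hsub]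
  rw [integral_sub hκi (hi _), hsum, ← integral_sub hκi
    (integrable_finsetSum _ fun j _ => hi2 j)]
  refine integral_congr_ae (ae_of_all _ fun y => ?_)
  simp only [smul_smul, ← Finset.sum_smul, ← sub_smul]
  congr 1
  rw [← radG_identity κ (reg_pos hδ (x - y)).ne']
  have hn : ((‖x - y‖ : ℝ) : ℂ) ^ 2 = ∑ j, ((x - y) j : ℂ) ^ 2 := by
    rw [← Complex.ofReal_pow, EuclideanSpace.real_norm_sq_eq]; push_cast; rfl
  have hr : ((reg δ (x - y) : ℝ) : ℂ) ^ 2 = ((‖x - y‖ : ℝ) : ℂ) ^ 2 + (δ : ℂ) ^ 2 := by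
    exact_mod_cast congrArg Complex.ofReal (reg_sq δ (x - y))
  rw [hr, hn, Finset.sum_add_distrib, ← Finset.sum_mul]
  simp
  ring

/-! ### The regularized Dirac mass -/

/-- Homogeneity under `s ↦ δs`, with `κ` replaced by `κδ`. The power `δ⁵` matches the factor `δ²` of
the kernel times the volume factor `δ³` of `z = δw`. -/
theorem radG2_scale (κ : ℂ) {δ s : ℝ} (hδ : 0 < δ) (hs : 0 < s) :
    (δ : ℂ) ^ 5 * radG2 κ (δ * s) = radG2 (κ * δ) s := by
  have hs' : (s : ℂ) ≠ 0 := by exact_mod_cast hs.ne'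
  have hδ' : (δ : ℂ) ≠ 0 := by exact_mod_cast hδ.ne'
  have e : -κ * ((δ * s : ℝ) : ℂ) = -(κ * δ) * s := by push_cast; ring
  rw [radG2, radG2, e]
  push_cast
  field_simp

theorem reg_smul {δ : ℝ} (hδ : 0 < δ) (w : E3) : reg δ (δ • w) = δ * reg 1 w := by
  rw [reg, reg, norm_smul, Real.norm_of_nonneg hδ.le,
    show (δ * ‖w‖) ^ 2 + δ ^ 2 = δ ^ 2 * (‖w‖ ^ 2 + 1 ^ 2) by ring,
    Real.sqrt_mul (sq_nonneg δ), Real.sqrt_sq hδ.le]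

theorem integral_radG2_reg_eq (κ : ℂ) {δ : ℝ} (hδ : 0 < δ) (x : E3) (h : E3 → Spinor) :
    ∫ y, ((δ : ℂ) ^ 2 * radG2 κ (reg δ (x - y))) • h y =
      ∫ w, radG2 (κ * δ) (reg 1 w) • h (x - δ • w) := by
  have h1 := integral_sub_left_eq_self
    (fun z => ((δ : ℂ) ^ 2 * radG2 κ (reg δ z)) • h (x - z)) (volume : Measure E3) x
  simp only [sub_sub_cancel] at h1
  have h2 := Measure.integral_comp_smul (volume : Measure E3)
    (fun z => ((δ : ℂ) ^ 2 * radG2 κ (reg δ z)) • h (x - z)) δ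
  rw [h1]
  have hfr : Module.finrank ℝ E3 = 3 := by simp
  rw [hfr, abs_of_pos (by positivity), eq_comm, inv_smul_eq_iff₀ (by positivity)] at h2
  rw [h2, ← integral_smul]
  refine integral_congr_ae (ae_of_all _ fun w => ?_)
  simp only [reg_smul hδ, ← radG2_scale κ hδ (reg_pos one_pos w)]
  rw [← Complex.coe_smul, smul_smul]
  congr 1
  push_cast
  ring

/-- A majorant uniform in `δ ≤ 1`. The power `s⁻⁴` is integrable at infinity in dimension three,
whereas the last term of `radG2` only offers `s⁻³`; the missing power is taken from the exponential.
-/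
theorem norm_radG2_scaled_le {κ : ℂ} (hκ : 0 < κ.re) {δ s : ℝ} (hδ : 0 < δ) (hδ1 : δ ≤ 1)
    (hs : 1 ≤ s) :
    ‖radG2 (κ * δ) s‖ ≤ (3 + 3 * ‖κ‖ + ‖κ‖ ^ 2 / κ.re) * s⁻¹ ^ 4 := by
  have hs0 : 0 < s := by linarith
  have hs1 : s⁻¹ ≤ 1 := inv_le_one_of_one_le₀ hs
  have hre : (κ * δ).re = κ.re * δ := by simp
  have hb := norm_exp_neg_mul (κ * δ) s
  rw [hre] at hb
  set E := Real.exp (-(κ.re * δ) * s) with hE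
  have hE0 : 0 ≤ E := (Real.exp_pos _).le
  have hE1 : E ≤ 1 := by
    rw [hE, Real.exp_le_one_iff]; have : 0 ≤ κ.re * δ * s := by positivity
    linarith
  -- The inequality `t e^{-t} ≤ 1` at `t = κ.re · δ · s`, from `1 + t ≤ e^t`. It trades the
  -- exponential for the factor `s⁻¹` used in `t3`.
  have hE2 : κ.re * δ * s * E ≤ 1 := by
    have h := Real.add_one_le_exp (κ.re * δ * s)
    have hm : E * Real.exp (κ.re * δ * s) = 1 := by
      rw [hE, ← Real.exp_add]; simp
    nlinarith
  refine (norm_four_pi_inv_le _).trans ?_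
  rw [norm_mul, hb]
  have h3 : ‖(3 : ℂ)‖ = 3 := by norm_num
  have hn : ‖3 * ((s⁻¹ ^ 5 : ℝ) : ℂ) + 3 * (κ * δ) * ((s⁻¹ ^ 4 : ℝ) : ℂ) +
      (κ * δ) ^ 2 * ((s⁻¹ ^ 3 : ℝ) : ℂ)‖ ≤
      3 * s⁻¹ ^ 5 + 3 * (‖κ‖ * δ) * s⁻¹ ^ 4 + (‖κ‖ * δ) ^ 2 * s⁻¹ ^ 3 := by
    refine (norm_add₃_le).trans (le_of_eq ?_)
    simp only [norm_mul, norm_pow, Complex.norm_real, h3, Real.norm_of_nonneg hδ.le,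
      Real.norm_of_nonneg (by positivity : (0 : ℝ) ≤ s⁻¹ ^ 5),
      Real.norm_of_nonneg (by positivity : (0 : ℝ) ≤ s⁻¹ ^ 4),
      Real.norm_of_nonneg (by positivity : (0 : ℝ) ≤ s⁻¹ ^ 3)]
  refine (mul_le_mul_of_nonneg_right hn hE0).trans ?_
  have t1 : 3 * s⁻¹ ^ 5 * E ≤ 3 * s⁻¹ ^ 4 := by
    have : s⁻¹ ^ 5 ≤ s⁻¹ ^ 4 := pow_le_pow_of_le_one (by positivity) hs1 (by norm_num)
    calc 3 * s⁻¹ ^ 5 * E ≤ 3 * s⁻¹ ^ 4 * 1 := by gcongr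
      _ = _ := by ring
  have t2 : 3 * (‖κ‖ * δ) * s⁻¹ ^ 4 * E ≤ 3 * ‖κ‖ * s⁻¹ ^ 4 := by
    calc 3 * (‖κ‖ * δ) * s⁻¹ ^ 4 * E ≤ 3 * (‖κ‖ * 1) * s⁻¹ ^ 4 * 1 := by gcongr
      _ = _ := by ring
  have t3 : (‖κ‖ * δ) ^ 2 * s⁻¹ ^ 3 * E ≤ ‖κ‖ ^ 2 / κ.re * s⁻¹ ^ 4 := by
    have e : (‖κ‖ * δ) ^ 2 * s⁻¹ ^ 3 * E =
        ‖κ‖ ^ 2 / κ.re * s⁻¹ ^ 4 * (δ * (κ.re * δ * s * E)) := by field_simp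
    rw [e]
    refine mul_le_of_le_one_right (by positivity) ?_
    exact mul_le_one₀ hδ1 (by positivity) hE2
  linarith

theorem integrable_inv_reg_pow_four : Integrable fun w : E3 => (reg 1 w)⁻¹ ^ 4 := by
  have h := integrable_rpow_neg_one_add_norm_sq (E := E3) (μ := volume) (r := 4) (by simp; norm_num)
  refine h.congr (ae_of_all _ fun w => ?_)
  have hp := reg_pos one_pos w
  have e : (1 : ℝ) + ‖w‖ ^ 2 = reg 1 w ^ 2 := by rw [reg_sq]; ring
  simp only [e]
  rw [show (-(4 : ℝ) / 2) = ((-2 : ℤ) : ℝ) by norm_num, Real.rpow_intCast]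
  rw [zpow_neg, inv_pow]
  norm_cast
  rw [← pow_mul]

/-- The normalization of the Dirac mass. At `κ = 0` the kernel is `3 (1 + |w|²)^{-5/2} / (4π)`, and
in polar coordinates `3y² (1 + y²)^{-5/2}` is the derivative of `(y / √(1 + y²))³`, which runs from
0 to 1. -/
theorem integral_reg_inv_pow_five : ∫ w : E3, radG2 0 (reg 1 w) = 1 := by
  have hf : ∀ y : ℝ, 0 < 1 + y ^ 2 := fun y => by positivity
  have hsq : ∀ y : ℝ, Real.sqrt (1 + y ^ 2) ^ 2 = 1 + y ^ 2 := fun y => Real.sq_sqrt (hf y).le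
  have hpos : ∀ y : ℝ, 0 < Real.sqrt (1 + y ^ 2) := fun y => Real.sqrt_pos.mpr (hf y)
  have hderiv : ∀ y : ℝ, HasDerivAt (fun y : ℝ => (y / Real.sqrt (1 + y ^ 2)) ^ 3)
      (3 * y ^ 2 * (Real.sqrt (1 + y ^ 2))⁻¹ ^ 5) y := by
    intro y
    have h1 : HasDerivAt (fun y : ℝ => 1 + y ^ 2) (2 * y) y := by
      simpa using (hasDerivAt_pow 2 y).const_add 1
    have h2 := h1.sqrt (hf y).ne'
    refine (((hasDerivAt_id y).div h2 (hpos y).ne').pow 3).congr_deriv ?_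
    have h3 := hsq y
    have h0 := (hpos y).ne'
    simp only [Pi.div_apply, id]
    generalize Real.sqrt (1 + y ^ 2) = r at h3 h0
    have h4 : (1 : ℝ) * r - y * (2 * y / (2 * r)) = 1 / r := by
      field_simp
      rw [h3]; ring
    rw [h4]
    push_cast
    field_simp
  have hlim : Tendsto (fun y : ℝ => (y / Real.sqrt (1 + y ^ 2)) ^ 3) atTop (𝓝 1) := by
    have h1 : Tendsto (fun y : ℝ => Real.sqrt (1 / (y⁻¹ ^ 2 + 1))) atTop (𝓝 1) := by
      have : Tendsto (fun y : ℝ => Real.sqrt (1 / (y⁻¹ ^ 2 + 1))) atTop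
          (𝓝 (Real.sqrt (1 / (0 ^ 2 + 1)))) := by
        refine (Real.continuous_sqrt.tendsto _).comp ?_
        exact tendsto_const_nhds.div ((tendsto_inv_atTop_zero.pow 2).add_const 1) (by norm_num)
      simpa using this
    have h2 : Tendsto (fun y : ℝ => y / Real.sqrt (1 + y ^ 2)) atTop (𝓝 1) := by
      refine h1.congr' ?_
      filter_upwards [eventually_gt_atTop 0] with y hy
      rw [eq_div_iff (hpos y).ne', ← Real.sqrt_mul (by positivity)]
      rw [Real.sqrt_eq_iff_mul_self_eq (by positivity) hy.le]
      field_simp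
    simpa using h2.pow 3
  have hint := integral_Ioi_of_hasDerivAt_of_nonneg' (a := 0) (fun y _ => hderiv y)
    (fun y _ => by positivity) hlim
  have hrad := integral_fun_norm_addHaar (volume : Measure E3)
    (fun y : ℝ => 3 * (Real.sqrt (1 + y ^ 2))⁻¹ ^ 5)
  have hdim : Module.finrank ℝ E3 = 3 := by simp
  have hint' : ∫ y in Ioi (0 : ℝ), y ^ 2 * (3 * (Real.sqrt (1 + y ^ 2))⁻¹ ^ 5) = 1 := by
    refine Eq.trans ?_ (hint.trans (by simp))
    exact integral_congr_ae (ae_of_all _ fun y => by ring)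
  have hball : (volume : Measure E3).real (Metric.ball 0 1) = 4 * Real.pi / 3 := by
    rw [measureReal_def, EuclideanSpace.volume_ball_fin_three]
    rw [ENNReal.toReal_mul, ENNReal.toReal_pow, ENNReal.toReal_ofReal (by norm_num),
      ENNReal.toReal_ofReal (by positivity)]
    ring
  simp only [hdim, smul_eq_mul, Nat.add_one_sub_one, hint', hball] at hrad
  have e : ∀ w : E3, radG2 0 (reg 1 w) =
      ((3 * (Real.sqrt (1 + ‖w‖ ^ 2))⁻¹ ^ 5 / (4 * Real.pi) : ℝ) : ℂ) := by
    intro w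
    rw [radG2, reg, add_comm (‖w‖ ^ 2)]
    simp
  simp_rw [e]
  rw [integral_complex_ofReal, integral_div, hrad]
  have := Real.pi_ne_zero
  norm_cast
  simp only [nsmul_eq_mul]
  push_cast
  field_simp

theorem tendsto_integral_radG2_reg {κ : ℂ} (hκ : 0 < κ.re) (x : E3) (h : 𝓢(E3, Spinor)) :
    Tendsto (fun δ : ℝ => ∫ y, ((δ : ℂ) ^ 2 * radG2 κ (reg δ (x - y))) • h y) (𝓝[>] 0)
      (𝓝 (h x)) := by
  obtain ⟨M, hM0, hM⟩ := exists_norm_le_schwartz h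
  have hlim : h x = ∫ w : E3, radG2 0 (reg 1 w) • h x := by
    rw [integral_smul_const, integral_reg_inv_pow_five, one_smul]
  rw [hlim]
  -- After the substitution `y = x - δw`, the kernel tends to `radG2 0 (reg 1 w)` and `h (x - δw)`
  -- to `h x`, under the uniform majorant.
  have key : Tendsto (fun δ : ℝ => ∫ w, radG2 (κ * δ) (reg 1 w) • h (x - δ • w)) (𝓝[>] 0)
      (𝓝 (∫ w : E3, radG2 0 (reg 1 w) • h x)) := by
    refine tendsto_integral_filter_of_dominated_convergence
      (fun w => (3 + 3 * ‖κ‖ + ‖κ‖ ^ 2 / κ.re) * (reg 1 w)⁻¹ ^ 4 * M) ?_ ?_ ?_ ?_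
    · refine Eventually.of_forall fun δ => Continuous.aestronglyMeasurable ?_
      exact (continuous_radG2_reg _ one_pos).smul
        (h.continuous.comp (continuous_const.sub (continuous_const_smul δ)))
    · filter_upwards [self_mem_nhdsWithin,
        mem_nhdsWithin_of_mem_nhds (Iic_mem_nhds (zero_lt_one' ℝ))] with δ hδ hδ1
      refine ae_of_all _ fun w => ?_
      rw [norm_smul]
      exact mul_le_mul (norm_radG2_scaled_le hκ hδ hδ1 (le_reg 1 w)) (hM _) (norm_nonneg _)
        (by have := reg_pos one_pos w; positivity)
    · exact (integrable_inv_reg_pow_four.const_mul _).mul_const M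
    · refine ae_of_all _ fun w => ?_
      have hc1 : Continuous fun δ : ℝ => radG2 (κ * δ) (reg 1 w) := by unfold radG2; fun_prop
      have hc2 : Continuous fun δ : ℝ => h (x - δ • w) := by
        have := h.continuous
        fun_prop
      have hc : Continuous fun δ : ℝ => radG2 (κ * δ) (reg 1 w) • h (x - δ • w) := hc1.smul hc2
      simpa using (hc.tendsto 0).mono_left (nhdsWithin_le_nhds (s := Ioi 0))
  refine key.congr' ?_
  filter_upwards [self_mem_nhdsWithin] with δ hδ
  exact (integral_radG2_reg_eq κ hδ x h).symm

/-- The Yukawa potential is the fundamental solution of `κ² - Δ`. -/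
theorem integral_radG_helmholtz {κ : ℂ} (hκ : 0 < κ.re) (x : E3) (h : 𝓢(E3, Spinor)) :
    ∫ y, radG κ ‖x - y‖ • (κ ^ 2 • h - ∑ j, ∂_{(basisE j)} (∂_{(basisE j)} h)) y = h x := by
  have h1 := tendsto_integral_reg (p := fun _ s => radG κ s) (C := 1) hκ
    (fun δ hδ => continuous_radG_reg κ hδ) (fun z s hs => (hasDerivAt_radG κ hs).continuousAt)
    (fun z s hs _ => by simpa using norm_radG_le hs) zero_le_one x
    (κ ^ 2 • h - ∑ j, ∂_{(basisE j)} (∂_{(basisE j)} h))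
  refine tendsto_nhds_unique (h1.congr' ?_) (tendsto_integral_radG2_reg hκ x h)
  filter_upwards [self_mem_nhdsWithin] with δ hδ
  exact integral_radG_reg_helmholtz hκ hδ x h

end DiracShell

end

noncomputable section

namespace DiracShell

/-! ### Bounded operators on `L²` from almost everywhere defined maps -/

theorem eLpNorm_two_sq {X : Type*} [MeasurableSpace X] (μ : Measure X) (f : X → Spinor) :
    eLpNorm f 2 μ ^ 2 = ∫⁻ x, ‖f x‖ₑ ^ 2 ∂μ := by
  have h := eLpNorm_nnreal_pow_eq_lintegral (f := f) (μ := μ) (p := 2) two_ne_zero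
  simpa using h

/-- All concrete operators below are pointwise formulas that respect sums and multiples only almost
everywhere; a bound on squared integrals suffices to make them operators on `L²`. -/
theorem exists_clm_of_ae {X Y : Type*} [MeasurableSpace X] [MeasurableSpace Y] {μ : Measure X}
    {ν : Measure Y} (T : Lp Spinor 2 μ → Y → Spinor) (C : ℝ)
    (hT : ∀ f, AEStronglyMeasurable (T f) ν)
    (hadd : ∀ f g, ∀ᵐ y ∂ν, T (f + g) y = T f y + T g y)
    (hsmul : ∀ (c : ℂ) f, ∀ᵐ y ∂ν, T (c • f) y = c • T f y)
    (hb : ∀ f, ∫⁻ y, ‖T f y‖ₑ ^ 2 ∂ν ≤ ENNReal.ofReal C * ∫⁻ x, ‖f x‖ₑ ^ 2 ∂μ) :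
    ∃ L : Lp Spinor 2 μ →L[ℂ] Lp Spinor 2 ν, ∀ f, ∀ᵐ y ∂ν, L f y = T f y := by
  have hle : ∀ f : Lp Spinor 2 μ, eLpNorm (T f) 2 ν ≤ ENNReal.ofReal (Real.sqrt C) * eLpNorm f 2 μ := by
    intro f
    have h := hb f
    rw [← eLpNorm_two_sq, ← eLpNorm_two_sq] at h
    refine (ENNReal.pow_le_pow_left_iff two_ne_zero).mp (h.trans (le_of_eq ?_))
    rw [mul_pow, ← ENNReal.ofReal_pow (Real.sqrt_nonneg _)]
    rcases le_total 0 C with hC | hC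
    · rw [Real.sq_sqrt hC]
    · rw [Real.sqrt_eq_zero_of_nonpos hC, ENNReal.ofReal_eq_zero.mpr hC]; simp
  have hmem : ∀ f : Lp Spinor 2 μ, MemLp (T f) 2 ν := fun f =>
    ⟨hT f, (hle f).trans_lt (ENNReal.mul_lt_top ENNReal.ofReal_lt_top (Lp.eLpNorm_lt_top f))⟩
  let L : Lp Spinor 2 μ →ₗ[ℂ] Lp Spinor 2 ν :=
    { toFun := fun f => (hmem f).toLp (T f)
      map_add' := fun f g => by
        rw [← MemLp.toLp_add (hmem f) (hmem g)]
        exact MemLp.toLp_congr _ _ (hadd f g)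
      map_smul' := fun c f => by
        rw [RingHom.id_apply, ← MemLp.toLp_const_smul c (hmem f)]
        exact MemLp.toLp_congr _ _ (hsmul c f) }
  refine ⟨L.mkContinuous (Real.sqrt C) fun f => ?_, fun f => (hmem f).coeFn_toLp⟩
  change ‖(hmem f).toLp (T f)‖ ≤ _
  rw [Lp.norm_toLp, Lp.norm_def, ← ENNReal.toReal_ofReal (Real.sqrt_nonneg C),
    ← ENNReal.toReal_mul]
  exact ENNReal.toReal_mono (ENNReal.mul_ne_top ENNReal.ofReal_ne_top (Lp.eLpNorm_ne_top f)) (hle f)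

/-- Multiplication by a bounded function, followed by extension by zero. -/
theorem exists_mulExt {X : Type*} [MeasurableSpace X] {μ : Measure X} {s : Set X}
    (hs : MeasurableSet s) (w : X → ℝ) (hw : AEStronglyMeasurable w (μ.restrict s)) (M : ℝ)
    (hM : ∀ᵐ x ∂μ.restrict s, ‖w x‖ ≤ M) :
    ∃ L : Lp Spinor 2 (μ.restrict s) →L[ℂ] Lp Spinor 2 μ,
      ∀ f, ∀ᵐ x ∂μ, L f x = s.indicator (fun x => (w x : ℂ) • f x) x := by
  refine exists_clm_of_ae (fun f => s.indicator (fun x => (w x : ℂ) • f x)) (M ^ 2)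
    (fun f => ?_) (fun f g => ?_) (fun c f => ?_) (fun f => ?_)
  · rw [aestronglyMeasurable_indicator_iff hs]
    exact (Complex.continuous_ofReal.comp_aestronglyMeasurable hw).smul
      (Lp.stronglyMeasurable f).aestronglyMeasurable
  · filter_upwards [(ae_restrict_iff' hs).mp (Lp.coeFn_add f g)] with x hx
    by_cases h : x ∈ s
    · simp only [indicator_of_mem h, hx h, Pi.add_apply, smul_add]
    · simp only [indicator_of_notMem h, add_zero]
  · filter_upwards [(ae_restrict_iff' hs).mp (Lp.coeFn_smul c f)] with x hx
    by_cases h : x ∈ s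
    · simp only [indicator_of_mem h, hx h, Pi.smul_apply]
      rw [smul_comm]
    · simp only [indicator_of_notMem h, smul_zero]
  · have e : ∀ x, ‖s.indicator (fun x => (w x : ℂ) • f x) x‖ₑ ^ 2 =
        s.indicator (fun x => ‖(w x : ℂ) • f x‖ₑ ^ 2) x := by
      intro x
      by_cases h : x ∈ s
      · simp only [indicator_of_mem h]
      · simp [indicator_of_notMem h]
    simp_rw [e]
    rw [lintegral_indicator hs, ← lintegral_const_mul' _ _ ENNReal.ofReal_ne_top]
    refine lintegral_mono_ae ?_
    filter_upwards [hM] with x hx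
    have hM0 : 0 ≤ M := (norm_nonneg _).trans hx
    rw [enorm_smul, mul_pow, ENNReal.ofReal_pow hM0]
    gcongr
    rw [← ofReal_norm, Complex.norm_real]
    exact ENNReal.ofReal_le_ofReal hx

/-- Composition with a map which does not charge null sets too much. -/
theorem exists_compLp {X Y : Type*} [MeasurableSpace X] [MeasurableSpace Y] {μ : Measure X}
    {ν : Measure Y} (T : Y → X) (hT : AEMeasurable T ν) (k : ℂ) (C : ℝ)
    (hC : ν.map T ≤ ENNReal.ofReal C • μ) :
    ∃ L : Lp Spinor 2 μ →L[ℂ] Lp Spinor 2 ν, ∀ f, ∀ᵐ y ∂ν, L f y = k • f (T y) := by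
  have hac : ν.map T ≪ μ := Measure.absolutelyContinuous_of_le_smul hC
  refine exists_clm_of_ae (fun f y => k • f (T y)) (‖k‖ ^ 2 * C)
    (fun f => ?_) (fun f g => ?_) (fun c f => ?_) (fun f => ?_)
  · exact ((Lp.stronglyMeasurable f).aestronglyMeasurable.comp_aemeasurable hT).const_smul k
  · filter_upwards [ae_of_ae_map hT (hac.ae_le (Lp.coeFn_add f g))] with y hy
    rw [hy, Pi.add_apply, smul_add]
  · filter_upwards [ae_of_ae_map hT (hac.ae_le (Lp.coeFn_smul c f))] with y hy
    rw [hy, Pi.smul_apply, smul_comm]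
  · have hm : Measurable fun x => ‖f x‖ₑ ^ 2 := (Lp.stronglyMeasurable f).measurable.enorm.pow_const 2
    calc ∫⁻ y, ‖k • f (T y)‖ₑ ^ 2 ∂ν = ‖k‖ₑ ^ 2 * ∫⁻ y, ‖f (T y)‖ₑ ^ 2 ∂ν := by
          rw [← lintegral_const_mul' _ _ (by finiteness)]
          simp_rw [enorm_smul, mul_pow]
      _ = ‖k‖ₑ ^ 2 * ∫⁻ x, ‖f x‖ₑ ^ 2 ∂(ν.map T) := by rw [lintegral_map' hm.aemeasurable hT]
      _ ≤ ‖k‖ₑ ^ 2 * (ENNReal.ofReal C * ∫⁻ x, ‖f x‖ₑ ^ 2 ∂μ) := by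
          gcongr
          refine (lintegral_mono' hC le_rfl).trans ?_
          rw [lintegral_smul_measure, smul_eq_mul]
      _ = _ := by
          rw [← mul_assoc, ENNReal.ofReal_mul (by positivity), ENNReal.ofReal_pow (norm_nonneg _),
            ofReal_norm]

/-! ### Young's inequality -/

/-- Split `k = k^{1/2} · k^{1/2}`, apply Cauchy–Schwarz to the inner integral, then Tonelli and
translation invariance. -/
theorem lintegral_conv_sq_le {k g : E3 → ℝ≥0∞} (hk : Measurable k) (hg : Measurable g) :
    ∫⁻ x, (∫⁻ y, k (x - y) * g y) ^ 2 ≤ (∫⁻ z, k z) ^ 2 * ∫⁻ y, g y ^ 2 := by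
  have hk1 : ∀ x : E3, ∫⁻ y, k (x - y) = ∫⁻ z, k z := fun x => lintegral_sub_left_eq_self k x
  have hk2 : ∀ y : E3, ∫⁻ x, k (x - y) = ∫⁻ z, k z := fun y => lintegral_sub_right_eq_self k y
  have hcs : ∀ x, (∫⁻ y, k (x - y) * g y) ^ 2 ≤ (∫⁻ z, k z) * ∫⁻ y, k (x - y) * g y ^ 2 := by
    intro x
    have hkx : Measurable fun y => k (x - y) := hk.comp (measurable_const.sub measurable_id)
    have h := ENNReal.lintegral_mul_le_Lp_mul_Lq (volume : Measure E3) Real.HolderConjugate.two_two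
      (f := fun y => k (x - y) ^ (1 / 2 : ℝ)) (g := fun y => k (x - y) ^ (1 / 2 : ℝ) * g y)
      (hkx.pow_const _).aemeasurable ((hkx.pow_const _).mul hg).aemeasurable
    have e1 : ∀ y, (k (x - y) ^ (1 / 2 : ℝ)) ^ (2 : ℝ) = k (x - y) := fun y => by
      rw [← ENNReal.rpow_mul]; norm_num
    have e2 : ∀ y, ((fun y => k (x - y) ^ (1 / 2 : ℝ)) * fun y => k (x - y) ^ (1 / 2 : ℝ) * g y) y =
        k (x - y) * g y := fun y => by
      rw [Pi.mul_apply, ← mul_assoc, ← sq, ← ENNReal.rpow_natCast, ← ENNReal.rpow_mul]; norm_num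
    have e3 : ∀ y, (k (x - y) ^ (1 / 2 : ℝ) * g y) ^ (2 : ℝ) = k (x - y) * g y ^ 2 := fun y => by
      rw [ENNReal.mul_rpow_of_nonneg _ _ (by norm_num), e1]; norm_num
    simp_rw [e1, e2, e3, hk1] at h
    refine (pow_le_pow_left' h 2).trans (le_of_eq ?_)
    rw [mul_pow, ← ENNReal.rpow_natCast, ← ENNReal.rpow_natCast, ← ENNReal.rpow_mul,
      ← ENNReal.rpow_mul]
    norm_num
  have hm : Measurable (Function.uncurry fun x y : E3 => k (x - y) * g y ^ 2) :=
    (hk.comp (measurable_fst.sub measurable_snd)).mul ((hg.comp measurable_snd).pow_const 2)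
  calc ∫⁻ x, (∫⁻ y, k (x - y) * g y) ^ 2
      ≤ ∫⁻ x, (∫⁻ z, k z) * ∫⁻ y, k (x - y) * g y ^ 2 := lintegral_mono hcs
    _ = (∫⁻ z, k z) * ∫⁻ x, ∫⁻ y, k (x - y) * g y ^ 2 :=
        lintegral_const_mul _ hm.lintegral_prod_right'
    _ = (∫⁻ z, k z) * ∫⁻ y, ∫⁻ x, k (x - y) * g y ^ 2 := by
        rw [lintegral_lintegral_swap hm.aemeasurable]
    _ = (∫⁻ z, k z) * ∫⁻ y, (∫⁻ z, k z) * g y ^ 2 := by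
        congr 1
        refine lintegral_congr fun y => ?_
        have hky : Measurable fun x : E3 => k (x - y) := hk.comp (measurable_id.sub_const y)
        rw [lintegral_mul_const _ hky, hk2]
    _ = _ := by rw [lintegral_const_mul _ (hg.pow_const 2)]; ring

theorem exists_convolution_op {φ : E3 → Matrix (Fin 4) (Fin 4) ℂ}
    (hφ : StronglyMeasurable fun z => act (φ z)) {k : E3 → ℝ} (hk : Measurable k)
    (hki : Integrable k) (hle : ∀ z, ‖act (φ z)‖ ≤ k z) :
    ∃ Φ : L2R3 →L[ℂ] L2R3, IsKernelOp (fun x y => φ (x - y)) Φ := by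
  set k' : E3 → ℝ≥0∞ := fun z => ENNReal.ofReal (k z) with hk'
  have hk'm : Measurable k' := hk.ennreal_ofReal
  have hk'i : ∫⁻ z, k' z ≠ ∞ := by
    have h := hki.lintegral_lt_top
    exact h.ne
  have hb : ∀ f : L2R3, ∫⁻ x, (∫⁻ y, k' (x - y) * ‖f y‖ₑ) ^ 2 ≤
      (∫⁻ z, k' z) ^ 2 * ∫⁻ y, ‖f y‖ₑ ^ 2 := fun f =>
    lintegral_conv_sq_le hk'm (Lp.stronglyMeasurable f).measurable.enorm
  have hpt : ∀ (f : L2R3) (x y : E3), ‖act (φ (x - y)) (f y)‖ₑ ≤ k' (x - y) * ‖f y‖ₑ := by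
    intro f x y
    rw [← ofReal_norm, ← ofReal_norm,
      ← ENNReal.ofReal_mul ((norm_nonneg _).trans (hle _))]
    exact ENNReal.ofReal_le_ofReal (((act (φ (x - y))).le_opNorm _).trans
      (mul_le_mul_of_nonneg_right (hle _) (norm_nonneg _)))
  have hsm : ∀ f : L2R3, StronglyMeasurable (Function.uncurry fun x y : E3 => act (φ (x - y)) (f y)) := by
    intro f
    have h1 : StronglyMeasurable fun p : E3 × E3 => act (φ (p.1 - p.2)) :=
      hφ.comp_measurable (measurable_fst.sub measurable_snd)
    have h2 : StronglyMeasurable fun p : E3 × E3 => f p.2 :=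
      (Lp.stronglyMeasurable f).comp_measurable measurable_snd
    exact (isBoundedBilinearMap_apply (𝕜 := ℂ) (E := Spinor) (F := Spinor)).continuous.comp_stronglyMeasurable
      (h1.prodMk h2)
  -- Young's inequality for the absolute values makes the inner integral finite for almost every
  -- `x`, so absolute convergence comes out of the same estimate as boundedness.
  have hint : ∀ f : L2R3, ∀ᵐ x : E3, Integrable fun y => act (φ (x - y)) (f y) := by
    intro f
    have hmL : Measurable fun x : E3 => (∫⁻ y, k' (x - y) * ‖f y‖ₑ) ^ 2 := by
      refine Measurable.pow_const (Measurable.lintegral_prod_right' (f := fun p : E3 × E3 =>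
        k' (p.1 - p.2) * ‖f p.2‖ₑ) ?_) 2
      exact (hk'm.comp (measurable_fst.sub measurable_snd)).mul
        ((Lp.stronglyMeasurable f).measurable.enorm.comp measurable_snd)
    have hfin : ∫⁻ x, (∫⁻ y, k' (x - y) * ‖f y‖ₑ) ^ 2 ≠ ∞ := by
      refine ((hb f).trans_lt (ENNReal.mul_lt_top (by finiteness) ?_)).ne
      rw [← eLpNorm_two_sq]
      have := Lp.eLpNorm_ne_top f
      finiteness
    filter_upwards [ae_lt_top hmL hfin] with x hx
    have hx' : ∫⁻ y, k' (x - y) * ‖f y‖ₑ < ∞ := by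
      by_contra hcon
      rw [not_lt, top_le_iff] at hcon
      rw [hcon] at hx
      simp at hx
    exact ⟨((hsm f).comp_measurable measurable_prodMk_left).aestronglyMeasurable,
      (lintegral_mono (hpt f x)).trans_lt hx'⟩
  suffices h : ∃ Φ : L2R3 →L[ℂ] L2R3, ∀ f : L2R3, ∀ᵐ x : E3, Φ f x = ∫ y, act (φ (x - y)) (f y) by
    obtain ⟨Φ, hΦ⟩ := h
    exact ⟨Φ, fun f => by filter_upwards [hΦ f, hint f] with x h1 h2 using ⟨h2, h1⟩⟩
  refine exists_clm_of_ae (fun f x => ∫ y, act (φ (x - y)) (f y)) ((∫⁻ z, k' z).toReal ^ 2)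
    (fun f => ?_) (fun f g => ?_) (fun c f => ?_) (fun f => ?_)
  · exact (hsm f).integral_prod_right'.aestronglyMeasurable
  · filter_upwards [hint f, hint g] with x h1 h2
    rw [← integral_add h1 h2]
    refine integral_congr_ae ?_
    filter_upwards [Lp.coeFn_add f g] with y hy
    rw [hy, Pi.add_apply, map_add]
  · refine ae_of_all _ fun x => ?_
    rw [← integral_smul]
    refine integral_congr_ae ?_
    filter_upwards [Lp.coeFn_smul c f] with y hy
    rw [hy, Pi.smul_apply, map_smul]
  · rw [ENNReal.ofReal_pow ENNReal.toReal_nonneg, ENNReal.ofReal_toReal hk'i]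
    refine le_trans (lintegral_mono fun x => ?_) (hb f)
    gcongr
    exact (enorm_integral_le_lintegral_enorm _).trans (lintegral_mono (hpt f x))

end DiracShell

end

noncomputable section

namespace DiracShell

/-! ### The resolvent kernel -/

/-- The decay exponent `√(m² - a²)`. -/
def decayExp (m : ℝ) (a : ℂ) : ℂ := Complex.sqrt ((m : ℂ) ^ 2 - a ^ 2)

theorem decayExp_sq (m : ℝ) (a : ℂ) : decayExp m a ^ 2 = (m : ℂ) ^ 2 - a ^ 2 := by
  rw [decayExp, Complex.sqrt]
  exact Complex.cpow_ofNat_inv_pow _ 2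

/-- Since `Re √z = √((|z| + Re z)/2)`, only `z ∈ (-∞, 0]` must be excluded. For `z = m² - a²`,
either `Re a = 0` and `Re z = m² + (Im a)² > 0`, or `Im z = -2 Re a Im a ≠ 0`. -/
theorem decayExp_re_pos (m : ℝ) {a : ℂ} (ha : a.im ≠ 0) : 0 < (decayExp m a).re := by
  rw [decayExp, Complex.sqrt, Complex.cpow_inv_two_re, Real.sqrt_pos]
  refine div_pos ?_ two_pos
  set z := (m : ℂ) ^ 2 - a ^ 2 with hz
  have hre : z.re = m ^ 2 - (a.re ^ 2 - a.im ^ 2) := by simp [hz, sq]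
  have him : z.im = -(2 * a.re * a.im) := by simp [hz, sq]; ring
  by_cases h : a.re = 0
  · have h1 : 0 < z.re := by 
      have : 0 < a.im ^ 2 := by positivity
      rw [hre, h]
      nlinarith [sq_nonneg m]
    have := norm_nonneg z
    linarith
  · have h2 : z.im ≠ 0 := by rw [him]; simp [h, ha]
    have h3 := Complex.abs_re_lt_norm.mpr h2
    have := neg_abs_le z.re
    linarith

theorem act_smul (c : ℂ) (M : Matrix (Fin 4) (Fin 4) ℂ) : act (c • M) = c • act M := by simp [act]

/-- This exhibits `φᵃ` as `(a + mβ - iα·∇) G`, with `∂_j G = z_j radG1`. At `z = 0` the formula also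
holds, by the convention that division by zero gives zero. -/
theorem act_fundSol (m : ℝ) (a : ℂ) (z : E3) :
    act (fundSol m a z) = radG (decayExp m a) ‖z‖ • (a • (1 : Spinor →L[ℂ] Spinor) +
      (m : ℂ) • act betaMat) +
      ∑ j, ((z j : ℂ) * radG1 (decayExp m a) ‖z‖) • ((-Complex.I) • act (alphaMat j)) := by
  have e1 : Complex.exp (-decayExp m a * ‖z‖) / (4 * Real.pi * ‖z‖) = radG (decayExp m a) ‖z‖ := by
    rw [radG]; push_cast
    rcases eq_or_ne z 0 with rfl | hz
    · simp
    have : ((‖z‖ : ℝ) : ℂ) ≠ 0 := by exact_mod_cast norm_ne_zero_iff.mpr hz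
    field_simp
  have e2 : ∀ j, radG (decayExp m a) ‖z‖ * ((1 + decayExp m a * ‖z‖) * Complex.I / (‖z‖ : ℂ) ^ 2 *
      (z j : ℂ)) = (z j : ℂ) * radG1 (decayExp m a) ‖z‖ * (-Complex.I) := by
    intro j
    rw [radG, radG1]; push_cast
    rcases eq_or_ne z 0 with rfl | hz
    · simp
    have : ((‖z‖ : ℝ) : ℂ) ≠ 0 := by exact_mod_cast norm_ne_zero_iff.mpr hz
    have hpi : (Real.pi : ℂ) ≠ 0 := by exact_mod_cast Real.pi_ne_zero
    field_simp
  have e3 : fundSol m a z = radG (decayExp m a) ‖z‖ • (a • (1 : Matrix (Fin 4) (Fin 4) ℂ) +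
      (m : ℂ) • betaMat) +
      ∑ j, ((z j : ℂ) * radG1 (decayExp m a) ‖z‖) • ((-Complex.I) • alphaMat j) := by
    change (Complex.exp (-decayExp m a * ‖z‖) / (4 * Real.pi * ‖z‖)) •
      (a • (1 : Matrix (Fin 4) (Fin 4) ℂ) + (m : ℂ) • betaMat +
        ((1 + decayExp m a * ‖z‖) * Complex.I / (‖z‖ : ℂ) ^ 2) •
          ∑ j, ((z j : ℝ) : ℂ) • alphaMat j) = _
    rw [e1, smul_add, smul_smul, Finset.smul_sum]
    simp only [smul_smul]
    congr 1
    refine Finset.sum_congr rfl fun j _ => ?_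
    rw [← e2, mul_assoc]
  rw [e3]
  simp only [act, map_add, map_smul, map_sum, map_one]

theorem measurable_radG (κ : ℂ) : Measurable (radG κ) := by
  have h : Measurable fun s : ℝ => Complex.exp (-κ * s) :=
    (by fun_prop : Continuous fun s : ℝ => Complex.exp (-κ * s)).measurable
  unfold radG
  fun_prop

theorem measurable_radG1 (κ : ℂ) : Measurable (radG1 κ) := by
  have h : Measurable fun s : ℝ => Complex.exp (-κ * s) :=
    (by fun_prop : Continuous fun s : ℝ => Complex.exp (-κ * s)).measurable
  unfold radG1
  fun_prop

theorem stronglyMeasurable_act_fundSol (m : ℝ) (a : ℂ) :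
    StronglyMeasurable fun z => act (fundSol m a z) := by
  simp_rw [act_fundSol]
  have h0 : Measurable fun z : E3 => radG (decayExp m a) ‖z‖ := (measurable_radG _).comp measurable_norm
  have h1 : Measurable fun z : E3 => radG1 (decayExp m a) ‖z‖ :=
    (measurable_radG1 _).comp measurable_norm
  refine (h0.stronglyMeasurable.smul_const _).add ?_
  refine Finset.stronglyMeasurable_fun_sum _ fun j _ => StronglyMeasurable.smul_const ?_ _
  have hj : Measurable fun z : E3 => (z j : ℂ) :=
    (by fun_prop : Continuous fun z : E3 => (z j : ℂ)).measurable
  exact (hj.mul h1).stronglyMeasurable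

theorem measurable_yukMaj (c : ℝ) : Measurable fun z : E3 => yukMaj c ‖z‖ := by
  unfold yukMaj
  fun_prop

theorem exists_norm_act_fundSol_le (m : ℝ) (a : ℂ) :
    ∃ C : ℝ, ∀ z, ‖act (fundSol m a z)‖ ≤ C * yukMaj (decayExp m a).re ‖z‖ := by
  refine ⟨‖a • (1 : Spinor →L[ℂ] Spinor) + (m : ℂ) • act betaMat‖ +
    ∑ j, (1 + ‖decayExp m a‖) * ‖(-Complex.I) • act (alphaMat j)‖, fun z => ?_⟩
  have h0 : ‖radG (decayExp m a) ‖z‖‖ ≤ yukMaj (decayExp m a).re ‖z‖ := by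
    rcases eq_or_ne z 0 with rfl | hz
    · simp [radG, yukMaj]
    · exact norm_radG_le (norm_pos_iff.mpr hz)
  have h1 : ∀ j, ‖(z j : ℂ) * radG1 (decayExp m a) ‖z‖‖ ≤
      (1 + ‖decayExp m a‖) * yukMaj (decayExp m a).re ‖z‖ := by
    intro j
    rcases eq_or_ne z 0 with rfl | hz
    · simp [yukMaj]
    · exact norm_mul_radG1_le (norm_pos_iff.mpr hz) (abs_apply_le_norm z j)
  rw [act_fundSol, add_mul, Finset.sum_mul]
  refine (norm_add_le _ _).trans (add_le_add ?_ ((norm_sum_le _ _).trans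
    (Finset.sum_le_sum fun j _ => ?_)))
  · rw [norm_smul, mul_comm]
    gcongr
  · rw [norm_smul, mul_right_comm]
    exact mul_le_mul_of_nonneg_right (h1 j) (norm_nonneg _)

theorem exists_isKernelOp_kerPhi (m : ℝ) {a : ℂ} (ha : a.im ≠ 0) :
    ∃ Φ : L2R3 →L[ℂ] L2R3, IsKernelOp (kerPhi m a) Φ := by
  obtain ⟨C, hC⟩ := exists_norm_act_fundSol_le m a
  exact exists_convolution_op (stronglyMeasurable_act_fundSol m a)
    ((measurable_yukMaj _).const_mul C) ((integrable_yukMaj (decayExp_re_pos m ha)).const_mul C) hC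

/-- The kernel inverts `𝐇 - a` on Schwartz functions. -/
theorem integral_fundSol_schwartzDirac (m : ℝ) {a : ℂ} (ha : a.im ≠ 0) (x : E3)
    (s : 𝓢(E3, Spinor)) :
    ∫ y, act (fundSol m a (x - y)) ((schwartzDirac m s - a • s) y) = s x := by
  set κ := decayExp m a with hκ
  have hκ0 : 0 < κ.re := decayExp_re_pos m ha
  set G : 𝓢(E3, Spinor) := schwartzDirac m s - a • s with hG
  have hm0 : AEStronglyMeasurable (fun y : E3 => radG κ ‖x - y‖) :=
    ((measurable_radG κ).comp (by fun_prop : Measurable fun y : E3 => ‖x - y‖)).aestronglyMeasurable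
  have hm1 : ∀ j, AEStronglyMeasurable (fun y : E3 => ((x - y) j : ℂ) * radG1 κ ‖x - y‖) := by
    intro j
    refine ((by fun_prop : Continuous fun y : E3 => ((x - y) j : ℂ)).measurable.mul
      ((measurable_radG1 κ).comp
        (by fun_prop : Measurable fun y : E3 => ‖x - y‖))).aestronglyMeasurable
  have hne : ∀ᵐ y : E3, y ≠ x := by
    rw [ae_iff]; simp
  have hi0 : ∀ h : 𝓢(E3, Spinor), Integrable fun y => radG κ ‖x - y‖ • h y := by
    intro h
    obtain ⟨M, hM0, hM⟩ := exists_norm_le_schwartz h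
    refine Integrable.mono' ((integrable_yukMaj_sub hκ0 x).mul_const M)
      (hm0.smul h.continuous.aestronglyMeasurable) ?_
    filter_upwards [hne] with y hy
    have hpos : 0 < ‖x - y‖ := norm_pos_iff.mpr (sub_ne_zero.mpr hy.symm)
    rw [norm_smul]
    exact mul_le_mul (norm_radG_le hpos) (hM y) (norm_nonneg _) (yukMaj_nonneg hpos.le)
  have hi1 : ∀ (j : Fin 3) (h : 𝓢(E3, Spinor)),
      Integrable fun y => (((x - y) j : ℂ) * radG1 κ ‖x - y‖) • h y := by
    intro j h
    obtain ⟨M, hM0, hM⟩ := exists_norm_le_schwartz h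
    refine Integrable.mono' (((integrable_yukMaj_sub hκ0 x).const_mul (1 + ‖κ‖)).mul_const M)
      ((hm1 j).smul h.continuous.aestronglyMeasurable) ?_
    filter_upwards [hne] with y hy
    have hpos : 0 < ‖x - y‖ := norm_pos_iff.mpr (sub_ne_zero.mpr hy.symm)
    rw [norm_smul]
    refine mul_le_mul (norm_mul_radG1_le hpos (abs_apply_le_norm _ j)) (hM y) (norm_nonneg _) ?_
    have := yukMaj_nonneg (c := κ.re) hpos.le
    positivity
  set G0 : 𝓢(E3, Spinor) := a • G + (m : ℂ) • schwartzAct betaMat G with hG0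
  have hpt : ∀ y, act (fundSol m a (x - y)) (G y) = radG κ ‖x - y‖ • G0 y +
      ∑ j, (((x - y) j : ℂ) * radG1 κ ‖x - y‖) •
        ((-Complex.I) • schwartzAct (alphaMat j) G) y := by
    intro y
    rw [act_fundSol]
    simp only [_root_.add_apply, _root_.smul_apply, _root_.sum_apply, ← hκ, hG0,
      one_apply_eq_self, schwartzAct_apply]
  simp_rw [hpt]
  rw [integral_add (hi0 _) (integrable_finsetSum _ fun j _ => hi1 j _),
    integral_finsetSum _ fun j _ => hi1 j _]
  simp_rw [← integral_radG_smul_lineDeriv hκ0]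
  rw [← integral_finsetSum _ fun j _ => hi0 _,
    ← integral_add (hi0 _) (integrable_finsetSum _ fun j _ => hi0 _)]
  -- `(H + a)(H - a)s = (-Δ + m² - a²)s`, and `m² - a² = κ²`. Here `G0` plus the derivative terms is
  -- `(H + a)` applied to `(H - a)s`.
  have hsq : G0 + ∑ j, ∂_{(basisE j)} ((-Complex.I) • schwartzAct (alphaMat j) G) =
      κ ^ 2 • s - ∑ j, ∂_{(basisE j)} (∂_{(basisE j)} s) := by
    have h1 : G0 + ∑ j, ∂_{(basisE j)} ((-Complex.I) • schwartzAct (alphaMat j) G) =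
        schwartzDirac m G + a • G := by
      rw [schwartzDirac_apply, hG0, Finset.smul_sum]
      simp only [schwartzAct_lineDerivOp, LineDeriv.lineDerivOp_smul]
      abel
    rw [h1, hG, map_sub, map_smul, schwartzDirac_sq, hκ, decayExp_sq]
    module
  rw [← integral_radG_helmholtz hκ0 x s, ← hsq]
  refine integral_congr_ae (ae_of_all _ fun y => ?_)
  simp only [_root_.add_apply, _root_.sum_apply, smul_add, Finset.smul_sum]

/-- The convolution is a left inverse of `H - a` on Schwartz functions, hence on the whole domain
because they form a core. As `H - a` is already known to be onto, a left inverse must be the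
resolvent. -/
theorem isResolvent_of_isKernelOp {m : ℝ} {a : ℂ} (ha : a.im ≠ 0) {Φ : L2R3 →L[ℂ] L2R3}
    (hΦ : IsKernelOp (kerPhi m a) Φ) : IsResolvent (diracOp m) a Φ := by
  obtain ⟨R, hR⟩ := exists_isResolvent_diracOp m ha
  have hS : ∀ s : 𝓢(E3, Spinor), Φ ((schwartzDirac m s).toLp 2 volume - a • s.toLp 2 volume) =
      s.toLp 2 volume := by
    intro s
    have e : (schwartzDirac m s).toLp 2 (volume : Measure E3) - a • s.toLp 2 volume =
        (schwartzDirac m s - a • s).toLp 2 volume := by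
      change SchwartzMap.toLpCLM ℂ Spinor 2 volume _ - a • SchwartzMap.toLpCLM ℂ Spinor 2 volume _ =
        SchwartzMap.toLpCLM ℂ Spinor 2 volume _
      rw [map_sub, map_smul]
    rw [e]
    refine Lp.ext ?_
    filter_upwards [hΦ ((schwartzDirac m s - a • s).toLp 2 volume), s.coeFn_toLp 2 volume]
      with x h1 h2
    rw [h1.2, h2, ← integral_fundSol_schwartzDirac m ha x s]
    refine integral_congr_ae ?_
    filter_upwards [(schwartzDirac m s - a • s).coeFn_toLp 2 volume] with y hy
    rw [hy]; rfl
  have hinv : ∀ g : (diracOp m).domain, Φ (diracOp m g - a • (g : L2R3)) = g := by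
    intro g
    obtain ⟨s, h1, h2⟩ := exists_schwartz_seq m g
    have h3 := (Φ.continuous.tendsto _).comp (h2.sub (h1.const_smul a))
    refine tendsto_nhds_unique h3 (h1.congr fun n => ?_)
    exact (hS (s n)).symm
  have hΦR : Φ = R := by
    refine ContinuousLinearMap.ext fun f => ?_
    obtain ⟨g, hg1, hg2⟩ := hR.1 f
    rw [hg1, ← hinv g, hg2]
  rw [hΦR]
  exact hR

end DiracShell

end

noncomputable section

namespace DiracShell

/-! ### Local charts of the boundary -/

/-- The parameter plane. -/
abbrev E2 : Type := EuclideanSpace ℝ (Fin 2)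

/-- The projection of space to the horizontal plane. -/
def horiz : E3 →L[ℝ] E2 :=
  LinearMap.toContinuousLinearMap
    { toFun := fun y => !₂[y 0, y 1]
      map_add' := fun x y => by ext i; fin_cases i <;> simp
      map_smul' := fun c y => by ext i; fin_cases i <;> simp }

/-- The embedding of the horizontal plane. -/
def horizIncl : E2 →L[ℝ] E3 :=
  LinearMap.toContinuousLinearMap
    { toFun := fun z => !₂[z 0, z 1, 0]
      map_add' := fun x y => by ext i; fin_cases i <;> simp
      map_smul' := fun c y => by ext i; fin_cases i <;> simp }

theorem horiz_apply (y : E3) : horiz y = !₂[y 0, y 1] := rfl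

theorem horizIncl_apply (z : E2) : horizIncl z = !₂[z 0, z 1, 0] := rfl

theorem horiz_horizIncl_add (z : E2) (c : ℝ) : horiz (horizIncl z + c • basisE 2) = z := by
  ext i; fin_cases i <;> simp [horiz_apply, horizIncl_apply]

theorem horizIncl_horiz_add (y : E3) : horizIncl (horiz y) + y 2 • basisE 2 = y := by
  ext i; fin_cases i <;> simp [horiz_apply, horizIncl_apply]

theorem inner_horizIncl (z : E2) (y : E3) : inner ℝ (horizIncl z) y = inner ℝ z (horiz y) := by
  simp [horiz_apply, horizIncl_apply, PiLp.inner_apply, Fin.sum_univ_succ]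

theorem horiz_basisE_two : horiz (basisE 2) = 0 := by
  ext i; fin_cases i <;> simp [horiz_apply]

theorem norm_horiz_le (y : E3) : ‖horiz y‖ ≤ ‖y‖ := by
  rw [EuclideanSpace.norm_eq, EuclideanSpace.norm_eq]
  refine Real.sqrt_le_sqrt ?_
  simp only [horiz_apply, Fin.sum_univ_succ]
  simp
  positivity

/-- A parametrization of `∂Ω` near `Q`. -/
structure LocalChart (Ω : Set E3) (Q : E3) where
  /-- The radius of the chart. -/
  r : ℝ
  r_pos : 0 < r
  /-- The parametrization. -/
  G : E2 → E3
  contDiff_G : ContDiff ℝ 2 G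
  /-- The coordinate map. -/
  π : E3 → E2
  contDiff_π : ContDiff ℝ 1 π
  lip_π : LipschitzWith 1 π
  π_G : ∀ z, π (G z) = z
  /-- The normal field. -/
  n : E2 → E3
  contDiff_n : ContDiff ℝ 1 n
  norm_n : ∀ z, ‖n z‖ = 1
  inner_n : ∀ z h, inner ℝ (n z) (fderiv ℝ G z h) = 0
  mem_iff : ∀ y ∈ Metric.ball Q r, (y ∈ frontier Ω ↔ G (π y) = y)
  isNormal : ∀ z, G z ∈ Metric.ball Q r → IsOutwardUnitNormal Ω (G z) (n z)

theorem nonempty_localChart {Ω : Set E3} (hΩ : IsC2Domain Ω) {Q : E3} (hQ : Q ∈ frontier Ω) :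
    Nonempty (LocalChart Ω Q) := by
  obtain ⟨r, hr, e, ψ, hψ, hch⟩ := hΩ.chart Q hQ
  have hψ1 : Differentiable ℝ ψ := hψ.differentiable (by norm_num)
  set gψ : E2 → E2 := gradient ψ with hgψ
  have hgψ1 : ContDiff ℝ 1 gψ :=
    (InnerProductSpace.toDual ℝ E2).symm.contDiff.comp (hψ.fderiv_right (m := 1) (by norm_num))
  have hgψi : ∀ z h, inner ℝ (gψ z) h = fderiv ℝ ψ z h := fun z h => by
    rw [hgψ, inner_gradient_left]
  -- The normal before normalization, `(∇ψ, -1)` in the graph coordinates. It points downward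
  -- because `Ω` lies above the graph, and it is the gradient of the defining function `ψ(y₀, y₁) -
  -- y₂`, negative inside `Ω`.
  set w : E2 → E3 := fun z => e.symm (horizIncl (gψ z) - basisE 2) with hw
  have hw1 : ContDiff ℝ 1 w :=
    e.symm.contDiff.comp ((horizIncl.contDiff.comp hgψ1).sub contDiff_const)
  have hwi : ∀ z v, inner ℝ (w z) v = fderiv ℝ ψ z (horiz (e v)) - (e v) 2 := by
    intro z v
    have : inner ℝ (w z) v = inner ℝ (horizIncl (gψ z) - basisE 2) (e v) := by
      rw [hw, ← e.inner_map_map, e.apply_symm_apply]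
    rw [this, inner_sub_left, inner_horizIncl, hgψi, real_inner_comm, inner_basisE]
  have hw0 : ∀ z, w z ≠ 0 := by
    intro z h0
    have h1 := hwi z (e.symm (basisE 2))
    rw [h0, e.apply_symm_apply, horiz_basisE_two] at h1
    simp at h1
  set G : E2 → E3 := fun z => Q + e.symm (horizIncl z + ψ z • basisE 2) with hG
  have hG2 : ContDiff ℝ 2 G :=
    contDiff_const.add (e.symm.contDiff.comp
      (horizIncl.contDiff.add (hψ.smul contDiff_const)))
  have heG : ∀ z, e (G z - Q) = horizIncl z + ψ z • basisE 2 := fun z => by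
    simp [hG]
  have hG' : ∀ z h, fderiv ℝ G z h = e.symm (horizIncl h + fderiv ℝ ψ z h • basisE 2) := by
    intro z h
    have h1 : HasFDerivAt (fun z => horizIncl z + ψ z • basisE 2)
        (horizIncl + (fderiv ℝ ψ z).smulRight (basisE 2)) z :=
      horizIncl.hasFDerivAt.add ((hψ1 z).hasFDerivAt.smul_const (basisE 2))
    have h2 : HasFDerivAt G ((e.symm.toContinuousLinearEquiv : E3 →L[ℝ] E3).comp
        (horizIncl + (fderiv ℝ ψ z).smulRight (basisE 2))) z :=
      (((e.symm.toContinuousLinearEquiv : E3 →L[ℝ] E3).hasFDerivAt).comp z h1).const_add Q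
    rw [h2.fderiv]; rfl
  refine ⟨{ r := r
            r_pos := hr
            G := G
            contDiff_G := hG2
            π := fun y => horiz (e (y - Q))
            contDiff_π := horiz.contDiff.comp (e.contDiff.comp (contDiff_id.sub contDiff_const))
            lip_π := ?_
            π_G := fun z => by rw [heG, horiz_horizIncl_add]
            n := fun z => ‖w z‖⁻¹ • w z
            contDiff_n := ((hw1.norm ℝ hw0).inv fun z => norm_ne_zero_iff.mpr (hw0 z)).smul hw1
            norm_n := fun z => by
              rw [norm_smul, norm_inv, norm_norm, inv_mul_cancel₀ (norm_ne_zero_iff.mpr (hw0 z))]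
            inner_n := fun z h => ?_
            mem_iff := fun y hy => ?_
            isNormal := fun z hz => ?_ }⟩
  · refine LipschitzWith.of_dist_le_mul fun x y => ?_
    rw [dist_eq_norm, dist_eq_norm, ← map_sub, ← map_sub, sub_sub_sub_cancel_right]
    have := norm_horiz_le (e (x - y))
    rw [e.norm_map] at this
    simpa using this
  · rw [inner_smul_left, hwi, hG', e.apply_symm_apply, horiz_horizIncl_add]
    simp [horizIncl_apply]
  · rw [(hch y hy).2]
    have h1 : G (horiz (e (y - Q))) = y ↔
        horizIncl (horiz (e (y - Q))) + ψ (horiz (e (y - Q))) • basisE 2 = e (y - Q) := by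
      rw [← heG, e.injective.eq_iff, sub_left_inj]
    rw [h1]
    change (e (y - Q)) 2 = ψ (horiz (e (y - Q))) ↔ _
    constructor
    · intro h
      rw [← h, horizIncl_horiz_add]
    · intro h
      have := congrArg (fun v : E3 => v 2) h
      simpa [horizIncl_apply] using this.symm
  · refine ⟨by rw [norm_smul, norm_inv, norm_norm, inv_mul_cancel₀ (norm_ne_zero_iff.mpr (hw0 z))],
      fun y => ψ (horiz (e (y - Q))) - (e (y - Q)) 2, ‖w z‖, norm_pos_iff.mpr (hw0 z), ?_, ?_, ?_, ?_⟩
    · have h1 : ContDiff ℝ 1 fun y => e (y - Q) := e.contDiff.comp (contDiff_id.sub contDiff_const)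
      have h2 : ContDiff ℝ 1 fun y => (e (y - Q)) 2 :=
        (EuclideanSpace.proj (𝕜 := ℝ) (2 : Fin 3)).contDiff.comp h1
      exact (((hψ.of_le (by norm_num)).comp (horiz.contDiff.comp h1)).sub h2).contDiffAt
    · simp only [heG, horiz_horizIncl_add]
      simp [horizIncl_apply]
    · rw [smul_smul, mul_inv_cancel₀ (norm_ne_zero_iff.mpr (hw0 z)), one_smul]
      have h1 : HasFDerivAt (fun y => e (y - Q)) (e.toContinuousLinearEquiv : E3 →L[ℝ] E3) (G z) :=
        ((e.toContinuousLinearEquiv : E3 →L[ℝ] E3).hasFDerivAt).comp (G z)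
          ((hasFDerivAt_id (G z)).sub_const Q)
      have h2 : HasFDerivAt (fun y => (e (y - Q)) 2)
          ((EuclideanSpace.proj (𝕜 := ℝ) (2 : Fin 3)).comp (e.toContinuousLinearEquiv : E3 →L[ℝ] E3))
          (G z) := (EuclideanSpace.proj (𝕜 := ℝ) (2 : Fin 3)).hasFDerivAt.comp (G z) h1
      have h3 : HasFDerivAt ψ (fderiv ℝ ψ z) (horiz (e (G z - Q))) := by
        rw [heG, horiz_horizIncl_add]; exact (hψ1 z).hasFDerivAt
      have h4 := (h3.comp (G z) (horiz.hasFDerivAt.comp (G z) h1)).sub h2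
      rw [hasGradientAt_iff_hasFDerivAt]
      refine h4.congr_fderiv ?_
      ext v
      rw [InnerProductSpace.toDual_apply_apply, hwi]
      rfl
    · filter_upwards [Metric.isOpen_ball.mem_nhds hz] with y hy
      rw [(hch y hy).1, sub_neg]
      rfl

/-- If `n₁ ≠ n₂`, moving from `x` in the direction `n₂ - n₁` makes `ρ₁` negative and `ρ₂` positive
to first order, so nearby points would be both inside and outside `Ω`. -/
theorem IsOutwardUnitNormal.unique {Ω : Set E3} {x n₁ n₂ : E3} (h₁ : IsOutwardUnitNormal Ω x n₁)
    (h₂ : IsOutwardUnitNormal Ω x n₂) : n₁ = n₂ := by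
  obtain ⟨hn1, ρ₁, c₁, hc1, -, h10, hg1, he1⟩ := h₁
  obtain ⟨hn2, ρ₂, c₂, hc2, -, h20, hg2, he2⟩ := h₂
  by_contra hne
  have hlt : inner ℝ n₁ n₂ < 1 := by
    refine lt_of_le_of_ne ?_ fun h => hne ((inner_eq_one_iff_of_norm_eq_one hn1 hn2).mp h)
    have := real_inner_le_norm n₁ n₂
    rwa [hn1, hn2, one_mul] at this
  have hline : HasDerivAt (fun t : ℝ => x + t • (n₂ - n₁)) (n₂ - n₁) 0 := by
    simpa using ((hasDerivAt_id (0 : ℝ)).smul_const (n₂ - n₁)).const_add x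
  have key : ∀ (ρ : E3 → ℝ) (g : E3), HasGradientAt ρ g x →
      HasDerivAt (fun t : ℝ => ρ (x + t • (n₂ - n₁))) (inner ℝ g (n₂ - n₁)) 0 := by
    intro ρ g hg
    have h := (hasGradientAt_iff_hasFDerivAt.mp hg)
    have h' : HasFDerivAt ρ (InnerProductSpace.toDual ℝ E3 g) (x + (0 : ℝ) • (n₂ - n₁)) := by
      simpa using h
    exact h'.comp_hasDerivAt (0 : ℝ) hline
  have d1 := key ρ₁ _ hg1
  have d2 := key ρ₂ _ hg2
  have s1 : inner ℝ (c₁ • n₁) (n₂ - n₁) < 0 := by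
    rw [inner_smul_left, inner_sub_right, real_inner_self_eq_norm_sq, hn1]
    exact mul_neg_of_pos_of_neg hc1 (by linarith)
  have s2 : 0 < inner ℝ (c₂ • n₂) (n₂ - n₁) := by
    rw [inner_smul_left, inner_sub_right, real_inner_self_eq_norm_sq, hn2, real_inner_comm]
    exact mul_pos hc2 (by linarith)
  have hsl : Tendsto (fun t : ℝ => x + t • (n₂ - n₁)) (𝓝[>] 0) (𝓝 x) := by
    have := hline.continuousAt.tendsto
    simp only [zero_smul, add_zero] at this
    exact this.mono_left nhdsWithin_le_nhds
  have e1 : ∀ᶠ t : ℝ in 𝓝[>] 0, ρ₁ (x + t • (n₂ - n₁)) < 0 := by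
    have h := (hasDerivAt_iff_tendsto_slope.mp d1).mono_left
      (nhdsWithin_mono 0 fun t (ht : t ∈ Ioi (0 : ℝ)) => (mem_Ioi.mp ht).ne')
    filter_upwards [h.eventually (gt_mem_nhds s1), self_mem_nhdsWithin] with t ht ht0
    simp only [slope_def_field, zero_smul, add_zero, h10, sub_zero] at ht
    exact (div_neg_iff.mp ht).resolve_left (fun h => absurd h.2 (not_lt.mpr (le_of_lt ht0))) |>.1
  have e2 : ∀ᶠ t : ℝ in 𝓝[>] 0, 0 < ρ₂ (x + t • (n₂ - n₁)) := by
    have h := (hasDerivAt_iff_tendsto_slope.mp d2).mono_left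
      (nhdsWithin_mono 0 fun t (ht : t ∈ Ioi (0 : ℝ)) => (mem_Ioi.mp ht).ne')
    filter_upwards [h.eventually (lt_mem_nhds s2), self_mem_nhdsWithin] with t ht ht0
    simp only [slope_def_field, zero_smul, add_zero, h20, sub_zero] at ht
    exact (div_pos_iff_of_pos_right ht0).mp ht
  obtain ⟨t, ⟨⟨ht1, ht2⟩, ht3⟩, ht4⟩ :=
    (((e1.and e2).and (hsl.eventually he1)).and (hsl.eventually he2)).exists
  exact absurd (ht4.mp (ht3.mpr ht1)) (not_lt.mpr ht2.le)

theorem IsOutwardUnitNormal.normal_eq {Ω : Set E3} {x n : E3} (h : IsOutwardUnitNormal Ω x n) :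
    normal Ω x = n :=
  (Classical.epsilon_spec (p := IsOutwardUnitNormal Ω x) ⟨n, h⟩).unique h

namespace LocalChart

variable {Ω : Set E3} {Q : E3} (c : LocalChart Ω Q)

theorem normal_G {z : E2} (hz : c.G z ∈ Metric.ball Q c.r) : normal Ω (c.G z) = c.n z :=
  (c.isNormal z hz).normal_eq

theorem normal_eq {y : E3} (hy : y ∈ Metric.ball Q c.r) (hyf : y ∈ frontier Ω) :
    normal Ω y = c.n (c.π y) := by
  have h := (c.mem_iff y hy).mp hyf
  have h' := c.normal_G (z := c.π y) (by rwa [h])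
  rwa [h] at h'

theorem G_mem {z : E2} (hz : c.G z ∈ Metric.ball Q c.r) : c.G z ∈ frontier Ω :=
  (c.mem_iff _ hz).mpr (by rw [c.π_G])

/-- The coordinate map is a 1-Lipschitz left inverse, so a graph parametrization never contracts
distances. The lower bound on its derivative, hence its injectivity, follows. -/
theorem dist_le_dist_G (z z' : E2) : dist z z' ≤ dist (c.G z) (c.G z') := by
  have := c.lip_π.dist_le_mul (c.G z) (c.G z')
  rwa [c.π_G, c.π_G, NNReal.coe_one, one_mul] at this

theorem norm_le_norm_fderiv (z h : E2) : ‖h‖ ≤ ‖fderiv ℝ c.G z h‖ := by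
  have hG : HasFDerivAt c.G (fderiv ℝ c.G z) z :=
    (c.contDiff_G.differentiable (by norm_num) z).hasFDerivAt
  have hd : HasDerivAt (fun t : ℝ => c.G (z + t • h)) (fderiv ℝ c.G z h) 0 :=
    HasFDerivAt.hasLineDerivAt hG h
  have h1 := (hasDerivAt_iff_tendsto_slope.mp hd).norm
  refine ge_of_tendsto h1 ?_
  filter_upwards [self_mem_nhdsWithin] with t ht
  have ht' : t ≠ 0 := ht
  rw [slope_def_module, norm_smul, ← dist_eq_norm, sub_zero]
  have := c.dist_le_dist_G (z + t • h) (z + (0 : ℝ) • h)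
  rw [dist_eq_norm] at this
  simp only [zero_smul, add_zero, add_sub_cancel_left, norm_smul] at this ⊢
  rw [norm_inv, inv_mul_eq_div, le_div_iff₀ (norm_pos_iff.mpr ht'), mul_comm]
  exact this

end LocalChart

end DiracShell

end

noncomputable section

namespace DiracShell

/-! ### Tubular neighbourhoods -/

variable {Ω : Set E3}

theorem IsC2Domain.isCompact_frontier (hΩ : IsC2Domain Ω) : IsCompact (frontier Ω) :=
  Metric.isCompact_of_isClosed_isBounded isClosed_frontier
    (hΩ.bounded.closure.subset frontier_subset_closure)

theorem IsC2Domain.norm_normal (hΩ : IsC2Domain Ω) {x : E3} (hx : x ∈ frontier Ω) :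
    ‖normal Ω x‖ = 1 := by
  obtain ⟨c⟩ := nonempty_localChart hΩ hx
  rw [c.normal_eq (Metric.mem_ball_self c.r_pos) hx, c.norm_n]

theorem IsC2Domain.continuousOn_normal (hΩ : IsC2Domain Ω) :
    ContinuousOn (normal Ω) (frontier Ω) := by
  intro x hx
  obtain ⟨c⟩ := nonempty_localChart hΩ hx
  have h1 : ContinuousWithinAt (fun y => c.n (c.π y)) (frontier Ω) x :=
    (c.contDiff_n.continuous.comp c.contDiff_π.continuous).continuousWithinAt
  refine h1.congr_of_eventuallyEq ?_ (c.normal_eq (Metric.mem_ball_self c.r_pos) hx)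
  filter_upwards [self_mem_nhdsWithin,
    mem_nhdsWithin_of_mem_nhds (Metric.ball_mem_nhds x c.r_pos)] with y hy hy'
  exact c.normal_eq hy' hy

/-- The `C²` hypothesis makes the derivative of `G` locally Lipschitz, so `y - x` differs from the
tangent vector `DG(b - a)` by `O(|b - a|²)`. The tangent vector is orthogonal to the normal, and `|b
- a| ≤ |y - x|`. -/
theorem LocalChart.exists_abs_inner_le {Q : E3} (c : LocalChart Ω Q) :
    ∃ K ≥ 0, ∀ᶠ p in 𝓝[frontier Ω ×ˢ frontier Ω] (Q, Q),
      |inner ℝ (p.2 - p.1) (normal Ω p.1)| ≤ K * ‖p.2 - p.1‖ ^ 2 := by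
  have hG1 : ContDiff ℝ 1 (fderiv ℝ c.G) := c.contDiff_G.fderiv_right (by norm_num)
  obtain ⟨K, t, ht, hK⟩ := hG1.contDiffAt.exists_lipschitzOnWith (x := c.π Q)
  obtain ⟨ρ, hρ, hball⟩ := Metric.mem_nhds_iff.mp ht
  refine ⟨K, K.2, ?_⟩
  have hπ1 : ∀ᶠ p in 𝓝 (Q, Q), c.π p.1 ∈ Metric.ball (c.π Q) ρ :=
    (c.contDiff_π.continuous.comp continuous_fst).continuousAt.eventually
      (Metric.ball_mem_nhds _ hρ)
  have hπ2 : ∀ᶠ p in 𝓝 (Q, Q), c.π p.2 ∈ Metric.ball (c.π Q) ρ :=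
    (c.contDiff_π.continuous.comp continuous_snd).continuousAt.eventually
      (Metric.ball_mem_nhds _ hρ)
  have hb1 : ∀ᶠ p in 𝓝 (Q, Q), p.1 ∈ Metric.ball Q c.r :=
    continuous_fst.continuousAt.eventually (Metric.ball_mem_nhds _ c.r_pos)
  have hb2 : ∀ᶠ p in 𝓝 (Q, Q), p.2 ∈ Metric.ball Q c.r :=
    continuous_snd.continuousAt.eventually (Metric.ball_mem_nhds _ c.r_pos)
  filter_upwards [self_mem_nhdsWithin, mem_nhdsWithin_of_mem_nhds hπ1,
    mem_nhdsWithin_of_mem_nhds hπ2, mem_nhdsWithin_of_mem_nhds hb1,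
    mem_nhdsWithin_of_mem_nhds hb2] with p hp h1 h2 h3 h4
  obtain ⟨x, y⟩ := p
  simp only [mem_prod] at hp h1 h2 h3 h4 ⊢
  have ex := (c.mem_iff x h3).mp hp.1
  have ey := (c.mem_iff y h4).mp hp.2
  rw [c.normal_eq h3 hp.1]
  set a := c.π x
  set b := c.π y
  have hab : ‖b - a‖ ≤ ‖y - x‖ := by
    have := c.dist_le_dist_G b a
    rwa [dist_eq_norm, dist_eq_norm, ex, ey] at this
  have hseg : ∀ z ∈ segment ℝ a b, ‖fderiv ℝ c.G z - fderiv ℝ c.G a‖ ≤ K * ‖b - a‖ := by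
    intro z hz
    have hzb := (convex_ball (c.π Q) ρ).segment_subset h1 h2 hz
    have hl := hK.dist_le_mul z (hball hzb) a (hball h1)
    rw [dist_eq_norm, dist_eq_norm] at hl
    refine hl.trans ?_
    gcongr
    obtain ⟨u, v, hu, hv, huv, rfl⟩ := hz
    have e : u • a + v • b - a = v • (b - a) := by
      rw [← eq_sub_iff_add_eq] at huv
      rw [huv]; module
    rw [e, norm_smul, Real.norm_of_nonneg hv]
    exact mul_le_of_le_one_left (norm_nonneg _) (by linarith)
  have hmv := (convex_segment a b).norm_image_sub_le_of_norm_hasFDerivWithin_le'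
    (fun z _ => ((c.contDiff_G.differentiable (by norm_num)) z).hasFDerivAt.hasFDerivWithinAt)
    hseg (left_mem_segment ℝ a b) (right_mem_segment ℝ a b)
  rw [ex, ey] at hmv
  have horth : inner ℝ (fderiv ℝ c.G a (b - a)) (c.n a) = 0 := by
    rw [real_inner_comm, c.inner_n]
  have e2 : inner ℝ (y - x) (c.n a) = inner ℝ (y - x - fderiv ℝ c.G a (b - a)) (c.n a) := by
    rw [inner_sub_left _ (fderiv ℝ c.G a (b - a)), horth, sub_zero]
  rw [e2]
  refine (abs_real_inner_le_norm _ _).trans ?_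
  rw [c.norm_n, mul_one]
  refine hmv.trans ?_
  rw [sq, ← mul_assoc]
  have hK0 := K.2
  gcongr

/-- Compactness of `Σ × Σ`: charts handle neighbourhoods of the diagonal, and away from it `|y - x|`
is bounded below, so Cauchy–Schwarz suffices. -/
theorem IsC2Domain.exists_abs_inner_le (hΩ : IsC2Domain Ω) :
    ∃ K : ℝ, 0 ≤ K ∧ ∀ x ∈ frontier Ω, ∀ y ∈ frontier Ω,
      |inner ℝ (y - x) (normal Ω x)| ≤ K * ‖y - x‖ ^ 2 := by
  have hc := hΩ.isCompact_frontier.prod hΩ.isCompact_frontier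
  suffices h : ∃ K : ℝ, 0 ≤ K ∧ ∀ p ∈ (frontier Ω ×ˢ frontier Ω),
      |inner ℝ (p.2 - p.1) (normal Ω p.1)| ≤ K * ‖p.2 - p.1‖ ^ 2 by
    obtain ⟨K, hK0, hK⟩ := h
    exact ⟨K, hK0, fun x hx y hy => hK (x, y) ⟨hx, hy⟩⟩
  refine hc.induction_on (p := fun s => ∃ K : ℝ, 0 ≤ K ∧ ∀ p ∈ s,
      |inner ℝ (p.2 - p.1) (normal Ω p.1)| ≤ K * ‖p.2 - p.1‖ ^ 2) ?_ ?_ ?_ ?_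
  · exact ⟨0, le_rfl, by simp⟩
  · rintro s t hst ⟨K, h0, hK⟩
    exact ⟨K, h0, fun p hp => hK p (hst hp)⟩
  · rintro s t ⟨K, h0, hK⟩ ⟨L, -, hL⟩
    refine ⟨max K L, h0.trans (le_max_left _ _), ?_⟩
    rintro p (hp | hp)
    · exact (hK p hp).trans (by gcongr; exact le_max_left _ _)
    · exact (hL p hp).trans (by gcongr; exact le_max_right _ _)
  · rintro ⟨x, y⟩ ⟨hx, hy⟩
    simp only at hx hy
    by_cases hxy : x = y
    · subst hxy
      obtain ⟨c⟩ := nonempty_localChart hΩ hx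
      obtain ⟨K, hK0, hK⟩ := c.exists_abs_inner_le
      exact ⟨_, hK, K, hK0, fun p hp => hp⟩
    · have hd : 0 < ‖y - x‖ := norm_pos_iff.mpr (sub_ne_zero.mpr (Ne.symm hxy))
      have hev : ∀ᶠ p : E3 × E3 in 𝓝 (x, y), ‖y - x‖ / 2 < ‖p.2 - p.1‖ := by
        have hcont : Continuous fun p : E3 × E3 => ‖p.2 - p.1‖ := by fun_prop
        exact hcont.continuousAt.eventually (lt_mem_nhds (by simp only; linarith))
      refine ⟨_, inter_mem self_mem_nhdsWithin (mem_nhdsWithin_of_mem_nhds hev),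
        2 / ‖y - x‖, by positivity, ?_⟩
      rintro p ⟨hp, hpd⟩
      refine (abs_real_inner_le_norm _ _).trans ?_
      rw [hΩ.norm_normal hp.1, mul_one]
      have hpd' : ‖y - x‖ / 2 < ‖p.2 - p.1‖ := hpd
      rw [sq, ← mul_assoc]
      refine le_mul_of_one_le_left (norm_nonneg _) ?_
      rw [div_mul_eq_mul_div, le_div_iff₀ hd]
      linarith

/-- If `x + sν(x) = y + tν(y)`, pairing with `y - x` gives `|y - x|² = s⟨y - x, ν(x)⟩ + t⟨x - y,
ν(y)⟩ ≤ 2εK |y - x|²`, which forces `x = y` when `2εK < 1`. -/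
theorem tube_injOn {K ε : ℝ} (hΩ : IsC2Domain Ω)
    (hK : ∀ x ∈ frontier Ω, ∀ y ∈ frontier Ω,
      |inner ℝ (y - x) (normal Ω x)| ≤ K * ‖y - x‖ ^ 2) (hε : 2 * ε * K < 1) :
    InjOn (tube Ω) (collar Ω ε) := by
  rintro ⟨x, s⟩ ⟨hx, hs⟩ ⟨y, t⟩ ⟨hy, ht⟩ h
  simp only at hx hs hy ht
  simp only [tube] at h
  have hs' : |s| ≤ ε := (abs_lt.mpr hs).le
  have ht' : |t| ≤ ε := (abs_lt.mpr ht).le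
  have hd : y - x = s • normal Ω x - t • normal Ω y := by
    rw [sub_eq_sub_iff_add_eq_add, ← h, add_comm]
  have h1 : ‖y - x‖ ^ 2 = s * inner ℝ (y - x) (normal Ω x) + t * inner ℝ (x - y) (normal Ω y) := by
    rw [← real_inner_self_eq_norm_sq]
    nth_rewrite 2 [hd]
    rw [inner_sub_right, inner_smul_right, inner_smul_right, ← neg_sub y x, inner_neg_left]
    ring
  have b1 : s * inner ℝ (y - x) (normal Ω x) ≤ ε * (K * ‖y - x‖ ^ 2) := by
    refine (le_abs_self _).trans ?_
    rw [abs_mul]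
    exact mul_le_mul hs' (hK x hx y hy) (abs_nonneg _) ((abs_nonneg _).trans hs')
  have b2 : t * inner ℝ (x - y) (normal Ω y) ≤ ε * (K * ‖y - x‖ ^ 2) := by
    refine (le_abs_self _).trans ?_
    rw [abs_mul, norm_sub_rev]
    exact mul_le_mul ht' (hK y hy x hx) (abs_nonneg _) ((abs_nonneg _).trans ht')
  have h0 : ‖y - x‖ ^ 2 = 0 := by nlinarith [sq_nonneg ‖y - x‖]
  have hxy : y = x := by simpa [sub_eq_zero] using h0
  subst hxy
  have hst : s • normal Ω y = t • normal Ω y := add_left_cancel h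
  have hn : normal Ω y ≠ 0 := by
    intro h0; have := hΩ.norm_normal hx; rw [h0] at this; simp at this
  rw [smul_left_injective ℝ hn hst]

/-- The tangent plane, the range of an injective linear map from the plane, has a one-dimensional
orthogonal complement, which contains the unit vector `n z`. -/
theorem LocalChart.exists_eq_smul {Q : E3} (c : LocalChart Ω Q) (z : E2) {w : E3}
    (hw : ∀ h, inner ℝ w (fderiv ℝ c.G z h) = 0) : ∃ s : ℝ, w = s • c.n z := by
  set A : E2 →ₗ[ℝ] E3 := (fderiv ℝ c.G z).toLinearMap with hA
  have hinj : Function.Injective A := by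
    rw [injective_iff_map_eq_zero]
    intro h hh
    have := c.norm_le_norm_fderiv z h
    have hh' : fderiv ℝ c.G z h = 0 := hh
    rw [hh', norm_zero] at this
    exact norm_le_zero_iff.mp this
  have hrank : Module.finrank ℝ A.range = 2 := by
    rw [LinearMap.finrank_range_of_inj hinj]; simp
  have horth : Module.finrank ℝ (A.range)ᗮ = 1 := by
    have := A.range.finrank_add_finrank_orthogonal
    rw [hrank] at this
    simp only [finrank_euclideanSpace, Fintype.card_fin] at this
    omega
  have hmem : ∀ v : E3, (∀ h, inner ℝ v (fderiv ℝ c.G z h) = 0) → v ∈ (A.range)ᗮ := by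
    intro v hv
    rw [Submodule.mem_orthogonal']
    rintro _ ⟨h, rfl⟩
    exact hv h
  have hn0 : (⟨c.n z, hmem _ (c.inner_n z)⟩ : (A.range)ᗮ) ≠ 0 := by
    intro h
    have h' : c.n z = 0 := congrArg Subtype.val h
    have := c.norm_n z
    rw [h'] at this; simp at this
  obtain ⟨s, hs⟩ := (finrank_eq_one_iff_of_nonzero' _ hn0).mp horth ⟨w, hmem w hw⟩
  exact ⟨s, (congrArg Subtype.val hs).symm⟩

theorem tube_mem_shell (hΩ : IsC2Domain Ω) {ε : ℝ} {p : E3 × ℝ} (hp : p ∈ collar Ω ε) :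
    tube Ω p ∈ shell Ω ε := by
  refine Metric.mem_thickening_iff.mpr ⟨p.1, hp.1, ?_⟩
  rw [tube, dist_eq_norm, add_sub_cancel_left, norm_smul, hΩ.norm_normal hp.1, mul_one]
  exact abs_lt.mpr hp.2

/-- Take a point `x` of `Σ` nearest to `y`. The first-order condition for the squared distance in a
chart makes `y - x` normal to `Σ` at `x`, and its length is less than `ε`. -/
theorem tube_surjOn (hΩ : IsC2Domain Ω) (ε : ℝ) :
    SurjOn (tube Ω) (collar Ω ε) (shell Ω ε) := by
  intro y hy
  obtain ⟨x₀, hx₀, hd₀⟩ := Metric.mem_thickening_iff.mp hy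
  obtain ⟨x, hx, hdx⟩ := hΩ.isCompact_frontier.exists_infDist_eq_dist ⟨x₀, hx₀⟩ y
  have hmin : ∀ x' ∈ frontier Ω, dist y x ≤ dist y x' := fun x' hx' => by
    rw [← hdx]; exact Metric.infDist_le_dist_of_mem hx'
  obtain ⟨c⟩ := nonempty_localChart hΩ hx
  have hxb := Metric.mem_ball_self (x := x) c.r_pos
  have hGx := (c.mem_iff x hxb).mp hx
  set z := c.π x with hz
  have hGd : HasFDerivAt c.G (fderiv ℝ c.G z) z :=
    (c.contDiff_G.differentiable (by norm_num) z).hasFDerivAt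
  have hloc : IsLocalMin (fun z' => ‖c.G z' - y‖ ^ 2) z := by
    have hb : ∀ᶠ z' in 𝓝 z, c.G z' ∈ Metric.ball x c.r :=
      c.contDiff_G.continuous.continuousAt.eventually
        (Metric.isOpen_ball.mem_nhds (by rw [hGx]; exact hxb))
    filter_upwards [hb] with z' hz'
    have := hmin _ (c.G_mem hz')
    rw [dist_comm, dist_comm y, dist_eq_norm, dist_eq_norm] at this
    rw [hGx]
    gcongr
  have hderiv := (hGd.sub_const y).norm_sq
  have hzero := hloc.hasFDerivAt_eq_zero hderiv
  obtain ⟨s, hs⟩ := c.exists_eq_smul z (w := y - x) fun h => by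
    have := congrArg (fun L : E2 →L[ℝ] ℝ => L h) hzero
    simp only [hGx, _root_.smul_apply, ContinuousLinearMap.comp_apply, innerSL_apply_apply,
      zero_apply] at this
    rw [← neg_sub, inner_neg_left]
    simpa using this
  refine ⟨(x, s), ⟨hx, ?_⟩, ?_⟩
  · have h1 : |s| = dist y x := by
      rw [dist_eq_norm, hs, norm_smul, c.norm_n, mul_one, Real.norm_eq_abs]
    have h2 : |s| < ε := by
      rw [h1]; exact (hmin x₀ hx₀).trans_lt hd₀
    exact abs_lt.mp h2
  · rw [tube, c.normal_eq hxb hx, ← hz, ← hs]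
    abel

end DiracShell

end

noncomputable section

namespace DiracShell

/-! ### The Jacobian of tubular coordinates -/

variable {Ω : Set E3}

/-- The map `f ⊕ id` on `T ⊕ Tᗮ`. It lets the determinant `det (1 - tW)` on the tangent plane be
read off from a map of the whole space. -/
theorem exists_extend_det (T : Submodule ℝ E3) (f : T →ₗ[ℝ] T) :
    ∃ M : E3 →ₗ[ℝ] E3, LinearMap.det M = LinearMap.det f ∧ (∀ v : T, M v = f v) ∧
      ∀ v ∈ Tᗮ, M v = v := by
  have hc : IsCompl T Tᗮ := Submodule.isCompl_orthogonal T
  set e := T.prodEquivOfIsCompl Tᗮ hc with he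
  refine ⟨(e : (T × Tᗮ) →ₗ[ℝ] E3) ∘ₗ (f.prodMap LinearMap.id) ∘ₗ (e.symm : E3 →ₗ[ℝ] (T × Tᗮ)),
    ?_, fun v => ?_, fun v hv => ?_⟩
  · have h : LinearMap.det (LinearMap.prodMap f (LinearMap.id : Tᗮ →ₗ[ℝ] Tᗮ)) =
        LinearMap.det f * LinearMap.det (LinearMap.id : Tᗮ →ₗ[ℝ] Tᗮ) := LinearMap.det_prodMap _ _
    rw [LinearMap.det_conj, h, LinearMap.det_id, mul_one]
  · simp [he]
  · have := T.prodEquivOfIsCompl_symm_apply_right Tᗮ hc ⟨v, hv⟩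
    simp only [LinearMap.comp_apply, LinearEquiv.coe_coe]
    rw [he, show v = ((⟨v, hv⟩ : Tᗮ) : E3) from rfl, this]
    simp

namespace LocalChart

variable {Q : E3} (c : LocalChart Ω Q)

theorem hasFDerivAt_G (z : E2) : HasFDerivAt c.G (fderiv ℝ c.G z) z :=
  (c.contDiff_G.differentiable (by norm_num) z).hasFDerivAt

theorem hasFDerivAt_n (z : E2) : HasFDerivAt c.n (fderiv ℝ c.n z) z :=
  (c.contDiff_n.differentiable (by norm_num) z).hasFDerivAt

theorem inner_fderiv_n (z h : E2) : inner ℝ (c.n z) (fderiv ℝ c.n z h) = 0 := by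
  have h1 : HasFDerivAt (fun z => ‖c.n z‖ ^ 2) (2 • (innerSL ℝ (c.n z)).comp (fderiv ℝ c.n z)) z :=
    (c.hasFDerivAt_n z).norm_sq
  have h2 : HasFDerivAt (fun z => ‖c.n z‖ ^ 2) (0 : E2 →L[ℝ] ℝ) z := by
    simp only [c.norm_n]
    exact hasFDerivAt_const _ _
  have := congrArg (fun L : E2 →L[ℝ] ℝ => L h) (h1.unique h2)
  simpa using this

/-- The chain rule for `ν ∘ G = n`. A derivative of `ν` within a surface is ambiguous in the normal
direction, but composing with `G` fixes its values on tangent vectors whichever one `fderivWithin`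
selects. -/
theorem fderivWithin_normal {z : E2} (hz : c.G z ∈ Metric.ball Q c.r) (h : E2) :
    fderivWithin ℝ (normal Ω) (frontier Ω) (c.G z) (fderiv ℝ c.G z h) = fderiv ℝ c.n z h := by
  have hev : ∀ᶠ y in 𝓝[frontier Ω] (c.G z), normal Ω y = c.n (c.π y) := by
    filter_upwards [self_mem_nhdsWithin,
      mem_nhdsWithin_of_mem_nhds (Metric.isOpen_ball.mem_nhds hz)] with y hy hy'
    exact c.normal_eq hy' hy
  have hd : DifferentiableWithinAt ℝ (normal Ω) (frontier Ω) (c.G z) := by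
    have h1 : DifferentiableAt ℝ (fun y => c.n (c.π y)) (c.G z) :=
      ((c.contDiff_n.comp c.contDiff_π).differentiable (by norm_num)) _
    exact h1.differentiableWithinAt.congr_of_eventuallyEq hev (by rw [c.normal_G hz, c.π_G])
  have hz' : ∀ᶠ z' in 𝓝 z, c.G z' ∈ Metric.ball Q c.r :=
    c.contDiff_G.continuous.continuousAt.eventually (Metric.isOpen_ball.mem_nhds hz)
  have ht : Tendsto c.G (𝓝 z) (𝓝[frontier Ω] (c.G z)) :=
    tendsto_nhdsWithin_iff.mpr ⟨c.contDiff_G.continuous.continuousAt, hz'.mono fun z' h => c.G_mem h⟩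
  have hcomp : HasFDerivAt (normal Ω ∘ c.G)
      ((fderivWithin ℝ (normal Ω) (frontier Ω) (c.G z)).comp (fderiv ℝ c.G z)) z := by
    have h1 : HasFDerivAtFilter (normal Ω) (fderivWithin ℝ (normal Ω) (frontier Ω) (c.G z))
      (𝓝[frontier Ω] (c.G z) ×ˢ pure (c.G z)) := hd.hasFDerivWithinAt
    exact h1.comp (c.hasFDerivAt_G z) (ht.prodMap (tendsto_pure_pure _ _))
  have hn : HasFDerivAt c.n
      ((fderivWithin ℝ (normal Ω) (frontier Ω) (c.G z)).comp (fderiv ℝ c.G z)) z :=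
    hcomp.congr_of_eventuallyEq (hz'.mono fun z' h => (c.normal_G h).symm)
  rw [hn.fderiv]
  rfl

/-- The derivative of tubular coordinates in a chart. -/
def tubeDeriv (z : E2) (t : ℝ) : E3 →L[ℝ] E3 :=
  (fderiv ℝ c.G z + t • fderiv ℝ c.n z).comp horiz +
    (EuclideanSpace.proj (𝕜 := ℝ) (2 : Fin 3)).smulRight (c.n z)

theorem tubeDeriv_apply (z : E2) (t : ℝ) (v : E3) : c.tubeDeriv z t v =
    fderiv ℝ c.G z (horiz v) + t • fderiv ℝ c.n z (horiz v) + v 2 • c.n z := by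
  simp [tubeDeriv]

theorem continuous_tubeDeriv : Continuous fun p : E2 × ℝ => c.tubeDeriv p.1 p.2 := by
  have h1 : Continuous fun p : E2 × ℝ => fderiv ℝ c.G p.1 :=
    (c.contDiff_G.continuous_fderiv (by norm_num)).comp continuous_fst
  have h2 : Continuous fun p : E2 × ℝ => fderiv ℝ c.n p.1 :=
    (c.contDiff_n.continuous_fderiv (by norm_num)).comp continuous_fst
  have h3 : Continuous fun p : E2 × ℝ => c.n p.1 := c.contDiff_n.continuous.comp continuous_fst
  unfold tubeDeriv
  refine ((h1.add (continuous_snd.smul h2)).clm_comp continuous_const).add ?_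
  exact ((ContinuousLinearMap.smulRightL ℝ E3 E3
    (EuclideanSpace.proj (𝕜 := ℝ) (2 : Fin 3))).continuous.comp h3)

/-- The Jacobian determinant of tubular coordinates in a chart. -/
def tubeDet (p : E2 × ℝ) : ℝ := (c.tubeDeriv p.1 p.2).det

theorem continuous_tubeDet : Continuous c.tubeDet :=
  ContinuousLinearMap.continuous_det.comp c.continuous_tubeDeriv

/-- The tubular derivative at height `t` factors as `M` after the one at height 0, where `M` is `1 -
tW` on the tangent plane and the identity on the normal line. Indeed `DG + t Dn = (1 - tW) DG`,
because `Dn = -W DG`. -/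
theorem tubeDet_eq {z : E2} (hz : c.G z ∈ Metric.ball Q c.r) (t : ℝ) :
    c.tubeDet (z, t) = jac Ω t (c.G z) * c.tubeDet (z, 0) := by
  set T := tangentPlane Ω (c.G z) with hT
  have hnm : normal Ω (c.G z) = c.n z := c.normal_G hz
  have hmem : ∀ v, inner ℝ (c.n z) v = 0 → v ∈ T := by
    intro v hv
    rw [hT, tangentPlane, hnm, Submodule.mem_orthogonal_singleton_iff_inner_right]
    exact hv
  obtain ⟨M, hdet, hMT, hMn⟩ := exists_extend_det T (1 - t • weingarten Ω (c.G z))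
  have hMnn : M (c.n z) = c.n z := by
    refine hMn _ ?_
    rw [hT, tangentPlane, hnm, Submodule.orthogonal_orthogonal]
    exact Submodule.mem_span_singleton_self _
  have hMG : ∀ h, M (fderiv ℝ c.G z h) = fderiv ℝ c.G z h + t • fderiv ℝ c.n z h := by
    intro h
    have h1 := hMT ⟨fderiv ℝ c.G z h, hmem _ (c.inner_n z h)⟩
    have h2 : ((weingarten Ω (c.G z) ⟨fderiv ℝ c.G z h, hmem _ (c.inner_n z h)⟩ : T) : E3) =
        -fderiv ℝ c.n z h := by
      simp only [weingarten, LinearMap.neg_apply, LinearMap.comp_apply, Submodule.subtype_apply,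
        ContinuousLinearMap.coe_coe]
      rw [c.fderivWithin_normal hz, Submodule.coe_neg]
      congr 1
      exact Submodule.starProjection_eq_self_iff.mpr (hmem _ (c.inner_fderiv_n z h))
    rw [h1, LinearMap.sub_apply, LinearMap.smul_apply, Submodule.coe_sub, Submodule.coe_smul, h2]
    simp
  have hcomp : (c.tubeDeriv z t : E3 →ₗ[ℝ] E3) = M ∘ₗ (c.tubeDeriv z 0 : E3 →ₗ[ℝ] E3) := by
    ext1 v
    simp only [LinearMap.comp_apply, ContinuousLinearMap.coe_coe, tubeDeriv_apply, map_add, hMG,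
      map_smul, hMnn, zero_smul, add_zero]
  rw [tubeDet, ContinuousLinearMap.det, hcomp, LinearMap.det_comp, hdet]
  rfl

/-- At height 0 the third column is the unit normal, orthogonal to the tangential ones. The 3 × 3
Gram determinant thus reduces to the 2 × 2 one, which is the squared area density. -/
theorem abs_tubeDet_zero (z : E2) :
    |c.tubeDet (z, 0)| = (fderiv ℝ c.G z : E2 →ₗ[ℝ] E3).normDet := by
  set A : E2 →ₗ[ℝ] E3 := (fderiv ℝ c.G z).toLinearMap with hA
  set B : E3 →ₗ[ℝ] E3 := (c.tubeDeriv z 0).toLinearMap with hB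
  have h3 := LinearMap.normDet_sq_eq_det_gram B (EuclideanSpace.basisFun (Fin 3) ℝ)
  have h2 := LinearMap.normDet_sq_eq_det_gram A (EuclideanSpace.basisFun (Fin 2) ℝ)
  have hBv : ∀ v : E3, B v = A (horiz v) + v 2 • c.n z := fun v => by
    change c.tubeDeriv z 0 v = _
    rw [tubeDeriv_apply, zero_smul, add_zero]; rfl
  have b0 : B (EuclideanSpace.basisFun (Fin 3) ℝ 0) = A (EuclideanSpace.basisFun (Fin 2) ℝ 0) := by
    rw [hBv]
    have : horiz (EuclideanSpace.basisFun (Fin 3) ℝ 0) = EuclideanSpace.basisFun (Fin 2) ℝ 0 := by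
      ext i; fin_cases i <;> simp [horiz_apply]
    rw [this]; simp
  have b1 : B (EuclideanSpace.basisFun (Fin 3) ℝ 1) = A (EuclideanSpace.basisFun (Fin 2) ℝ 1) := by
    rw [hBv]
    have : horiz (EuclideanSpace.basisFun (Fin 3) ℝ 1) = EuclideanSpace.basisFun (Fin 2) ℝ 1 := by
      ext i; fin_cases i <;> simp [horiz_apply]
    rw [this]; simp
  have b2 : B (EuclideanSpace.basisFun (Fin 3) ℝ 2) = c.n z := by
    rw [hBv]
    have : horiz (EuclideanSpace.basisFun (Fin 3) ℝ 2) = 0 := by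
      ext i; fin_cases i <;> simp [horiz_apply]
    rw [this]; simp
  have hin : ∀ h, inner ℝ (c.n z) (A h) = 0 := c.inner_n z
  have hin' : ∀ h, inner ℝ (A h) (c.n z) = 0 := fun h => by rw [real_inner_comm, hin]
  have hnn : inner ℝ (c.n z) (c.n z) = (1 : ℝ) := by
    rw [real_inner_self_eq_norm_sq, c.norm_n, one_pow]
  rw [Matrix.det_fin_three] at h3
  rw [Matrix.det_fin_two] at h2
  simp only [Matrix.gram_apply, b0, b1, b2, hin, hin', hnn] at h2 h3
  have h4 : B.normDet ^ 2 = A.normDet ^ 2 := by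
    have h2' : A.normDet ^ 2 = _ := h2
    have h3' : B.normDet ^ 2 = _ := h3
    rw [h2', h3']; ring
  have h5 : B.normDet = A.normDet :=
    (sq_eq_sq₀ B.normDet_nonneg A.normDet_nonneg).mp h4
  rw [← h5, LinearMap.normDet_eq_abs_det]
  rfl

theorem normDet_pos (z : E2) : 0 < (fderiv ℝ c.G z : E2 →ₗ[ℝ] E3).normDet := by
  refine lt_of_le_of_ne (LinearMap.normDet_nonneg _) (Ne.symm ?_)
  rw [Ne, LinearMap.normDet_eq_zero_iff_ker_ne_bot, not_not, LinearMap.ker_eq_bot']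
  intro h hh
  have := c.norm_le_norm_fderiv z h
  have hh' : fderiv ℝ c.G z h = 0 := hh
  rw [hh', norm_zero] at this
  exact norm_le_zero_iff.mp this

theorem tubeDet_zero_ne_zero (z : E2) : c.tubeDet (z, 0) ≠ 0 := by
  rw [← abs_pos, c.abs_tubeDet_zero]
  exact c.normDet_pos z

theorem jac_eq {x : E3} (hx : x ∈ Metric.ball Q c.r) (hf : x ∈ frontier Ω) (t : ℝ) :
    jac Ω t x = c.tubeDet (c.π x, t) / c.tubeDet (c.π x, 0) := by
  have h := (c.mem_iff x hx).mp hf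
  rw [eq_div_iff (c.tubeDet_zero_ne_zero _), c.tubeDet_eq (by rwa [h]) t, h]

end LocalChart

theorem jac_zero (x : E3) : jac Ω 0 x = 1 := by simp [jac]

theorem LocalChart.continuousWithinAt_jac {x : E3} (c : LocalChart Ω x) (hx : x ∈ frontier Ω)
    (t : ℝ) : ContinuousWithinAt (fun p : E3 × ℝ => jac Ω p.2 p.1) (frontier Ω ×ˢ univ) (x, t) := by
  have hxb := Metric.mem_ball_self (x := x) c.r_pos
  have hp : Continuous fun p : E3 × ℝ => c.π p.1 := c.contDiff_π.continuous.comp continuous_fst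
  have h1 : Continuous fun p : E3 × ℝ => c.tubeDet (c.π p.1, p.2) / c.tubeDet (c.π p.1, 0) :=
    (c.continuous_tubeDet.comp (hp.prodMk continuous_snd)).div
      (c.continuous_tubeDet.comp (hp.prodMk continuous_const))
      fun p => c.tubeDet_zero_ne_zero (c.π p.1)
  have hb : ∀ᶠ p : E3 × ℝ in 𝓝 (x, t), p.1 ∈ Metric.ball x c.r :=
    continuous_fst.continuousAt.eventually (Metric.ball_mem_nhds _ c.r_pos)
  have he : (fun p : E3 × ℝ => jac Ω p.2 p.1) =ᶠ[𝓝[frontier Ω ×ˢ univ] (x, t)]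
      fun p : E3 × ℝ => c.tubeDet (c.π p.1, p.2) / c.tubeDet (c.π p.1, 0) := by
    filter_upwards [self_mem_nhdsWithin, mem_nhdsWithin_of_mem_nhds hb] with p hp1 hp2
    exact c.jac_eq hp2 hp1.1 p.2
  exact h1.continuousWithinAt.congr_of_eventuallyEq_of_mem he ⟨hx, mem_univ _⟩

theorem IsC2Domain.continuousOn_jac (hΩ : IsC2Domain Ω) :
    ContinuousOn (fun p : E3 × ℝ => jac Ω p.2 p.1) (frontier Ω ×ˢ univ) := fun p hp =>
  (nonempty_localChart hΩ hp.1).some.continuousWithinAt_jac hp.1 p.2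

/-- The Jacobian is jointly continuous on `Σ × ℝ` and equals 1 at `t = 0`; compactness of `Σ` makes
the neighbourhood of 0 uniform. -/
theorem IsC2Domain.exists_jac_bounds (hΩ : IsC2Domain Ω) :
    ∃ η : ℝ, 0 < η ∧ ∀ x ∈ frontier Ω, ∀ t : ℝ, |t| < η → 1 / 2 ≤ jac Ω t x ∧ jac Ω t x ≤ 2 := by
  have h : ∀ᶠ t : ℝ in 𝓝 0, ∀ x ∈ frontier Ω,
      x ∈ frontier Ω → 1 / 2 ≤ jac Ω t x ∧ jac Ω t x ≤ 2 := by
    refine hΩ.isCompact_frontier.eventually_forall_of_forall_eventually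
      (P := fun t x => x ∈ frontier Ω → 1 / 2 ≤ jac Ω t x ∧ jac Ω t x ≤ 2) fun x hx => ?_
    have hc := hΩ.continuousOn_jac (x, 0) ⟨hx, mem_univ _⟩
    have hI : Icc (1 / 2 : ℝ) 2 ∈ 𝓝 (jac Ω 0 x) := by
      rw [jac_zero]; exact Icc_mem_nhds (by norm_num) (by norm_num)
    have h1 := eventually_nhdsWithin_iff.mp (hc.eventually hI)
    have h2 : Tendsto (fun p : ℝ × E3 => (p.2, p.1)) (𝓝 (0, x)) (𝓝 (x, 0)) :=
      continuous_swap.tendsto (0, x)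
    filter_upwards [h2.eventually h1] with p hp hpf
    exact hp ⟨hpf, mem_univ _⟩
  obtain ⟨η, hη, hball⟩ := Metric.eventually_nhds_iff.mp h
  exact ⟨η, hη, fun x hx t ht => hball (by simpa using ht) x hx hx⟩

end DiracShell

end

noncomputable section

namespace DiracShell

/-! ### The area formula for charts -/

variable {Ω : Set E3}

/-- The map `f ∘ g⁻¹` is well defined and `K`-Lipschitz on `g(B)`, even when `g` is not injective,
because the hypothesis forces `f` to be constant on its fibres in `B`. -/
theorem euclideanHausdorffMeasure_image_le_of_edist_le {X : Type*} (f g : X → E3) (B : Set X)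
    (K : NNReal) (h : ∀ x ∈ B, ∀ y ∈ B, edist (f x) (f y) ≤ K * edist (g x) (g y)) :
    Measure.euclideanHausdorffMeasure 2 (f '' B) ≤
      (K : ℝ≥0∞) ^ 2 * Measure.euclideanHausdorffMeasure 2 (g '' B) := by
  rcases isEmpty_or_nonempty X with hX | hX
  · simp [Set.eq_empty_of_isEmpty B]
  have hinv : ∀ x ∈ B, Function.invFunOn g B (g x) ∈ B ∧ g (Function.invFunOn g B (g x)) = g x :=
    fun x hx => ⟨Function.invFunOn_mem ⟨x, hx, rfl⟩, Function.invFunOn_eq ⟨x, hx, rfl⟩⟩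
  have hf : ∀ x ∈ B, f (Function.invFunOn g B (g x)) = f x := by
    intro x hx
    have h1 := h _ (hinv x hx).1 x hx
    rw [(hinv x hx).2, edist_self, mul_zero, nonpos_iff_eq_zero, edist_eq_zero] at h1
    exact h1
  have himg : f '' B = (f ∘ Function.invFunOn g B) '' (g '' B) := by
    rw [image_image]
    exact image_congr fun x hx => (hf x hx).symm
  have hlip : LipschitzOnWith K (f ∘ Function.invFunOn g B) (g '' B) := by
    rintro _ ⟨x, hx, rfl⟩ _ ⟨y, hy, rfl⟩
    simp only [Function.comp_apply, hf x hx, hf y hy]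
    exact h x hx y hy
  have hle := hlip.hausdorffMeasure_image_le (d := ((2 : ℕ) : ℝ)) (by norm_num)
  rw [himg]
  simp only [Measure.euclideanHausdorffMeasure_def, Measure.smul_apply, ENNReal.smul_def,
    smul_eq_mul]
  rw [mul_left_comm]
  gcongr
  simpa using hle

namespace LocalChart

variable {Q : E3} (c : LocalChart Ω Q)

/-- The area density of a chart. -/
def area (z : E2) : ℝ := (fderiv ℝ c.G z : E2 →ₗ[ℝ] E3).normDet

theorem area_pos (z : E2) : 0 < c.area z := c.normDet_pos z

theorem measure_fderiv_image (z : E2) (B : Set E2) :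
    Measure.euclideanHausdorffMeasure 2 (fderiv ℝ c.G z '' B) =
      ENNReal.ofReal (c.area z) * volume B := by
  have h := LinearMap.euclideanHausdorffMeasure_image_eq_normDet_mul_volume
    (fderiv ℝ c.G z).toLinearMap B
  rw [finrank_euclideanSpace, Fintype.card_fin] at h
  exact h

/-- Strict differentiability gives `|G x - G y - A(x - y)| ≤ δ|x - y|` near `z`, where `A` is the
derivative at `z`, and `|x - y| ≤ |A(x - y)|`. So `G` and `A` distort distances relative to each
other by at most `1 ± δ`, and two-dimensional measures by the square. -/
theorem exists_image_bounds (z : E2) {δ : ℝ} (hδ : 0 < δ) (hδ1 : δ < 1) :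
    ∃ r₀ > 0, ∀ B ⊆ Metric.closedBall z r₀,
      ENNReal.ofReal ((1 - δ) ^ 2 * c.area z) * volume B ≤
        Measure.euclideanHausdorffMeasure 2 (c.G '' B) ∧
      Measure.euclideanHausdorffMeasure 2 (c.G '' B) ≤
        ENNReal.ofReal ((1 + δ) ^ 2 * c.area z) * volume B := by
  have hs : HasStrictFDerivAt c.G (fderiv ℝ c.G z) z :=
    c.contDiff_G.contDiffAt.hasStrictFDerivAt (by norm_num)
  obtain ⟨s, hs, happ⟩ := hs.approximates_deriv_on_nhds (c := ⟨δ, hδ.le⟩) (Or.inr hδ)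
  obtain ⟨r₀, hr₀, hball⟩ := Metric.nhds_basis_closedBall.mem_iff.mp hs
  refine ⟨r₀, hr₀, fun B hB => ?_⟩
  set A := fderiv ℝ c.G z
  have hd : ∀ x ∈ B, ∀ y ∈ B, ‖c.G x - c.G y - A (x - y)‖ ≤ δ * ‖A (x - y)‖ := by
    intro x hx y hy
    have h := happ x (hball (hB hx)) y (hball (hB hy))
    refine h.trans ?_
    have := c.norm_le_norm_fderiv z (x - y)
    change δ * ‖x - y‖ ≤ _
    gcongr
  have h1 := euclideanHausdorffMeasure_image_le_of_edist_le c.G A B ⟨1 + δ, by positivity⟩ (by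
    intro x hx y hy
    rw [edist_dist, edist_dist, dist_eq_norm, dist_eq_norm, ← map_sub]
    have h := hd x hx y hy
    have h2 : ‖c.G x - c.G y‖ ≤ (1 + δ) * ‖A (x - y)‖ := by
      have := norm_add_le (c.G x - c.G y - A (x - y)) (A (x - y))
      rw [sub_add_cancel] at this
      linarith
    refine (ENNReal.ofReal_le_ofReal h2).trans (le_of_eq ?_)
    rw [ENNReal.ofReal_mul (by positivity)]
    congr 1
    exact ENNReal.ofReal_eq_coe_nnreal _)
  have h1δ : 0 < 1 - δ := by linarith
  have h2 := euclideanHausdorffMeasure_image_le_of_edist_le A c.G B ⟨(1 - δ)⁻¹, by positivity⟩ (by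
    intro x hx y hy
    rw [edist_dist, edist_dist, dist_eq_norm, dist_eq_norm, ← map_sub]
    have h := hd x hx y hy
    have h2 : ‖A (x - y)‖ ≤ (1 - δ)⁻¹ * ‖c.G x - c.G y‖ := by
      have := norm_sub_norm_le (A (x - y)) (A (x - y) - (c.G x - c.G y))
      rw [sub_sub_cancel, norm_sub_rev] at this
      rw [inv_mul_eq_div, le_div_iff₀ h1δ]
      linarith
    refine (ENNReal.ofReal_le_ofReal h2).trans (le_of_eq ?_)
    rw [ENNReal.ofReal_mul (by positivity)]
    congr 1
    exact ENNReal.ofReal_eq_coe_nnreal _)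
  rw [c.measure_fderiv_image z B] at h1 h2
  have hk : ∀ (k : ℝ) (hk : 0 ≤ k), ENNReal.ofNNReal ⟨k, hk⟩ = ENNReal.ofReal k :=
    fun k hk => (ENNReal.ofReal_eq_coe_nnreal hk).symm
  rw [hk] at h1 h2
  constructor
  · rw [ENNReal.ofReal_mul (by positivity), mul_assoc]
    refine (mul_le_mul_right h2 _).trans (le_of_eq ?_)
    rw [← mul_assoc, ← ENNReal.ofReal_pow (by positivity), ← ENNReal.ofReal_mul (by positivity),
      ← mul_pow, mul_inv_cancel₀ h1δ.ne']
    simp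
  · rw [ENNReal.ofReal_mul (by positivity), mul_assoc, ENNReal.ofReal_pow (by positivity)]
    exact h1

theorem measurableEmbedding_G : MeasurableEmbedding c.G :=
  c.contDiff_G.continuous.measurableEmbedding fun x y h => by rw [← c.π_G x, h, c.π_G]

/-- The area formula for the chart. The pulled-back Hausdorff measure is locally finite and
absolutely continuous. By Besicovitch differentiation its density is a limit of ratios on small
balls, which the image bounds squeeze between `(1 ± δ)²` times the area density. -/
theorem map_G_withDensity :
    (volume.withDensity fun z => ENNReal.ofReal (c.area z)).map c.G =
      (Measure.euclideanHausdorffMeasure 2).restrict (range c.G) := by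
  rw [← c.measurableEmbedding_G.map_comap]
  congr 1
  set ρ : Measure E2 := (Measure.euclideanHausdorffMeasure 2).comap c.G with hρ
  have hρa : ∀ B, ρ B = Measure.euclideanHausdorffMeasure 2 (c.G '' B) :=
    fun B => c.measurableEmbedding_G.comap_apply _ _
  have hloc : IsLocallyFiniteMeasure ρ := by
    refine ⟨fun z => ?_⟩
    obtain ⟨r₀, hr₀, h⟩ := c.exists_image_bounds z (δ := 1 / 2) (by norm_num) (by norm_num)
    refine ⟨Metric.closedBall z r₀, Metric.closedBall_mem_nhds z hr₀, ?_⟩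
    rw [hρa]
    exact (h _ subset_rfl).2.trans_lt (ENNReal.mul_lt_top ENNReal.ofReal_lt_top
      measure_closedBall_lt_top)
  have hac : ρ ≪ volume := by
    intro N hN
    refine measure_null_of_locally_null N fun z _ => ?_
    obtain ⟨r₀, hr₀, h⟩ := c.exists_image_bounds z (δ := 1 / 2) (by norm_num) (by norm_num)
    refine ⟨N ∩ Metric.closedBall z r₀,
      inter_mem_nhdsWithin N (Metric.closedBall_mem_nhds z hr₀), ?_⟩
    rw [hρa]
    have h1 := (h (N ∩ Metric.closedBall z r₀) inter_subset_right).2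
    rw [measure_mono_null inter_subset_left hN, mul_zero] at h1
    exact nonpos_iff_eq_zero.mp h1
  rw [← Measure.withDensity_rnDeriv_eq ρ volume hac]
  refine withDensity_congr_ae ?_
  filter_upwards [Besicovitch.ae_tendsto_rnDeriv ρ (volume : Measure E2)] with z hz
  have hlim : ∀ (s : ℝ), Tendsto (fun δ : ℝ => ENNReal.ofReal ((1 + s * δ) ^ 2 * c.area z)) (𝓝[>] 0)
      (𝓝 (ENNReal.ofReal (c.area z))) := by
    intro s
    have hc : Continuous fun δ : ℝ => ENNReal.ofReal ((1 + s * δ) ^ 2 * c.area z) :=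
      ENNReal.continuous_ofReal.comp (by fun_prop)
    simpa using (hc.tendsto 0).mono_left (nhdsWithin_le_nhds (s := Ioi 0))
  have hq : ∀ δ : ℝ, 0 < δ → δ < 1 → ∀ᶠ r in 𝓝[>] (0 : ℝ),
      ENNReal.ofReal ((1 - δ) ^ 2 * c.area z) ≤
        ρ (Metric.closedBall z r) / volume (Metric.closedBall z r) ∧
      ρ (Metric.closedBall z r) / volume (Metric.closedBall z r) ≤
        ENNReal.ofReal ((1 + δ) ^ 2 * c.area z) := by
    intro δ hδ hδ1
    obtain ⟨r₀, hr₀, h⟩ := c.exists_image_bounds z hδ hδ1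
    filter_upwards [Ioc_mem_nhdsGT hr₀] with r hr
    have hb := h _ (Metric.closedBall_subset_closedBall hr.2)
    have hv0 : volume (Metric.closedBall z r) ≠ 0 := (Metric.measure_closedBall_pos _ z hr.1).ne'
    have hvt : volume (Metric.closedBall z r) ≠ ∞ := measure_closedBall_lt_top.ne
    rw [← hρa] at hb
    rw [ENNReal.le_div_iff_mul_le (Or.inl hv0) (Or.inl hvt),
      ENNReal.div_le_iff_le_mul (Or.inl hv0) (Or.inl hvt)]
    exact hb
  have hone : ∀ᶠ δ : ℝ in 𝓝[>] 0, 0 < δ ∧ δ < 1 := Ioo_mem_nhdsGT one_pos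
  refine le_antisymm ?_ ?_
  · refine le_of_tendsto (by simpa [sub_eq_add_neg] using hlim (-1)) ?_
    filter_upwards [hone] with δ hδ
    exact ge_of_tendsto hz ((hq δ hδ.1 hδ.2).mono fun r h => h.1)
  · refine ge_of_tendsto (by simpa using hlim 1) ?_
    filter_upwards [hone] with δ hδ
    exact le_of_tendsto hz ((hq δ hδ.1 hδ.2).mono fun r h => h.2)

theorem continuous_area : Continuous c.area := by
  have h : c.area = fun z => |c.tubeDet (z, 0)| := funext fun z => (c.abs_tubeDet_zero z).symm
  rw [h]
  exact (c.continuous_tubeDet.comp (continuous_id.prodMk continuous_const)).abs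

end LocalChart

theorem IsC2Domain.isFiniteMeasure_surfaceMeasure (hΩ : IsC2Domain Ω) :
    IsFiniteMeasure (surfaceMeasure Ω) := by
  refine ⟨?_⟩
  rw [surfaceMeasure, Measure.restrict_apply_univ]
  refine hΩ.isCompact_frontier.measure_lt_top_of_nhdsWithin fun x hx => ?_
  obtain ⟨c⟩ := nonempty_localChart hΩ hx
  obtain ⟨r₀, hr₀, h⟩ := c.exists_image_bounds (c.π x) (δ := 1 / 2) (by norm_num) (by norm_num)
  refine ⟨c.G '' Metric.closedBall (c.π x) r₀, ?_, ?_⟩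
  · have h1 : ∀ᶠ y in 𝓝 x, c.π y ∈ Metric.closedBall (c.π x) r₀ :=
      c.contDiff_π.continuous.continuousAt.eventually (Metric.closedBall_mem_nhds _ hr₀)
    filter_upwards [self_mem_nhdsWithin, mem_nhdsWithin_of_mem_nhds h1,
      mem_nhdsWithin_of_mem_nhds (Metric.ball_mem_nhds x c.r_pos)] with y hy h1 h2
    exact ⟨c.π y, h1, (c.mem_iff y h2).mp hy⟩
  · exact (h _ subset_rfl).2.trans_lt (ENNReal.mul_lt_top ENNReal.ofReal_lt_top
      measure_closedBall_lt_top)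

end DiracShell

end

noncomputable section

namespace DiracShell

/-! ### Change of variables -/

variable {Ω : Set E3}

/-- Splitting off the last coordinate. -/
def splitLast (y : E3) : E2 × ℝ := (horiz y, y 2)

theorem measurePreserving_splitLast : MeasurePreserving splitLast volume volume := by
  have h1 : MeasurePreserving (WithLp.ofLp : E3 → (Fin 3 → ℝ)) := PiLp.volume_preserving_ofLp (Fin 3)
  have h2 := volume_preserving_piFinSuccAbove (fun _ : Fin 3 => ℝ) 2
  have h3 : MeasurePreserving (WithLp.toLp 2 : (Fin 2 → ℝ) → E2) := PiLp.volume_preserving_toLp (Fin 2)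
  have h4 : MeasurePreserving (Prod.swap : ℝ × (Fin 2 → ℝ) → (Fin 2 → ℝ) × ℝ) :=
    Measure.measurePreserving_swap
  have h5 : MeasurePreserving (Prod.map (WithLp.toLp 2 : (Fin 2 → ℝ) → E2) (id : ℝ → ℝ)) :=
    h3.prod (MeasurePreserving.id volume)
  have h := h5.comp (h4.comp (h2.comp h1))
  convert! h using 1
  funext y
  refine Prod.ext ?_ rfl
  ext i
  fin_cases i <;> rfl

theorem measurableEmbedding_splitLast : MeasurableEmbedding splitLast := by
  refine Continuous.measurableEmbedding ?_ fun x y h => ?_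
  · exact horiz.continuous.prodMk (EuclideanSpace.proj (𝕜 := ℝ) (2 : Fin 3)).continuous
  · rw [← horizIncl_horiz_add x, ← horizIncl_horiz_add y]
    have h1 : horiz x = horiz y := congrArg Prod.fst h
    have h2 : x 2 = y 2 := congrArg Prod.snd h
    rw [h1, h2]

theorem splitLast_add (z : E2) (t : ℝ) : splitLast (horizIncl z + t • basisE 2) = (z, t) := by
  refine Prod.ext (horiz_horizIncl_add z t) ?_
  simp [splitLast, horizIncl_apply]

theorem IsC2Domain.continuousOn_tube (hΩ : IsC2Domain Ω) :
    ContinuousOn (tube Ω) (frontier Ω ×ˢ univ) :=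
  continuousOn_fst.add (continuousOn_snd.smul
    (hΩ.continuousOn_normal.comp continuousOn_fst fun _ hp => hp.1))

theorem measurableSet_collar (ε : ℝ) : MeasurableSet (collar Ω ε) :=
  isClosed_frontier.measurableSet.prod measurableSet_Ioo

theorem collar_subset (ε : ℝ) : collar Ω ε ⊆ frontier Ω ×ˢ univ :=
  prod_mono subset_rfl (subset_univ _)

theorem measurableSet_tube_image (hΩ : IsC2Domain Ω) {ε : ℝ} (hinj : InjOn (tube Ω) (collar Ω ε))
    {s : Set (E3 × ℝ)} (hs : MeasurableSet s) (hsub : s ⊆ collar Ω ε) :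
    MeasurableSet (tube Ω '' s) :=
  hs.image_of_continuousOn_injOn (hΩ.continuousOn_tube.mono (hsub.trans (collar_subset ε)))
    (hinj.mono hsub)

namespace LocalChart

variable {Q : E3} (c : LocalChart Ω Q)

/-- Tubular coordinates in a chart. -/
def tubeParam (y : E3) : E3 := c.G (horiz y) + y 2 • c.n (horiz y)

theorem hasFDerivAt_tubeParam (y : E3) :
    HasFDerivAt c.tubeParam (c.tubeDeriv (horiz y) (y 2)) y := by
  have h1 := (c.hasFDerivAt_G (horiz y)).comp y horiz.hasFDerivAt
  have h2 := (c.hasFDerivAt_n (horiz y)).comp y horiz.hasFDerivAt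
  have h3 : HasFDerivAt (fun y : E3 => y 2) (EuclideanSpace.proj (𝕜 := ℝ) (2 : Fin 3)) y :=
    (EuclideanSpace.proj (𝕜 := ℝ) (2 : Fin 3)).hasFDerivAt
  refine (h1.add (h3.smul h2)).congr_fderiv ?_
  ext1 v
  rw [tubeDeriv_apply]
  simp only [_root_.add_apply, _root_.smul_apply, ContinuousLinearMap.comp_apply,
    ContinuousLinearMap.smulRight_apply, Function.comp_apply]
  rw [add_assoc]
  rfl

/-- In the chart the product measure has density `area z`, and `area · jac = |tubeDet|` is the
Jacobian of `tubeParam`; the ordinary change of variables in space applies. `F` is arbitrary: the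
density and change-of-variables lemmas used require no measurability of it. -/
theorem lintegral_tube [IsFiniteMeasure (surfaceMeasure Ω)] {ε : ℝ}
    (hinj : InjOn (tube Ω) (collar Ω ε))
    (hpos : ∀ x ∈ frontier Ω, ∀ t ∈ Ioo (-ε) ε, 0 ≤ jac Ω t x) {E : Set E3} (hE : MeasurableSet E)
    (hEf : E ⊆ frontier Ω) (hEb : E ⊆ Metric.ball Q c.r) (F : E3 → ℝ≥0∞) :
    ∫⁻ p in E ×ˢ Ioo (-ε) ε, ENNReal.ofReal (jac Ω p.2 p.1) * F (tube Ω p)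
      ∂((surfaceMeasure Ω).prod volume) = ∫⁻ y in tube Ω '' (E ×ˢ Ioo (-ε) ε), F y := by
  set I := Ioo (-ε) ε with hI
  set D : Set E2 := c.G ⁻¹' E with hD
  have hDm : MeasurableSet D := c.contDiff_G.continuous.measurable hE
  have hGD : c.G '' D = E := by
    rw [hD, image_preimage_eq_iff]
    intro y hy
    exact ⟨c.π y, (c.mem_iff y (hEb hy)).mp (hEf hy)⟩
  have hnD : ∀ z ∈ D, normal Ω (c.G z) = c.n z := fun z hz => c.normal_G (hEb hz)
  set a : E2 → ℝ≥0∞ := fun z => ENNReal.ofReal (c.area z) with ha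
  have ham : Measurable a := c.continuous_area.measurable.ennreal_ofReal
  set em : E2 × ℝ → E3 × ℝ := Prod.map c.G id with hem
  have hemb : MeasurableEmbedding em := by
    refine (c.contDiff_G.continuous.prodMap continuous_id).measurableEmbedding ?_
    exact (c.measurableEmbedding_G.injective).prodMap Function.injective_id
  have hσ : (surfaceMeasure Ω).restrict E = ((volume.withDensity a).restrict D).map c.G := by
    rw [hD, ← c.measurableEmbedding_G.restrict_map, c.map_G_withDensity,
      Measure.restrict_restrict hE, surfaceMeasure, Measure.restrict_restrict hE,
      inter_eq_left.mpr hEf, inter_eq_left.mpr]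
    rw [← hGD]; exact image_subset_range _ _
  have hfin : IsFiniteMeasure ((volume.withDensity a).restrict D) := by
    refine ⟨?_⟩
    have h1 : ((volume.withDensity a).restrict D) univ = (surfaceMeasure Ω).restrict E univ := by
      rw [hσ, Measure.map_apply c.contDiff_G.continuous.measurable MeasurableSet.univ, preimage_univ]
    rw [h1]
    exact measure_lt_top _ _
  have hprod : ((surfaceMeasure Ω).prod volume).restrict (E ×ˢ I) =
      (((volume.withDensity a).restrict D).prod (volume.restrict I)).map em := by
    rw [← Measure.prod_restrict, hσ, hem, ← Measure.map_prod_map _ _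
      c.contDiff_G.continuous.measurable measurable_id, Measure.map_id]
  have hwd : ((volume.withDensity a).restrict D).prod (volume.restrict I) =
      ((volume : Measure (E2 × ℝ)).restrict (D ×ˢ I)).withDensity fun p => a p.1 := by
    rw [restrict_withDensity hDm, Measure.volume_eq_prod, ← Measure.prod_restrict,
      prod_withDensity_left ham]
  have ham2 : Measurable fun p : E2 × ℝ => a p.1 := ham.comp measurable_fst
  rw [hprod, hemb.lintegral_map, hwd, lintegral_withDensity_eq_lintegral_mul_non_measurable _
    ham2 (ae_of_all _ fun p => ENNReal.ofReal_lt_top)]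
  have hpt : ∀ p ∈ D ×ˢ I, ((fun p : E2 × ℝ => a p.1) *
      fun p => ENNReal.ofReal (jac Ω (em p).2 (em p).1) * F (tube Ω (em p))) p =
      ENNReal.ofReal |c.tubeDet p| * F (c.G p.1 + p.2 • c.n p.1) := by
    rintro ⟨z, t⟩ ⟨hz, ht⟩
    have hzb : c.G z ∈ Metric.ball Q c.r := hEb hz
    simp only [Pi.mul_apply, hem, Prod.map, id]
    rw [← mul_assoc, ha, ← ENNReal.ofReal_mul (c.area_pos z).le, c.tubeDet_eq hzb, abs_mul,
      c.abs_tubeDet_zero, abs_of_nonneg (hpos _ (hEf hz) t ht), mul_comm (jac Ω t (c.G z)), tube,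
      hnD z hz]
    rfl
  rw [setLIntegral_congr_fun (hDm.prod measurableSet_Ioo) hpt,
    ← measurePreserving_splitLast.setLIntegral_comp_preimage_emb measurableEmbedding_splitLast]
  have himg : c.tubeParam '' (splitLast ⁻¹' (D ×ˢ I)) = tube Ω '' (E ×ˢ I) := by
    ext y
    constructor
    · rintro ⟨w, ⟨hw1, hw2⟩, rfl⟩
      have hw : horiz w ∈ D := hw1
      exact ⟨(c.G (horiz w), w 2), ⟨hw, hw2⟩, by simp only [tube, hnD _ hw]; rfl⟩
    · rintro ⟨⟨x, t⟩, ⟨hx, ht⟩, rfl⟩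
      rw [← hGD] at hx
      obtain ⟨z, hz, rfl⟩ := hx
      refine ⟨horizIncl z + t • basisE 2, ?_, ?_⟩
      · rw [mem_preimage, splitLast_add]; exact ⟨hz, ht⟩
      · have h := splitLast_add z t
        have h1 : horiz (horizIncl z + t • basisE 2) = z := congrArg Prod.fst h
        have h2 : (horizIncl z + t • basisE 2) 2 = t := congrArg Prod.snd h
        rw [tubeParam, h1, h2, tube, hnD z hz]
  have hinj' : InjOn c.tubeParam (splitLast ⁻¹' (D ×ˢ I)) := by
    rintro w ⟨hw1, hw2⟩ w' ⟨hw1', hw2'⟩ hww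
    have e : ∀ v : E3, horiz v ∈ D → c.tubeParam v = tube Ω (c.G (horiz v), v 2) :=
      fun v hv => by simp only [tube, hnD _ hv]; rfl
    rw [e w hw1, e w' hw1'] at hww
    have hm : (c.G (horiz w), w 2) ∈ collar Ω ε := ⟨hEf (show c.G (horiz w) ∈ E from hw1), hw2⟩
    have hm' : (c.G (horiz w'), w' 2) ∈ collar Ω ε :=
      ⟨hEf (show c.G (horiz w') ∈ E from hw1'), hw2'⟩
    have h := hinj hm hm' hww
    have h1 : horiz w = horiz w' := c.measurableEmbedding_G.injective (congrArg Prod.fst h)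
    have h2 : w 2 = w' 2 := congrArg Prod.snd h
    exact measurableEmbedding_splitLast.injective (Prod.ext h1 h2)
  rw [← himg, lintegral_image_eq_lintegral_abs_det_fderiv_mul volume
    (measurableEmbedding_splitLast.measurable (hDm.prod measurableSet_Ioo))
    (fun y _ => (c.hasFDerivAt_tubeParam y).hasFDerivWithinAt) hinj']
  rfl

end LocalChart

theorem lintegral_tube (hΩ : IsC2Domain Ω) {ε : ℝ} (hinj : InjOn (tube Ω) (collar Ω ε))
    (hpos : ∀ x ∈ frontier Ω, ∀ t ∈ Ioo (-ε) ε, 0 ≤ jac Ω t x) (F : E3 → ℝ≥0∞) :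
    ∫⁻ p, ENNReal.ofReal (jac Ω p.2 p.1) * F (tube Ω p) ∂(cylMeasure Ω ε) =
      ∫⁻ y in shell Ω ε, F y := by
  have := hΩ.isFiniteMeasure_surfaceMeasure
  have hfm : MeasurableSet (frontier Ω) := isClosed_frontier.measurableSet
  have hloc : ∃ s', MeasurableSet s' ∧ frontier Ω ⊆ s' ∧ ∀ E, MeasurableSet E → E ⊆ s' →
      E ⊆ frontier Ω → ∫⁻ p in E ×ˢ Ioo (-ε) ε, ENNReal.ofReal (jac Ω p.2 p.1) * F (tube Ω p)
        ∂((surfaceMeasure Ω).prod volume) = ∫⁻ y in tube Ω '' (E ×ˢ Ioo (-ε) ε), F y := by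
    refine hΩ.isCompact_frontier.induction_on (p := fun s => ∃ s', MeasurableSet s' ∧ s ⊆ s' ∧
      ∀ E, MeasurableSet E → E ⊆ s' → E ⊆ frontier Ω →
      ∫⁻ p in E ×ˢ Ioo (-ε) ε, ENNReal.ofReal (jac Ω p.2 p.1) * F (tube Ω p)
        ∂((surfaceMeasure Ω).prod volume) = ∫⁻ y in tube Ω '' (E ×ˢ Ioo (-ε) ε), F y)
      ?_ ?_ ?_ ?_
    · refine ⟨∅, MeasurableSet.empty, subset_rfl, fun E _ hE _ => ?_⟩
      rw [subset_empty_iff.mp hE]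
      simp
    · rintro s t hst ⟨s', h1, h2, h3⟩
      exact ⟨s', h1, hst.trans h2, h3⟩
    · rintro s t ⟨s', hs1, hs2, hs3⟩ ⟨t', ht1, ht2, ht3⟩
      -- Splitting `E` into `E ∩ s'` and `E \ s'` makes the pieces disjoint, and injectivity on the
      -- whole collar keeps their images disjoint, so the two formulas add.
      refine ⟨s' ∪ t', hs1.union ht1, union_subset_union hs2 ht2, fun E hE hEs hEf => ?_⟩
      have h1 := hs3 (E ∩ s') (hE.inter hs1) inter_subset_right (inter_subset_left.trans hEf)
      have h2 := ht3 (E \ s') (hE.diff hs1) (fun x hx => (hEs hx.1).resolve_left hx.2)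
        (sdiff_subset.trans hEf)
      have hEq : E ×ˢ Ioo (-ε) ε = (E ∩ s') ×ˢ Ioo (-ε) ε ∪ (E \ s') ×ˢ Ioo (-ε) ε := by
        rw [← union_prod, inter_union_sdiff]
      have hdisj : Disjoint ((E ∩ s') ×ˢ Ioo (-ε) ε) ((E \ s') ×ˢ Ioo (-ε) ε) :=
        disjoint_left.mpr fun p hp hp' => hp'.1.2 hp.1.2
      have hsub1 : (E ∩ s') ×ˢ Ioo (-ε) ε ⊆ collar Ω ε :=
        prod_mono (inter_subset_left.trans hEf) subset_rfl
      have hsub2 : (E \ s') ×ˢ Ioo (-ε) ε ⊆ collar Ω ε :=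
        prod_mono (sdiff_subset.trans hEf) subset_rfl
      have hm2 : MeasurableSet ((E \ s') ×ˢ Ioo (-ε) ε) := (hE.diff hs1).prod measurableSet_Ioo
      have hdisj' : Disjoint (tube Ω '' ((E ∩ s') ×ˢ Ioo (-ε) ε))
          (tube Ω '' ((E \ s') ×ˢ Ioo (-ε) ε)) := by
        rw [disjoint_left]
        rintro _ ⟨p, hp, rfl⟩ ⟨q, hq, hpq⟩
        rw [hinj (hsub2 hq) (hsub1 hp) hpq] at hq
        exact disjoint_left.mp hdisj hp hq
      rw [hEq, image_union, lintegral_union hm2 hdisj,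
        lintegral_union (measurableSet_tube_image hΩ hinj hm2 hsub2) hdisj', h1, h2]
    · intro x hx
      obtain ⟨c⟩ := nonempty_localChart hΩ hx
      exact ⟨Metric.ball x c.r, mem_nhdsWithin_of_mem_nhds (Metric.ball_mem_nhds x c.r_pos),
        Metric.ball x c.r, Metric.isOpen_ball.measurableSet, subset_rfl,
        fun E hE hEb hEf => c.lintegral_tube hinj hpos hE hEf hEb F⟩
  obtain ⟨s', -, hs, h⟩ := hloc
  have h1 := h _ hfm hs subset_rfl
  have h2 : tube Ω '' (frontier Ω ×ˢ Ioo (-ε) ε) = shell Ω ε :=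
    subset_antisymm (image_subset_iff.mpr fun p hp => tube_mem_shell hΩ hp) (tube_surjOn hΩ ε)
  rw [h2, ← Measure.prod_restrict] at h1
  rw [cylMeasure, ← h1]
  congr 2
  rw [surfaceMeasure, Measure.restrict_restrict hfm, inter_self]

end DiracShell

end

noncomputable section

namespace DiracShell

/-! ### Tubular coordinates as maps of measure spaces -/

/-- Tubular coordinates are injective on the collar of width `ε`, with Jacobian in `[1/2, 2]`. -/
structure IsTubular (Ω : Set E3) (ε : ℝ) : Prop where
  domain : IsC2Domain Ω
  pos : 0 < ε
  injOn : InjOn (tube Ω) (collar Ω ε)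
  le_jac : ∀ p ∈ collar Ω ε, 1 / 2 ≤ jac Ω p.2 p.1
  jac_le : ∀ p ∈ collar Ω ε, jac Ω p.2 p.1 ≤ 2

/-- The inverse of the tubular coordinates. -/
def tubeInv (Ω : Set E3) (ε : ℝ) : E3 → E3 × ℝ := Function.invFunOn (tube Ω) (collar Ω ε)

theorem cylMeasure_eq_restrict (Ω : Set E3) [SFinite (surfaceMeasure Ω)] (ε : ℝ) :
    cylMeasure Ω ε = ((surfaceMeasure Ω).prod volume).restrict (collar Ω ε) := by
  rw [collar, ← Measure.prod_restrict, cylMeasure]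
  congr 1
  rw [surfaceMeasure, Measure.restrict_restrict isClosed_frontier.measurableSet, inter_self]

theorem measurableSet_shell (Ω : Set E3) (ε : ℝ) : MeasurableSet (shell Ω ε) :=
  Metric.isOpen_thickening.measurableSet

namespace IsTubular

variable {Ω : Set E3} {ε : ℝ}

theorem bijOn (h : IsTubular Ω ε) : BijOn (tube Ω) (collar Ω ε) (shell Ω ε) :=
  ⟨fun _ hp => tube_mem_shell h.domain hp, h.injOn, tube_surjOn h.domain ε⟩

theorem tubeInv_tube (h : IsTubular Ω ε) {p : E3 × ℝ} (hp : p ∈ collar Ω ε) :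
    tubeInv Ω ε (tube Ω p) = p :=
  h.injOn.leftInvOn_invFunOn hp

theorem tubeInv_mem (h : IsTubular Ω ε) {y : E3} (hy : y ∈ shell Ω ε) :
    tubeInv Ω ε y ∈ collar Ω ε :=
  h.bijOn.surjOn.mapsTo_invFunOn hy

theorem tube_tubeInv (h : IsTubular Ω ε) {y : E3} (hy : y ∈ shell Ω ε) :
    tube Ω (tubeInv Ω ε y) = y :=
  h.bijOn.surjOn.rightInvOn_invFunOn hy

theorem isFiniteMeasure (h : IsTubular Ω ε) : IsFiniteMeasure (surfaceMeasure Ω) :=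
  h.domain.isFiniteMeasure_surfaceMeasure

theorem ae_mem_collar (h : IsTubular Ω ε) : ∀ᵐ p ∂(cylMeasure Ω ε), p ∈ collar Ω ε := by
  have := h.isFiniteMeasure
  rw [cylMeasure_eq_restrict]
  exact ae_restrict_mem (measurableSet_collar ε)

theorem aemeasurable_tube (h : IsTubular Ω ε) : AEMeasurable (tube Ω) (cylMeasure Ω ε) := by
  have := h.isFiniteMeasure
  rw [cylMeasure_eq_restrict]
  exact (h.domain.continuousOn_tube.mono (collar_subset ε)).aemeasurable (measurableSet_collar ε)

theorem aemeasurable_jac (h : IsTubular Ω ε) :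
    AEMeasurable (fun p : E3 × ℝ => jac Ω p.2 p.1) (cylMeasure Ω ε) := by
  have := h.isFiniteMeasure
  rw [cylMeasure_eq_restrict]
  exact (h.domain.continuousOn_jac.mono (collar_subset ε)).aemeasurable (measurableSet_collar ε)

theorem lintegral_tube (h : IsTubular Ω ε) (F : E3 → ℝ≥0∞) :
    ∫⁻ p, ENNReal.ofReal (jac Ω p.2 p.1) * F (tube Ω p) ∂(cylMeasure Ω ε) =
      ∫⁻ y in shell Ω ε, F y :=
  DiracShell.lintegral_tube h.domain h.injOn
    (fun x hx t ht => le_trans (by norm_num) (h.le_jac (x, t) ⟨hx, ht⟩)) F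

/-- The change of variables tested on indicator functions. With the bounds 1/2 and 2 on the
Jacobian, it makes `Σ × (-ε, ε)` and the shell comparable as measure spaces. -/
theorem map_tube_withDensity (h : IsTubular Ω ε) :
    ((cylMeasure Ω ε).withDensity fun p => ENNReal.ofReal (jac Ω p.2 p.1)).map (tube Ω) =
      volume.restrict (shell Ω ε) := by
  have hj := h.aemeasurable_jac.ennreal_ofReal
  have ht : AEMeasurable (tube Ω)
      ((cylMeasure Ω ε).withDensity fun p => ENNReal.ofReal (jac Ω p.2 p.1)) :=
    h.aemeasurable_tube.mono_ac (withDensity_absolutelyContinuous _ _)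
  ext s hs
  rw [← lintegral_indicator_one hs, ← lintegral_indicator_one hs,
    lintegral_map' (measurable_one.indicator hs).aemeasurable ht, ← h.lintegral_tube,
    lintegral_withDensity_eq_lintegral_mul₀' hj]
  · rfl
  · exact ((measurable_one.indicator hs).comp_aemeasurable ht)

theorem cylMeasure_le_withDensity (h : IsTubular Ω ε) : cylMeasure Ω ε ≤
    (2 : ℝ≥0∞) • (cylMeasure Ω ε).withDensity fun p => ENNReal.ofReal (jac Ω p.2 p.1) := by
  rw [← withDensity_smul' _ _ ENNReal.ofNat_ne_top]
  conv_lhs => rw [← withDensity_one (μ := cylMeasure Ω ε)]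
  refine withDensity_mono ?_
  filter_upwards [h.ae_mem_collar] with p hp
  have h1 : (1 : ℝ≥0∞) = 2 * ENNReal.ofReal (1 / 2) := by
    rw [← ENNReal.ofReal_ofNat 2, ← ENNReal.ofReal_mul (by norm_num)]
    norm_num
  simp only [Pi.one_apply, Pi.smul_apply, smul_eq_mul]
  rw [h1]
  gcongr
  exact h.le_jac p hp

theorem withDensity_le_cylMeasure (h : IsTubular Ω ε) :
    ((cylMeasure Ω ε).withDensity fun p => ENNReal.ofReal (jac Ω p.2 p.1)) ≤
      (2 : ℝ≥0∞) • cylMeasure Ω ε := by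
  rw [← withDensity_const]
  refine withDensity_mono ?_
  filter_upwards [h.ae_mem_collar] with p hp
  rw [← ENNReal.ofReal_ofNat 2]
  exact ENNReal.ofReal_le_ofReal (h.jac_le p hp)

theorem map_tube_le (h : IsTubular Ω ε) :
    (cylMeasure Ω ε).map (tube Ω) ≤ ENNReal.ofReal 2 • volume.restrict (shell Ω ε) := by
  have ht : AEMeasurable (tube Ω)
      ((cylMeasure Ω ε).withDensity fun p => ENNReal.ofReal (jac Ω p.2 p.1)) :=
    h.aemeasurable_tube.mono_ac (withDensity_absolutelyContinuous _ _)
  rw [← h.map_tube_withDensity, ENNReal.ofReal_ofNat, ← Measure.map_smul]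
  refine Measure.le_iff.mpr fun s hs => ?_
  rw [Measure.map_apply_of_aemeasurable h.aemeasurable_tube hs,
    Measure.map_apply_of_aemeasurable (ht.smul_measure _) hs]
  exact h.cylMeasure_le_withDensity _

theorem aemeasurable_tubeInv (h : IsTubular Ω ε) :
    AEMeasurable (tubeInv Ω ε) (volume.restrict (shell Ω ε)) := by
  refine aemeasurable_restrict_of_measurable_subtype (measurableSet_shell Ω ε) fun s hs => ?_
  -- Preimages under the inverse are images under `tube`, and these are Borel because `tube` is
  -- continuous and injective on the collar.
  have h1 : (fun y : shell Ω ε => tubeInv Ω ε y) ⁻¹' s =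
      Subtype.val ⁻¹' (tube Ω '' (s ∩ collar Ω ε)) := by
    ext ⟨y, hy⟩
    constructor
    · intro hys
      exact ⟨tubeInv Ω ε y, ⟨hys, h.tubeInv_mem hy⟩, h.tube_tubeInv hy⟩
    · rintro ⟨p, ⟨hps, hpc⟩, hpy⟩
      simp only [mem_preimage]
      rw [← show tube Ω p = y from hpy, h.tubeInv_tube hpc]
      exact hps
  rw [h1]
  exact measurable_subtype_coe (measurableSet_tube_image h.domain h.injOn
    (hs.inter (measurableSet_collar ε)) inter_subset_right)

/-- The change of variables is applied to an indicator composed with `tubeInv`, whose values outside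
the shell do not matter. -/
theorem map_tubeInv (h : IsTubular Ω ε) : (volume.restrict (shell Ω ε)).map (tubeInv Ω ε) =
    (cylMeasure Ω ε).withDensity fun p => ENNReal.ofReal (jac Ω p.2 p.1) := by
  ext s hs
  have hi : Measurable (s.indicator (1 : E3 × ℝ → ℝ≥0∞)) := measurable_one.indicator hs
  rw [← lintegral_indicator_one hs, ← lintegral_indicator_one hs,
    lintegral_map' hi.aemeasurable h.aemeasurable_tubeInv,
    ← h.lintegral_tube fun y => s.indicator 1 (tubeInv Ω ε y),
    lintegral_withDensity_eq_lintegral_mul₀' h.aemeasurable_jac.ennreal_ofReal hi.aemeasurable]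
  refine lintegral_congr_ae ?_
  filter_upwards [h.ae_mem_collar] with p hp
  rw [h.tubeInv_tube hp]
  rfl

theorem map_tubeInv_le (h : IsTubular Ω ε) : (volume.restrict (shell Ω ε)).map (tubeInv Ω ε) ≤
    ENNReal.ofReal 2 • cylMeasure Ω ε := by
  rw [h.map_tubeInv, ENNReal.ofReal_ofNat]
  exact h.withDensity_le_cylMeasure

theorem ae_tube (h : IsTubular Ω ε) {P : E3 → Prop} (hP : ∀ᵐ y ∂(volume.restrict (shell Ω ε)), P y) :
    ∀ᵐ p ∂(cylMeasure Ω ε), P (tube Ω p) := by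
  refine ae_of_ae_map h.aemeasurable_tube ?_
  exact (Measure.absolutelyContinuous_of_le_smul h.map_tube_le) hP

theorem ae_tubeInv (h : IsTubular Ω ε) {P : E3 × ℝ → Prop} (hP : ∀ᵐ p ∂(cylMeasure Ω ε), P p) :
    ∀ᵐ y ∂(volume.restrict (shell Ω ε)), P (tubeInv Ω ε y) := by
  refine ae_of_ae_map h.aemeasurable_tubeInv ?_
  exact (Measure.absolutelyContinuous_of_le_smul h.map_tubeInv_le) hP

variable {E : Type*} [NormedAddCommGroup E] [NormedSpace ℝ E]

theorem integrable_tube_iff (h : IsTubular Ω ε) {F : E3 → E}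
    (hF : AEStronglyMeasurable F (volume.restrict (shell Ω ε))) :
    Integrable (fun p : E3 × ℝ => jac Ω p.2 p.1 • F (tube Ω p)) (cylMeasure Ω ε) ↔
      IntegrableOn F (shell Ω ε) := by
  have ht : AEMeasurable (tube Ω)
      ((cylMeasure Ω ε).withDensity fun p => ENNReal.ofReal (jac Ω p.2 p.1)) :=
    h.aemeasurable_tube.mono_ac (withDensity_absolutelyContinuous _ _)
  rw [IntegrableOn, ← h.map_tube_withDensity, integrable_map_measure _ ht,
    integrable_withDensity_iff_integrable_smul₀' h.aemeasurable_jac.ennreal_ofReal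
      (ae_of_all _ fun _ => ENNReal.ofReal_lt_top)]
  · refine integrable_congr ?_
    filter_upwards [h.ae_mem_collar] with p hp
    rw [ENNReal.toReal_ofReal (le_trans (by norm_num) (h.le_jac p hp))]
    rfl
  · rw [h.map_tube_withDensity]; exact hF

theorem integral_tube (h : IsTubular Ω ε) {F : E3 → E}
    (hF : AEStronglyMeasurable F (volume.restrict (shell Ω ε))) :
    ∫ p, jac Ω p.2 p.1 • F (tube Ω p) ∂(cylMeasure Ω ε) = ∫ y in shell Ω ε, F y := by
  have ht : AEMeasurable (tube Ω)
      ((cylMeasure Ω ε).withDensity fun p => ENNReal.ofReal (jac Ω p.2 p.1)) :=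
    h.aemeasurable_tube.mono_ac (withDensity_absolutelyContinuous _ _)
  rw [← h.map_tube_withDensity, integral_map ht,
    integral_withDensity_eq_integral_toReal_smul₀ h.aemeasurable_jac.ennreal_ofReal
      (ae_of_all _ fun _ => ENNReal.ofReal_lt_top)]
  · refine integral_congr_ae ?_
    filter_upwards [h.ae_mem_collar] with p hp
    rw [ENNReal.toReal_ofReal (le_trans (by norm_num) (h.le_jac p hp))]
  · rw [h.map_tube_withDensity]; exact hF

end IsTubular

/-! ### Scaling of the collar -/

/-- The map `(x, s) ↦ (x, ε s)`. -/
def stretch (ε : ℝ) (p : E3 × ℝ) : E3 × ℝ := (p.1, ε * p.2)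

theorem measurable_stretch (ε : ℝ) : Measurable (stretch ε) := by
  unfold stretch
  fun_prop

theorem stretch_stretch_inv {ε : ℝ} (hε : ε ≠ 0) (p : E3 × ℝ) :
    stretch ε (stretch ε⁻¹ p) = p := by
  simp [stretch, hε]

theorem stretch_inv_stretch {ε : ℝ} (hε : ε ≠ 0) (p : E3 × ℝ) :
    stretch ε⁻¹ (stretch ε p) = p := by
  simp [stretch, hε]

theorem measurableEmbedding_stretch {ε : ℝ} (hε : ε ≠ 0) : MeasurableEmbedding (stretch ε) := by
  refine Continuous.measurableEmbedding ?_ fun x y h => ?_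
  · unfold stretch
    fun_prop
  · rw [← stretch_inv_stretch hε x, h, stretch_inv_stretch hε]

theorem map_stretch (Ω : Set E3) [SFinite (surfaceMeasure Ω)] {ε : ℝ} (hε : 0 < ε) :
    (cylMeasure Ω 1).map (stretch ε) = ENNReal.ofReal ε⁻¹ • cylMeasure Ω ε := by
  have h1 : (volume.restrict (Ioo (-1 : ℝ) 1)).map (ε * ·) =
      ENNReal.ofReal ε⁻¹ • volume.restrict (Ioo (-ε) ε) := by
    have h2 : Ioo (-1 : ℝ) 1 = (ε * ·) ⁻¹' Ioo (-ε) ε := by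
      ext t
      simp only [mem_Ioo, mem_preimage]
      constructor
      · rintro ⟨h1, h2⟩; constructor <;> nlinarith
      · rintro ⟨h1, h2⟩; constructor <;> nlinarith
    rw [h2, ← Measure.restrict_map (measurable_const_mul ε) measurableSet_Ioo,
      Real.map_volume_mul_left hε.ne', Measure.restrict_smul, abs_of_pos (inv_pos.mpr hε)]
  have h2 : stretch ε = Prod.map id (ε * ·) := rfl
  rw [cylMeasure, h2, ← Measure.map_prod_map _ _ measurable_id (measurable_const_mul ε), h1,
    Measure.map_id, Measure.prod_smul_right, cylMeasure]

theorem map_stretch_inv (Ω : Set E3) [SFinite (surfaceMeasure Ω)] {ε : ℝ} (hε : 0 < ε) :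
    (cylMeasure Ω ε).map (stretch ε⁻¹) = ENNReal.ofReal ε • cylMeasure Ω 1 := by
  have h1 : cylMeasure Ω ε = ENNReal.ofReal ε • (cylMeasure Ω 1).map (stretch ε) := by
    rw [map_stretch Ω hε, smul_smul, ← ENNReal.ofReal_mul hε.le, mul_inv_cancel₀ hε.ne',
      ENNReal.ofReal_one, one_smul]
  rw [h1, Measure.map_smul, Measure.map_map (measurable_stretch _) (measurable_stretch _)]
  have h2 : stretch ε⁻¹ ∘ stretch ε = id := funext fun p => stretch_inv_stretch hε.ne' p
  rw [h2, Measure.map_id]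

theorem ae_stretch {Ω : Set E3} [SFinite (surfaceMeasure Ω)] {ε : ℝ} (hε : 0 < ε)
    {P : E3 × ℝ → Prop} (hP : ∀ᵐ p ∂(cylMeasure Ω ε), P p) :
    ∀ᵐ p ∂(cylMeasure Ω 1), P (stretch ε p) := by
  refine ae_of_ae_map (measurable_stretch ε).aemeasurable ?_
  rw [map_stretch Ω hε]
  exact Measure.smul_absolutelyContinuous hP

theorem ae_stretch_inv {Ω : Set E3} [SFinite (surfaceMeasure Ω)] {ε : ℝ} (hε : 0 < ε)
    {P : E3 × ℝ → Prop} (hP : ∀ᵐ p ∂(cylMeasure Ω 1), P p) :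
    ∀ᵐ p ∂(cylMeasure Ω ε), P (stretch ε⁻¹ p) := by
  refine ae_of_ae_map (measurable_stretch ε⁻¹).aemeasurable ?_
  rw [map_stretch_inv Ω hε]
  exact Measure.smul_absolutelyContinuous hP

theorem integrable_stretch_iff {Ω : Set E3} [SFinite (surfaceMeasure Ω)] {ε : ℝ} (hε : 0 < ε)
    {E : Type*} [NormedAddCommGroup E] {F : E3 × ℝ → E} :
    Integrable (fun p => F (stretch ε p)) (cylMeasure Ω 1) ↔ Integrable F (cylMeasure Ω ε) := by
  have h := (measurableEmbedding_stretch hε.ne').integrable_map_iff (μ := cylMeasure Ω 1) (g := F)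
  rw [map_stretch Ω hε, integrable_smul_measure (by simpa using hε) ENNReal.ofReal_ne_top] at h
  exact h.symm

theorem integral_stretch {Ω : Set E3} [SFinite (surfaceMeasure Ω)] {ε : ℝ} (hε : 0 < ε)
    {E : Type*} [NormedAddCommGroup E] [NormedSpace ℝ E] (F : E3 × ℝ → E) :
    ∫ p, F (stretch ε p) ∂(cylMeasure Ω 1) = ε⁻¹ • ∫ p, F p ∂(cylMeasure Ω ε) := by
  rw [← (measurableEmbedding_stretch hε.ne').integral_map, map_stretch Ω hε,
    integral_smul_measure, ENNReal.toReal_ofReal (inv_pos.mpr hε).le]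


end DiracShell

end

noncomputable section

namespace DiracShell

/-! ### The operators `𝓘_ε` and `𝓢_ε` -/

theorem matOp_coeFn {X : Type*} [MeasurableSpace X] {μ : Measure X}
    (M : Matrix (Fin 4) (Fin 4) ℂ) (f : Lp Spinor 2 μ) :
    ∀ᵐ x ∂μ, matOp μ M f x = act M (f x) :=
  (act M).coeFn_compLpL (p := 2) f

theorem IsTubular.exists_tubeOp {Ω : Set E3} {ε : ℝ} (h : IsTubular Ω ε) :
    ∃ I : L2Cyl Ω ε ≃L[ℂ] L2Shell Ω ε, IsTubeOp I ∧
      (∀ f : L2Cyl Ω ε, ∀ᵐ y ∂(volume.restrict (shell Ω ε)), I f y = f (tubeInv Ω ε y)) ∧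
      ∀ F : L2Shell Ω ε, ∀ᵐ p ∂(cylMeasure Ω ε), I.symm F p = F (tube Ω p) := by
  obtain ⟨L, hL⟩ := exists_compLp (tubeInv Ω ε) h.aemeasurable_tubeInv 1 2 h.map_tubeInv_le
  obtain ⟨K, hK⟩ := exists_compLp (tube Ω) h.aemeasurable_tube 1 2 h.map_tube_le
  simp only [one_smul] at hL hK
  have hI : ∀ f : L2Cyl Ω ε, ∀ᵐ p ∂(cylMeasure Ω ε), L f (tube Ω p) = f p := by
    intro f
    filter_upwards [h.ae_tube (hL f), h.ae_mem_collar] with p hp hpc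
    rw [hp, h.tubeInv_tube hpc]
  have h1 : Function.LeftInverse K L := by
    intro f
    refine Lp.ext ?_
    filter_upwards [hK (L f), hI f] with p h1 h2
    rw [h1, h2]
  have h2 : Function.RightInverse K L := by
    intro F
    refine Lp.ext ?_
    filter_upwards [hL (K F), h.ae_tubeInv (hK F),
      ae_restrict_mem (measurableSet_shell Ω ε)] with y h1 h2 hy
    rw [h1, h2, h.tube_tubeInv hy]
  exact ⟨ContinuousLinearEquiv.equivOfInverse L K h1 h2, hI, hL, hK⟩

theorem exists_scalingOp (Ω : Set E3) [SFinite (surfaceMeasure Ω)] {ε : ℝ} (hε : 0 < ε) :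
    ∃ S : L2Cyl Ω 1 ≃ₗᵢ[ℂ] L2Cyl Ω ε, IsScalingOp S ∧
      ∀ f : L2Cyl Ω ε, ∀ᵐ p ∂(cylMeasure Ω 1),
        S.symm f p = ((Real.sqrt ε : ℝ) : ℂ) • f (stretch ε p) := by
  obtain ⟨L, hL⟩ := exists_compLp (stretch ε⁻¹) (measurable_stretch _).aemeasurable
    (((Real.sqrt ε)⁻¹ : ℝ) : ℂ) ε (map_stretch_inv Ω hε).le
  obtain ⟨K, hK⟩ := exists_compLp (stretch ε) (measurable_stretch _).aemeasurable
    ((Real.sqrt ε : ℝ) : ℂ) ε⁻¹ (map_stretch Ω hε).le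
  have hs : Real.sqrt ε ≠ 0 := (Real.sqrt_pos.mpr hε).ne'
  have h1 : Function.LeftInverse K L := by
    intro f
    refine Lp.ext ?_
    filter_upwards [hK (L f), ae_stretch hε (hL f)] with p h1 h2
    rw [h1, h2, stretch_inv_stretch hε.ne', smul_smul, ← Complex.ofReal_mul, mul_inv_cancel₀ hs,
      Complex.ofReal_one, one_smul]
  have h2 : Function.RightInverse K L := by
    intro F
    refine Lp.ext ?_
    filter_upwards [hL (K F), ae_stretch_inv hε (hK F)] with y h1 h2
    rw [h1, h2, stretch_stretch_inv hε.ne', smul_smul, ← Complex.ofReal_mul, inv_mul_cancel₀ hs,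
      Complex.ofReal_one, one_smul]
  have hn : ∀ f, ‖L f‖ = ‖f‖ := by
    intro f
    have hsq : eLpNorm (L f) 2 (cylMeasure Ω ε) ^ 2 = eLpNorm f 2 (cylMeasure Ω 1) ^ 2 := by
      rw [eLpNorm_two_sq, eLpNorm_two_sq]
      have h3 : ∀ᵐ p ∂(cylMeasure Ω ε), ‖L f p‖ₑ ^ 2 =
          ENNReal.ofReal ε⁻¹ * ‖f (stretch ε⁻¹ p)‖ₑ ^ 2 := by
        filter_upwards [hL f] with p hp
        rw [hp, enorm_smul, mul_pow, ← ofReal_norm, ← ENNReal.ofReal_pow (norm_nonneg _),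
          Complex.norm_real, Real.norm_eq_abs, sq_abs, inv_pow, Real.sq_sqrt hε.le]
      rw [lintegral_congr_ae h3, lintegral_const_mul' _ _ ENNReal.ofReal_ne_top,
        ← (measurableEmbedding_stretch (inv_pos.mpr hε).ne').lintegral_map
          (fun p => ‖f p‖ₑ ^ 2), map_stretch_inv Ω hε, lintegral_smul_measure, smul_eq_mul,
        ← mul_assoc, ← ENNReal.ofReal_mul (inv_pos.mpr hε).le, inv_mul_cancel₀ hε.ne',
        ENNReal.ofReal_one, one_mul]
    -- The factor `ε⁻¹` from squaring `ε^{-1/2}` has cancelled the dilation factor `ε`, so the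
    -- squared seminorms agree.
    rw [Lp.norm_def, Lp.norm_def, (ENNReal.pow_right_strictMono two_ne_zero).injective hsq]
  refine ⟨⟨(ContinuousLinearEquiv.equivOfInverse L K h1 h2).toLinearEquiv, hn⟩, fun g => ?_, hK⟩
  filter_upwards [hL g] with p hp
  refine hp.trans ?_
  rw [stretch, div_eq_inv_mul]

/-! ### The potentials -/

section Potential

variable {Ω : Set E3} {V : ℝ → ℝ} {η ε : ℝ}

theorem shellPot_tube (h : IsTubular Ω ε) {p : E3 × ℝ} (hp : p ∈ collar Ω ε) :
    shellPot Ω V η ε (tube Ω p) = scaledPot V η ε p.2 := by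
  rw [shellPot, if_pos (tube_mem_shell h.domain hp)]
  exact congrArg (fun q : E3 × ℝ => scaledPot V η ε q.2) (h.tubeInv_tube hp)

theorem shellPot_eq_zero {x : E3} (hx : x ∉ shell Ω ε) : shellPot Ω V η ε x = 0 := if_neg hx

theorem shellV_eq_zero {x : E3} (hx : x ∉ shell Ω ε) : shellV Ω V η ε x = 0 := by
  rw [shellV, shellPot_eq_zero hx]
  simp

theorem sign_mul_sqrt_mul_sqrt (x : ℝ) : Real.sign x * √|x| * √|x| = x := by
  rw [mul_assoc, Real.mul_self_sqrt (abs_nonneg x)]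
  rcases lt_trichotomy x 0 with h | h | h
  · rw [Real.sign_of_neg h, abs_of_neg h, neg_one_mul, neg_neg]
  · rw [h, abs_zero, mul_zero]
  · rw [Real.sign_of_pos h, abs_of_pos h, one_mul]

theorem shellV_mul_shellU (x : E3) :
    shellV Ω V η ε x * shellU Ω V η ε x = shellPot Ω V η ε x :=
  sign_mul_sqrt_mul_sqrt _

theorem abs_sign_le_one (x : ℝ) : |Real.sign x| ≤ 1 := by
  rcases Real.sign_apply_eq x with h | h | h <;> simp [h]

theorem measurable_sign : Measurable Real.sign := by
  unfold Real.sign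
  exact Measurable.ite measurableSet_Iio measurable_const
    (Measurable.ite measurableSet_Ioi measurable_const measurable_const)

/-- Since `V_ε(εt) = (η/ε) V(ηt)`, the factor `√ε` produced by `𝓢_ε⁻¹` exactly removes the `ε` from
`|V_ε|^{1/2}`. -/
theorem shellU_stretch (h : IsTubular Ω ε) (hη : 0 < η) {p : E3 × ℝ}
    (hp : stretch ε p ∈ collar Ω ε) :
    √ε * shellU Ω V η ε (tube Ω (stretch ε p)) = profU V η p.2 := by
  have hε := h.pos
  have h1 : η * (ε * p.2) / ε = η * p.2 := by field_simp
  rw [shellU, shellPot_tube h hp, scaledPot, stretch, h1, ← Real.sqrt_mul hε.le, profU]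
  congr 1
  rw [abs_mul, abs_mul, abs_div, abs_of_pos hε]
  field_simp

theorem shellV_stretch (h : IsTubular Ω ε) (hη : 0 < η) {p : E3 × ℝ}
    (hp : stretch ε p ∈ collar Ω ε) :
    √ε * shellV Ω V η ε (tube Ω (stretch ε p)) = profV V η p.2 := by
  have hε := h.pos
  have h0 := shellU_stretch (V := V) h hη hp
  have h1 : η * (ε * p.2) / ε = η * p.2 := by field_simp
  have h2 : Real.sign (shellPot Ω V η ε (tube Ω (stretch ε p))) = Real.sign (V (η * p.2)) := by
    rw [shellPot_tube h hp, scaledPot, stretch, h1]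
    have hpos : 0 < η / ε := div_pos hη hε
    rcases lt_trichotomy (V (η * p.2)) 0 with hv | hv | hv
    · rw [Real.sign_of_neg hv, Real.sign_of_neg (mul_neg_of_pos_of_neg hpos hv)]
    · rw [hv, mul_zero]
    · rw [Real.sign_of_pos hv, Real.sign_of_pos (mul_pos hpos hv)]
  rw [shellV, h2, profV, ← h0, shellU]
  ring

theorem quasiMeasurePreserving_scale (hη : 0 < η) (hε : 0 < ε) :
    Measure.QuasiMeasurePreserving (fun t : ℝ => η * t / ε) volume volume := by
  have h1 : (fun t : ℝ => η * t / ε) = fun t => (η / ε) * t := by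
    funext t
    ring
  rw [h1]
  refine ⟨measurable_const_mul _, ?_⟩
  rw [Real.map_volume_mul_left (div_pos hη hε).ne']
  exact Measure.smul_absolutelyContinuous

theorem quasiMeasurePreserving_snd_cylMeasure (Ω : Set E3) (ε : ℝ) :
    Measure.QuasiMeasurePreserving (Prod.snd : E3 × ℝ → ℝ) (cylMeasure Ω ε) volume :=
  ⟨measurable_snd, Measure.quasiMeasurePreserving_snd.absolutelyContinuous.trans
    Measure.restrict_le_self.absolutelyContinuous⟩

/-- `V` is measurable and bounded only up to null sets. Both properties survive composition because
the inverse tubular coordinates, the projection to `t` and the dilation pull null sets back to null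
sets. -/
theorem shellPot_bounds (h : IsTubular Ω ε) (hη : 0 < η) (hV : MemLp V ∞ volume) :
    AEStronglyMeasurable (shellPot Ω V η ε) (volume.restrict (shell Ω ε)) ∧
      ∃ M, ∀ᵐ x ∂(volume.restrict (shell Ω ε)), |shellPot Ω V η ε x| ≤ M := by
  have hq := (quasiMeasurePreserving_scale hη h.pos).comp
    (quasiMeasurePreserving_snd_cylMeasure Ω ε)
  have heq : ∀ᵐ y ∂(volume.restrict (shell Ω ε)),
      scaledPot V η ε (tubeInv Ω ε y).2 = shellPot Ω V η ε y := by
    filter_upwards [ae_restrict_mem (measurableSet_shell Ω ε)] with y hy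
    rw [shellPot, if_pos hy, tubeInv]
  constructor
  · have h1 : AEStronglyMeasurable (fun p : E3 × ℝ => scaledPot V η ε p.2) (cylMeasure Ω ε) :=
      (hV.1.comp_quasiMeasurePreserving hq).const_mul (η / ε)
    have h2 : AEStronglyMeasurable (fun p : E3 × ℝ => scaledPot V η ε p.2)
        ((volume.restrict (shell Ω ε)).map (tubeInv Ω ε)) :=
      h1.mono_ac (Measure.absolutelyContinuous_of_le_smul h.map_tubeInv_le)
    exact (h2.comp_aemeasurable h.aemeasurable_tubeInv).congr heq
  · have hb : ∀ᵐ t, ‖V t‖ₑ ≤ eLpNorm V ∞ volume := by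
      rw [eLpNorm_exponent_top]
      exact ae_le_eLpNormEssSup
    refine ⟨η / ε * (eLpNorm V ∞ volume).toReal, ?_⟩
    filter_upwards [heq, h.ae_tubeInv (hq.ae hb)] with y hy hy2
    rw [← hy, scaledPot, abs_mul, abs_of_pos (div_pos hη h.pos)]
    refine mul_le_mul_of_nonneg_left ?_ (div_pos hη h.pos).le
    have h3 := ENNReal.toReal_mono hV.2.ne hy2
    rwa [toReal_enorm] at h3

theorem exists_potential_ops (h : IsTubular Ω ε) (hη : 0 < η) (hV : MemLp V ∞ volume) :
    ∃ (u : L2R3 →L[ℂ] L2Shell Ω ε) (v : L2Shell Ω ε →L[ℂ] L2R3) (W : L2R3 →L[ℂ] L2R3),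
      IsMulOp (shellU Ω V η ε) u ∧ IsMulOp (shellV Ω V η ε) v ∧ IsMulOp (shellPot Ω V η ε) W := by
  obtain ⟨hm, M, hM⟩ := shellPot_bounds h hη hV
  have hs := measurableSet_shell Ω ε
  have hUm : AEStronglyMeasurable (shellU Ω V η ε) (volume.restrict (shell Ω ε)) :=
    (Real.continuous_sqrt.comp continuous_abs).comp_aestronglyMeasurable hm
  have hVm : AEStronglyMeasurable (shellV Ω V η ε) (volume.restrict (shell Ω ε)) :=
    (measurable_sign.comp_aemeasurable hm.aemeasurable).aestronglyMeasurable.mul hUm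
  have hUb : ∀ᵐ x ∂(volume.restrict (shell Ω ε)), ‖shellU Ω V η ε x‖ ≤ √M := by
    filter_upwards [hM] with x hx
    rw [shellU, Real.norm_of_nonneg (Real.sqrt_nonneg _)]
    exact Real.sqrt_le_sqrt hx
  have hVb : ∀ᵐ x ∂(volume.restrict (shell Ω ε)), ‖shellV Ω V η ε x‖ ≤ √M := by
    filter_upwards [hUb] with x hx
    refine le_trans ?_ hx
    rw [shellV, norm_mul]
    exact mul_le_of_le_one_left (norm_nonneg _) (abs_sign_le_one _)
  obtain ⟨LU, hLU⟩ := exists_mulExt hs _ hUm _ hUb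
  obtain ⟨LV, hLV⟩ := exists_mulExt hs _ hVm _ hVb
  obtain ⟨LW, hLW⟩ := exists_mulExt hs _ hm M hM
  set res : L2R3 →L[ℂ] L2Shell Ω ε := LpToLpRestrictCLM E3 Spinor ℂ volume 2 (shell Ω ε) with hres
  have hr : ∀ f : L2R3, ∀ᵐ x ∂(volume.restrict (shell Ω ε)), res f x = f x := fun f =>
    LpToLpRestrictCLM_coeFn ℂ (shell Ω ε) f
  have hr' : ∀ f : L2R3, ∀ᵐ x, x ∈ shell Ω ε → res f x = f x := fun f =>
    (ae_restrict_iff' hs).mp (hr f)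
  -- `LU` multiplies and extends by zero, so it is preceded and followed by restriction to get a map
  -- into functions on the shell; `LV` already maps outward, and `LW` only needs the first
  -- restriction.
  refine ⟨res ∘L LU ∘L res, LV, LW ∘L res, fun f => ?_, fun f => ?_, fun f => ?_⟩
  · filter_upwards [hr (LU (res f)), ae_restrict_of_ae (hLU (res f)), hr f,
      ae_restrict_mem hs] with x h1 h2 h3 hx
    rw [ContinuousLinearMap.comp_apply, ContinuousLinearMap.comp_apply, h1, h2,
      indicator_of_mem hx, h3]
  · filter_upwards [hLV f] with x hx
    rw [hx]
    by_cases hxs : x ∈ shell Ω ε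
    · rw [indicator_of_mem hxs]
    · rw [indicator_of_notMem hxs, shellV_eq_zero hxs, Complex.ofReal_zero, zero_smul]
  · filter_upwards [hLW (res f), hr' f] with x h1 h2
    rw [ContinuousLinearMap.comp_apply, h1]
    by_cases hxs : x ∈ shell Ω ε
    · rw [indicator_of_mem hxs, h2 hxs]
    · rw [indicator_of_notMem hxs, shellPot_eq_zero hxs, Complex.ofReal_zero, zero_smul]

end Potential

theorem im_inner_eq_zero_of_ae {f g : L2R3}
    (h : ∀ᵐ x, inner ℂ (f x) (g x) = inner ℂ (g x) (f x)) : (inner ℂ f g).im = 0 := by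
  have h1 : inner ℂ f g = inner ℂ g f := by
    rw [L2.inner_def, L2.inner_def]
    exact integral_congr_ae h
  have h2 := congrArg Complex.im h1
  rw [← inner_conj_symm f g, Complex.conj_im] at h2 ⊢
  linarith

theorem IsMulOp.im_inner {w : E3 → ℝ} {W : L2R3 →L[ℂ] L2R3} (hW : IsMulOp w W) (f : L2R3) :
    (inner ℂ f (W f)).im = 0 := by
  refine im_inner_eq_zero_of_ae ?_
  filter_upwards [hW f] with x hx
  rw [hx, inner_smul_left, inner_smul_right, Complex.conj_ofReal]

theorem IsMulOp.im_inner_betaMat {w : E3 → ℝ} {W : L2R3 →L[ℂ] L2R3} (hW : IsMulOp w W)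
    (f : L2R3) : (inner ℂ f ((matOp volume betaMat ∘L W) f)).im = 0 := by
  refine im_inner_eq_zero_of_ae ?_
  filter_upwards [hW f, matOp_coeFn betaMat (W f)] with x hx hx2
  rw [ContinuousLinearMap.comp_apply, hx2, hx, map_smul, inner_smul_left, inner_smul_right,
    Complex.conj_ofReal, inner_act_betaMat]

end DiracShell

end

noncomputable section

namespace DiracShell

/-! ### The integral kernels -/

variable {Ω : Set E3} {V : ℝ → ℝ} {η ε m : ℝ} {a : ℂ}
  {I : L2Cyl Ω ε ≃L[ℂ] L2Shell Ω ε} {S : L2Cyl Ω 1 ≃ₗᵢ[ℂ] L2Cyl Ω ε}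
  {u : L2R3 →L[ℂ] L2Shell Ω ε} {v : L2Shell Ω ε →L[ℂ] L2R3}

/-- Properties which hold almost everywhere in the shell hold almost everywhere on
`Σ × (-1, 1)` in rescaled tubular coordinates. -/
theorem IsTubular.ae_tube_stretch (h : IsTubular Ω ε) {P : E3 → Prop}
    (hP : ∀ᵐ y ∂(volume.restrict (shell Ω ε)), P y) :
    ∀ᵐ p ∂(cylMeasure Ω 1), P (tube Ω (stretch ε p)) := by
  have := h.isFiniteMeasure
  exact ae_stretch h.pos (h.ae_tube hP)

theorem IsTubular.ae_stretch_mem (h : IsTubular Ω ε) :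
    ∀ᵐ p ∂(cylMeasure Ω 1), stretch ε p ∈ collar Ω ε := by
  have := h.isFiniteMeasure
  exact ae_stretch h.pos h.ae_mem_collar

theorem symm_symm_mul_apply (h : IsTubular Ω ε) (hη : 0 < η)
    (hI : ∀ F : L2Shell Ω ε, ∀ᵐ p ∂(cylMeasure Ω ε), I.symm F p = F (tube Ω p))
    (hS : ∀ f : L2Cyl Ω ε, ∀ᵐ p ∂(cylMeasure Ω 1),
      S.symm f p = ((Real.sqrt ε : ℝ) : ℂ) • f (stretch ε p))
    (hu : IsMulOp (shellU Ω V η ε) u) (f : L2R3) :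
    ∀ᵐ p ∂(cylMeasure Ω 1), S.symm (I.symm (u f)) p =
      (profU V η p.2 : ℂ) • f (tube Ω (stretch ε p)) := by
  have := h.isFiniteMeasure
  filter_upwards [hS (I.symm (u f)), ae_stretch h.pos (hI (u f)), h.ae_tube_stretch (hu f),
    h.ae_stretch_mem] with p h1 h2 h3 hp
  rw [h1, h2, h3, smul_smul, ← Complex.ofReal_mul, shellU_stretch h hη hp]

/-- Postcomposing with `𝓢_ε⁻¹ 𝓘_ε⁻¹ 𝐮_ε` evaluates the output at the tubular point and multiplies by
`u(t)`, so it acts on the first variable of the kernel. Both `B` and `C` are obtained this way. -/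
theorem isKernelOp_symm_symm_mul (h : IsTubular Ω ε) (hη : 0 < η)
    (hI : ∀ F : L2Shell Ω ε, ∀ᵐ p ∂(cylMeasure Ω ε), I.symm F p = F (tube Ω p))
    (hS : ∀ f : L2Cyl Ω ε, ∀ᵐ p ∂(cylMeasure Ω 1),
      S.symm f p = ((Real.sqrt ε : ℝ) : ℂ) • f (stretch ε p))
    (hu : IsMulOp (shellU Ω V η ε) u) {X : Type*} [MeasurableSpace X] {μ : Measure X}
    {K : E3 → X → Matrix (Fin 4) (Fin 4) ℂ} {T : Lp Spinor 2 μ →L[ℂ] L2R3} (hT : IsKernelOp K T)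
    {T' : Lp Spinor 2 μ →L[ℂ] L2Cyl Ω 1} (hT' : ∀ f, T' f = S.symm (I.symm (u (T f)))) :
    IsKernelOp (fun p x => (profU V η p.2 : ℂ) • K (tube Ω (stretch ε p)) x) T' := by
  intro f
  filter_upwards [symm_symm_mul_apply h hη hI hS hu (T f),
    h.ae_tube_stretch (ae_restrict_of_ae (hT f))] with p h1 ⟨h2, h3⟩
  simp only [act_smul, _root_.smul_apply]
  exact ⟨h2.fun_smul _, by rw [hT', h1, h3, integral_smul]⟩

/-- One factor `ε^{-1/2}` comes from `𝓢_ε` and another from `𝐯_ε`. Their product `ε⁻¹` is later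
cancelled by `dt = ε ds`. -/
theorem mul_tube_scaling_apply (h : IsTubular Ω ε) (hη : 0 < η) (hI : IsTubeOp I)
    (hS : IsScalingOp S) (hv : IsMulOp (shellV Ω V η ε) v) (g : L2Cyl Ω 1) :
    ∀ᵐ q ∂(cylMeasure Ω 1), v (I (S g)) (tube Ω (stretch ε q)) =
      ((ε⁻¹ * profV V η q.2 : ℝ) : ℂ) • g q := by
  have := h.isFiniteMeasure
  have hε := h.pos
  filter_upwards [h.ae_tube_stretch (ae_restrict_of_ae (hv (I (S g)))),
    ae_stretch hε (hI (S g)), ae_stretch hε (hS g), h.ae_stretch_mem] with q h1 h2 h3 hq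
  have h4 : ((stretch ε q).1, (stretch ε q).2 / ε) = q := by
    simp [stretch, hε.ne']
  rw [h1, h2, h3, h4, smul_smul, ← Complex.ofReal_mul, ← shellV_stretch h hη hq]
  congr 2
  have h5 : √ε ≠ 0 := (Real.sqrt_pos.mpr hε).ne'
  field_simp
  rw [Real.sq_sqrt hε.le, mul_comm]

theorem isKernelOp_kerA (h : IsTubular Ω ε) (hη : 0 < η) (hI : IsTubeOp I)
    (hS : IsScalingOp S) (hv : IsMulOp (shellV Ω V η ε) v) {Φ : L2R3 →L[ℂ] L2R3}
    (hΦ : IsKernelOp (kerPhi m a) Φ) {A : L2Cyl Ω 1 →L[ℂ] L2R3}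
    (hA : ∀ g, A g = Φ (v (I (S g)))) : IsKernelOp (kerA Ω V η ε m a) A := by
  have := h.isFiniteMeasure
  have hε := h.pos
  intro g
  have hz : ∀ᵐ y, y ∉ shell Ω ε → v (I (S g)) y = 0 := by
    filter_upwards [hv (I (S g))] with y hy hys
    rw [hy, shellV_eq_zero hys, Complex.ofReal_zero, zero_smul]
  filter_upwards [hΦ (v (I (S g)))] with x ⟨hint, hx⟩
  set F : E3 → Spinor := fun y => act (kerPhi m a x y) (v (I (S g)) y) with hF
  have hFm : AEStronglyMeasurable F (volume.restrict (shell Ω ε)) :=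
    hint.aestronglyMeasurable.restrict
  have hzF : ∀ᵐ y, y ∉ shell Ω ε → F y = 0 := by
    filter_upwards [hz] with y hy hys
    rw [hF]
    simp only [hy hys, map_zero]
  -- The integrand vanishes outside the shell, so the integral over space is an integral over the
  -- shell. It is moved first to `Σ × (-ε, ε)`, with the Jacobian, and then to `Σ × (-1, 1)`.
  have hi := (integrable_stretch_iff hε).mpr ((h.integrable_tube_iff hFm).mpr hint.integrableOn)
  have he := integral_stretch (Ω := Ω) hε fun p : E3 × ℝ => jac Ω p.2 p.1 • F (tube Ω p)
  rw [h.integral_tube hFm, setIntegral_eq_integral_of_ae_compl_eq_zero hzF, ← hx] at he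
  have hpt : ∀ᵐ q ∂(cylMeasure Ω 1),
      jac Ω (stretch ε q).2 (stretch ε q).1 • F (tube Ω (stretch ε q)) =
        ε⁻¹ • act (kerA Ω V η ε m a x q) (g q) := by
    filter_upwards [mul_tube_scaling_apply h hη hI hS hv g] with q hq
    simp only [hF]
    rw [hq, map_smul, kerA, act_smul, _root_.smul_apply]
    simp only [← Complex.coe_smul, smul_smul, ← Complex.ofReal_mul]
    congr 2
    simp only [stretch]
    ring
  rw [integral_congr_ae hpt, integral_smul] at he
  have hi2 := (integrable_congr hpt).mp hi
  refine ⟨?_, ?_⟩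
  · have h3 := hi2.smul ε
    refine h3.congr (ae_of_all _ fun q => ?_)
    simp only [Pi.smul_apply, smul_smul, mul_inv_cancel₀ hε.ne', one_smul]
  · rw [hA]
    exact (smul_right_injective _ (inv_pos.mpr hε).ne' he).symm

theorem isKernelOp_kerC (h : IsTubular Ω ε) (hη : 0 < η)
    (hI : ∀ F : L2Shell Ω ε, ∀ᵐ p ∂(cylMeasure Ω ε), I.symm F p = F (tube Ω p))
    (hS : ∀ f : L2Cyl Ω ε, ∀ᵐ p ∂(cylMeasure Ω 1),
      S.symm f p = ((Real.sqrt ε : ℝ) : ℂ) • f (stretch ε p))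
    (hu : IsMulOp (shellU Ω V η ε) u) {Φ : L2R3 →L[ℂ] L2R3} (hΦ : IsKernelOp (kerPhi m a) Φ)
    {C : L2R3 →L[ℂ] L2Cyl Ω 1} (hC : ∀ f, C f = S.symm (I.symm (u (Φ f)))) :
    IsKernelOp (kerC Ω V η ε m a) C :=
  isKernelOp_symm_symm_mul h hη hI hS hu hΦ hC

theorem isKernelOp_kerB (h : IsTubular Ω ε) (hη : 0 < η)
    (hI : ∀ F : L2Shell Ω ε, ∀ᵐ p ∂(cylMeasure Ω ε), I.symm F p = F (tube Ω p))
    (hS : ∀ f : L2Cyl Ω ε, ∀ᵐ p ∂(cylMeasure Ω 1),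
      S.symm f p = ((Real.sqrt ε : ℝ) : ℂ) • f (stretch ε p))
    (hu : IsMulOp (shellU Ω V η ε) u) {A : L2Cyl Ω 1 →L[ℂ] L2R3}
    (hA : IsKernelOp (kerA Ω V η ε m a) A)
    {B : L2Cyl Ω 1 →L[ℂ] L2Cyl Ω 1} (hB : ∀ g, B g = S.symm (I.symm (u (A g)))) :
    IsKernelOp (kerB Ω V η ε m a) B := by
  have hk : kerB Ω V η ε m a = fun p x =>
      (profU V η p.2 : ℂ) • kerA Ω V η ε m a (tube Ω (stretch ε p)) x := by
    funext p q
    rw [kerA, smul_smul, ← Complex.ofReal_mul, ← mul_assoc]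
    rfl
  rw [hk]
  exact isKernelOp_symm_symm_mul h hη hI hS hu hA hB

/-! ### Factorization of the potential -/

theorem potential_factorization {W : L2R3 →L[ℂ] L2R3} (hu : IsMulOp (shellU Ω V η ε) u)
    (hv : IsMulOp (shellV Ω V η ε) v) (hW : IsMulOp (shellPot Ω V η ε) W) (f : L2R3) :
    v (u f) = W f := by
  refine Lp.ext ?_
  have hu' : ∀ᵐ x, x ∈ shell Ω ε → u f x = (shellU Ω V η ε x : ℂ) • f x :=
    (ae_restrict_iff' (measurableSet_shell Ω ε)).mp (hu f)
  filter_upwards [hv (u f), hu', hW f] with x h1 h2 h3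
  rw [h1, h3]
  by_cases hx : x ∈ shell Ω ε
  · rw [h2 hx, smul_smul, ← Complex.ofReal_mul, shellV_mul_shellU]
  · rw [shellV_eq_zero hx, shellPot_eq_zero hx, Complex.ofReal_zero, zero_smul, zero_smul]

/-- A constant matrix commutes with composition and with scalar multiplication. This lets `β` be
moved from `Σ × (-1, 1)` to space, giving the factorization `β𝐕_ε = v β u` with `β` in the middle.
-/
theorem mul_tube_scaling_matOp (h : IsTubular Ω ε)
    (hI : ∀ f : L2Cyl Ω ε, ∀ᵐ y ∂(volume.restrict (shell Ω ε)), I f y = f (tubeInv Ω ε y))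
    (hS : IsScalingOp S) (hv : IsMulOp (shellV Ω V η ε) v) (M : Matrix (Fin 4) (Fin 4) ℂ)
    (g : L2Cyl Ω 1) :
    v (I (S (matOp (cylMeasure Ω 1) M g))) = matOp volume M (v (I (S g))) := by
  have := h.isFiniteMeasure
  have hε := h.pos
  have e1 : S (matOp (cylMeasure Ω 1) M g) = matOp (cylMeasure Ω ε) M (S g) := by
    refine Lp.ext ?_
    filter_upwards [hS (matOp (cylMeasure Ω 1) M g), matOp_coeFn M (S g), hS g,
      ae_stretch_inv hε (matOp_coeFn M g)] with p h1 h2 h3 h4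
    have h5 : stretch ε⁻¹ p = (p.1, p.2 / ε) := by rw [stretch, div_eq_inv_mul]
    rw [h5] at h4
    rw [h1, h2, h3, h4, map_smul]
  have e2 : ∀ f, I (matOp (cylMeasure Ω ε) M f) =
      matOp (volume.restrict (shell Ω ε)) M (I f) := by
    intro f
    refine Lp.ext ?_
    filter_upwards [hI (matOp (cylMeasure Ω ε) M f), matOp_coeFn M (I f), hI f,
      h.ae_tubeInv (matOp_coeFn M f)] with p h1 h2 h3 h4
    rw [h1, h2, h3, h4]
  have e3 : ∀ f, v (matOp (volume.restrict (shell Ω ε)) M f) = matOp volume M (v f) := by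
    intro f
    have h4 : ∀ᵐ x, x ∈ shell Ω ε → matOp (volume.restrict (shell Ω ε)) M f x = act M (f x) :=
      (ae_restrict_iff' (measurableSet_shell Ω ε)).mp (matOp_coeFn M f)
    refine Lp.ext ?_
    filter_upwards [hv (matOp (volume.restrict (shell Ω ε)) M f), matOp_coeFn M (v f), hv f,
      h4] with x h1 h2 h3 h4
    rw [h1, h2, h3]
    by_cases hx : x ∈ shell Ω ε
    · rw [h4 hx, map_smul]
    · rw [shellV_eq_zero hx, Complex.ofReal_zero, zero_smul, zero_smul, map_zero]
  rw [e1, e2, e3]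

theorem matOp_betaMat_mul_self {X : Type*} [MeasurableSpace X] (μ : Measure X) :
    matOp μ betaMat * matOp μ betaMat = 1 := by
  ext1 f
  refine Lp.ext ?_
  filter_upwards [matOp_coeFn betaMat (matOp μ betaMat f), matOp_coeFn betaMat f] with x h1 h2
  rw [mul_apply_eq_comp, h1, h2, act_betaMat_betaMat, one_apply_eq_self]

/-- Sufficiently narrow collars of the boundary of a `C²` domain are tubular. -/
theorem IsC2Domain.exists_isTubular (hΩ : IsC2Domain Ω) :
    ∃ η₀ : ℝ, 0 < η₀ ∧ ∀ ε, 0 < ε → ε ≤ η₀ → IsTubular Ω ε := by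
  obtain ⟨K, hK0, hK⟩ := hΩ.exists_abs_inner_le
  obtain ⟨η, hη, hj⟩ := hΩ.exists_jac_bounds
  have hK1 : 0 < 2 * K + 1 := by positivity
  -- The second bound gives `2εK ≤ 1 - ε < 1`, the injectivity condition; the first keeps the
  -- Jacobian in `[1/2, 2]`.
  refine ⟨min η (1 / (2 * K + 1)), lt_min hη (by positivity), fun ε hε hle => ?_⟩
  have h1 : ε ≤ η := hle.trans (min_le_left _ _)
  have h2 : ε * (2 * K + 1) ≤ 1 := (le_div_iff₀ hK1).mp (hle.trans (min_le_right _ _))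
  have hb : ∀ p ∈ collar Ω ε, |p.2| < η := fun p hp => (abs_lt.mpr hp.2).trans_le h1
  exact ⟨hΩ, hε, tube_injOn hΩ hK (by nlinarith), fun p hp => (hj p.1 hp.1 p.2 (hb p hp)).1,
    fun p hp => (hj p.1 hp.1 p.2 (hb p hp)).2⟩

end DiracShell

end

theorem lemma3p1 (Ω : Set E3) (hΩ : IsC2Domain Ω) :
    ∃ η₀ : ℝ, 0 < η₀ ∧
      ∀ (m : ℝ) (_ : 0 < m) (a : ℂ) (_ : a.im ≠ 0) (η : ℝ) (_ : 0 < η) (_ : η ≤ η₀)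
        (V : ℝ → ℝ) (_ : MemLp V ∞ volume) (_ : ∀ᵐ t, t ∉ Icc (-η) η → V t = 0)
        (ε : ℝ) (_ : 0 < ε) (_ : ε ≤ η),
      BijOn (tube Ω) (collar Ω ε) (shell Ω ε) ∧
      ∃ (Φ : L2R3 →L[ℂ] L2R3)
        (A : L2Cyl Ω 1 →L[ℂ] L2R3)
        (B : L2Cyl Ω 1 →L[ℂ] L2Cyl Ω 1)
        (C : L2R3 →L[ℂ] L2Cyl Ω 1)
        (I : L2Cyl Ω ε ≃L[ℂ] L2Shell Ω ε)
        (S : L2Cyl Ω 1 ≃ₗᵢ[ℂ] L2Cyl Ω ε)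
        (u : L2R3 →L[ℂ] L2Shell Ω ε)
        (v : L2Shell Ω ε →L[ℂ] L2R3)
        (W : L2R3 →L[ℂ] L2R3)
        (R Re Rs : L2R3 →L[ℂ] L2R3),
        -- the operators of the statement, which exist as bounded operators
        IsKernelOp (kerPhi m a) Φ ∧
        IsKernelOp (kerA Ω V η ε m a) A ∧
        IsKernelOp (kerB Ω V η ε m a) B ∧
        IsKernelOp (kerC Ω V η ε m a) C ∧
        IsTubeOp I ∧
        IsScalingOp S ∧
        IsMulOp (shellU Ω V η ε) u ∧
        IsMulOp (shellV Ω V η ε) v ∧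
        IsMulOp (shellPot Ω V η ε) W ∧
        IsResolvent (diracOp m) a R ∧
        IsResolvent (perturb (diracOp m) W) a Re ∧
        IsResolvent (perturb (diracOp m) (matOp volume betaMat ∘L W)) a Rs ∧
        -- the factorizations
        (∀ g, A g = Φ (v (I (S g)))) ∧
        (∀ g, B g = S.symm (I.symm (u (Φ (v (I (S g))))))) ∧
        (∀ f, C f = S.symm (I.symm (u (Φ f)))) ∧
        -- the resolvent formulae
        IsUnit (1 + B) ∧
        Re = R - A ∘L Ring.inverse (1 + B) ∘L C ∧
        IsUnit (matOp (cylMeasure Ω 1) betaMat + B) ∧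
        Rs = R - A ∘L Ring.inverse (matOp (cylMeasure Ω 1) betaMat + B) ∘L C := by
  obtain ⟨η₀, hη₀, hη₀'⟩ := hΩ.exists_isTubular
  refine ⟨η₀, hη₀, fun m _ a ha η hη hηη V hV _ ε hε hεη => ?_⟩
  have h : IsTubular Ω ε := hη₀' ε hε (hεη.trans hηη)
  have := h.isFiniteMeasure
  obtain ⟨Φ, hΦ⟩ := exists_isKernelOp_kerPhi m ha
  obtain ⟨I, hI, hI1, hI2⟩ := h.exists_tubeOp
  obtain ⟨S, hS, hS2⟩ := exists_scalingOp Ω hε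
  obtain ⟨u, v, W, hu, hv, hW⟩ := exists_potential_ops h hη hV
  have hR : IsResolvent (diracOp m) a Φ := isResolvent_of_isKernelOp ha hΦ
  obtain ⟨Re, hRe⟩ := hR.exists_perturb (realForm_diracOp m) ha hW.im_inner
  obtain ⟨Rs, hRs⟩ := hR.exists_perturb (realForm_diracOp m) ha hW.im_inner_betaMat
  -- The factors of the potential on `Σ × (-1, 1)`. By construction `Φ v' = A`, `u' Φ = C` and `u' Φ
  -- v' = B`, so the operator identities hold definitionally; in `v' u'` the maps `𝓘_ε` and `𝓢_ε`
  -- cancel, leaving `𝐕_ε`.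
  set u' : L2R3 →L[ℂ] L2Cyl Ω 1 := (S.symm.toContinuousLinearEquiv : L2Cyl Ω ε →L[ℂ] L2Cyl Ω 1) ∘L
    (I.symm : L2Shell Ω ε →L[ℂ] L2Cyl Ω ε) ∘L u with hu'
  set v' : L2Cyl Ω 1 →L[ℂ] L2R3 := v ∘L (I : L2Cyl Ω ε →L[ℂ] L2Shell Ω ε) ∘L
    (S.toContinuousLinearEquiv : L2Cyl Ω 1 →L[ℂ] L2Cyl Ω ε) with hv'
  have hu1 : ∀ f, u' f = S.symm (I.symm (u f)) := fun f => rfl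
  have hv1 : ∀ g, v' g = v (I (S g)) := fun g => rfl
  have hvu : ∀ f, v' (u' f) = W f := fun f => by
    rw [hu1, hv1, S.apply_symm_apply, I.apply_symm_apply, potential_factorization hu hv hW]
  -- The abstract formula with `b = 1` for the electrostatic shell, and below with `b = β` for the
  -- scalar one.
  have he := hR.factorized hRe u' v' 1 (one_mul 1) fun f => (hvu f).symm
  have hs := hR.factorized hRs u' v' (matOp (cylMeasure Ω 1) betaMat) (matOp_betaMat_mul_self _)
    fun f => by
      rw [hv1, mul_tube_scaling_matOp h hI1 hS hv, ← hv1, hvu, ContinuousLinearMap.comp_apply]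
  have hA : IsKernelOp (kerA Ω V η ε m a) (Φ ∘L v') :=
    isKernelOp_kerA h hη hI hS hv hΦ fun g => rfl
  exact ⟨h.bijOn, Φ, Φ ∘L v', u' ∘L Φ ∘L v', u' ∘L Φ, I, S, u, v, W, Φ, Re, Rs, hΦ, hA,
    isKernelOp_kerB h hη hI2 hS2 hu hA fun g => rfl,
    isKernelOp_kerC h hη hI2 hS2 hu hΦ fun f => rfl,
    hI, hS, hu, hv, hW, hR, hRe, hRs, fun g => rfl, fun g => rfl, fun f => rfl,
    he.1, he.2, hs.1, hs.2⟩
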